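/- Let $X$ be a locally compact Hausdorff space. A **$C_0(X)$-algebra** is a $C^*$-algebra $A$ with a $*$-homomorphism $\Phi$ from $C_0(X)$ into the center of the multiplier algebra $M(A)$ such that $\Phi(C_0(X))A$ is dense in $A$; write $f\cdot a=\Phi(f)a$. Let $\otimes$ be the maximal $C^*$-tensor product, $\mathcal K$ the compact operators on $\ell^2(\mathbb N)$, $B[0,1]=C([0,1],B)$, and $SB=\{F\in B[0,1]: F(0)=F(1)=0\}$. If $B$ is a $C_0(X)$-algebra, so are $B\otimes\mathcal K$ (with $f\cdot(b\otimes k)=(f\cdot b)\otimes k$), $B[0,1]$ and $SB$ (with $(f\cdot F)(s)=f\cdot F(s)$), and $C_0(X)$ acts on $M_2(B)$ entrywise. A **$C_0(X)$-isomorphism** is a $*$-isomorphism commuting with the actions of $C_0(X)$. $B$ is **$C_0(X)$-stable** if $B\cong B\otimes\mathcal K$ by a $C_0(X)$-isomorphism. An **asymptotic $C_0(X)$-morphism** $A\to B$ is a family of maps $\psi_t:A\to B$, $t\in[1,\infty)$, such that for each $a\in A$ the map $t\mapsto\psi_t(a)$ is norm continuous and bounded, and such that for all $a,b\in A$, $\lambda\in\mathbb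 C$, $f\in C_0(X)$ the elements $$\psi_t(a+b)-\psi_t(a)-\psi_t(b),\quad \psi_t(\lambda a)-\lambda\psi_t(a),\quad \psi_t(ab)-\psi_t(a)\psi_t(b),\quad \psi_t(a^*)-\psi_t(a)^*,\quad \psi_t(f\cdot a)-f\cdot\psi_t(a)$$ tend to $0$ in norm as $t\to\infty$. Two of them, $\psi_t$ and $\phi_t$, are **$C_0(X)$-homotopic** if there is an asymptotic $C_0(X)$-morphism $\Psi_t:A\to B[0,1]$ with $\Psi_t(a)(0)=\psi_t(a)$ and $\Psi_t(a)(1)=\phi_t(a)$ for all $t,a$. This is an equivalence relation; $[\![\psi_t]\!]_X$ denotes the class of $\psi_t$ and $[\![A,B]\!]_X$ the set of classes. A **stabilization isomorphism** for $B$ is a $C_0(X)$-isomorphism $\theta:M_2(B)\to B$ that arises as a composite $$M_2(B)\cong M_2(C\otimes\mathcal K)\cong C\otimes M_2(\mathcal K)\cong C\otimes\mathcal K\cong B$$ from a $C_0(X)$-algebra $C$, a $C_0(X)$-isomorphism $B\cong C\otimes\mathcal K$ (used at both ends) and a $*$-isomorphism $M_2(\mathcal K)\cong\mathcal K$. Given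 such a $\theta$, the **direct sum** of asymptotic $C_0(X)$-morphisms $\psi_t,\phi_t:A\to B$ is $$(\psi_t\oplus\phi_t)(a)=\theta\begin{pmatrix}\psi_t(a)&0\\0&\phi_t(a)\end{pmatrix}.$$ The **loop composition** of $\psi_t,\phi_t:A\to SB$ is $$(\psi_t\cdot\phi_t)(a)(s)=\begin{cases}\psi_t(a)(2s),&0\le s\le 1/2,\\ \phi_t(a)(2s-1),&1/2\le s\le 1.\end{cases}$$ **Theorem 3.15.** Let $A$ and $B$ be $C_0(X)$-algebras. 1. If $B$ is $C_0(X)$-stable, then stabilization isomorphisms for $B$ exist, and for each of them direct sums of asymptotic $C_0(X)$-morphisms are asymptotic $C_0(X)$-morphisms and $[\![\psi_t]\!]_X+[\![\phi_t]\!]_X=[\![\psi_t\oplus\phi_t]\!]_X$ is a well-defined operation making $[\![A,B]\!]_X$ an abelian monoid, whose identity is the class of the zero morphism. 2. Loop compositions of asymptotic $C_0(X)$-morphisms $A\to SB$ are asymptotic $C_0(X)$-morphisms, and $[\![\psi_t]\!]_X\,[\![\phi_t]\!]_X=[\![\psi_t\cdot\phi_t]\!]_X$ is a well-defined operation making $[\![A,SB]\!]_X$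 a (not necessarily abelian) group. 3. There are stabilization isomorphisms for $S(B\otimes\mathcal K)$. On $[\![A,S(B\otimes\mathcal K)]\!]_X$, loop composition and the direct sum formed with any stabilization isomorphism are well defined and all are the same operation, and with it $[\![A,S(B\otimes\mathcal K)]\!]_X$ is an abelian group, whose identity is the class of the zero morphism. -/

import Mathlib

noncomputable section

open Filter Topology MultiplierAlgebra ZeroAtInfty TensorProduct

universe u v w

/-! ### Algebras over `C₀(X)` -/

/-- A `C₀(X)`-algebra structure on a C*-algebra `A`: a nondegenerate `*`-homomorphism from
`C₀(X)` into the center of the multiplier algebra `M(A)`. -/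
class C0Algebra (X : Type u) [TopologicalSpace X] (A : Type v) [NonUnitalCStarAlgebra A] where
  /-- The structure map `Φ : C₀(X) → M(A)`. -/
  toMultiplier : C₀(X, ℂ) →⋆ₙₐ[ℂ] 𝓜(ℂ, A)
  /-- `Φ` takes values in the center of `M(A)`. -/
  central : ∀ f m, Commute (toMultiplier f) m
  /-- Nondegeneracy: `Φ(C₀(X)) · A` is dense in `A`. -/
  nondegenerate : Dense {x : A | ∃ (f : C₀(X, ℂ)) (a : A), (toMultiplier f).fst a = x}

namespace C0Algebra

section act
variable {X : Type u} [TopologicalSpace X] {A : Type v} [NonUnitalCStarAlgebra A] [C0Algebra X A]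

/-- The action `f · a = Φ(f) a` of `C₀(X)` on a `C₀(X)`-algebra. -/
def act (f : C₀(X, ℂ)) : A →L[ℂ] A := (toMultiplier (A := A) f).fst

theorem act_mul (f : C₀(X, ℂ)) (a b : A) : act f (a * b) = act f a * b := by
  have key : ∀ c : A, c * act f (a * b) = c * (act f a * b) := fun c => by
    have h1 := (toMultiplier (A := A) f).central c (a * b)
    have h2 := (toMultiplier (A := A) f).central c a
    change c * (toMultiplier (A := A) f).fst (a * b) = c * ((toMultiplier (A := A) f).fst a * b)
    rw [← h1, ← mul_assoc, h2, mul_assoc]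
  have h := key (star (act f (a * b) - act f a * b))
  rw [← sub_eq_zero, ← mul_sub, CStarRing.star_mul_self_eq_zero_iff, sub_eq_zero] at h
  exact h

theorem mul_act (f : C₀(X, ℂ)) (a b : A) : act f (a * b) = a * act f b := by
  have h := central (A := A) f (DoubleCentralizer.coe ℂ a)
  have h2 := congrArg (fun m : 𝓜(ℂ, A) => m.fst b) h.eq
  exact h2

theorem act_act (f g : C₀(X, ℂ)) (a : A) : act f (act g a) = act (f * g) a := by
  simp [act, map_mul]

theorem act_add (f g : C₀(X, ℂ)) (a : A) : act (f + g) a = act f a + act g a := by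
  simp [act, map_add]

theorem act_sub (f g : C₀(X, ℂ)) (a : A) : act (f - g) a = act f a - act g a := by
  simp [act, map_sub]

theorem act_smul (c : ℂ) (f : C₀(X, ℂ)) (a : A) : act (c • f) a = c • act f a := by
  simp [act, map_smul]

theorem star_act (f : C₀(X, ℂ)) (a : A) : star (act f a) = act (star f) (star a) := by
  have key : ∀ b : A, act (star f) (star a) * b = star (act f a) * b := fun b => by
    rw [← act_mul, mul_act, act, map_star, DoubleCentralizer.star_fst]
    have h := (toMultiplier (A := A) f).central (star b) a
    have h2 := congrArg star h
    rw [star_mul, star_mul, star_star] at h2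
    rw [h2]; rfl
  have h := key (star (act (star f) (star a) - star (act f a)))
  rw [← sub_eq_zero, ← sub_mul, CStarRing.mul_star_self_eq_zero_iff, sub_eq_zero] at h
  exact h.symm

theorem norm_act_le (f : C₀(X, ℂ)) (a : A) : ‖act f a‖ ≤ ‖f‖ * ‖a‖ := by
  refine ((act (A := A) f).le_opNorm a).trans ?_
  gcongr
  rw [act, DoubleCentralizer.norm_fst]
  exact NonUnitalStarAlgHom.norm_apply_le toMultiplier f

end act

section mk
variable {X : Type u} [TopologicalSpace X] {A : Type v} [NonUnitalCStarAlgebra A]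

/-- A central `*`-preserving action of `C₀(X)` on `A` by bounded operators, as a central double
centralizer. -/
@[reducible]
def ofAction (T : C₀(X, ℂ) → A →L[ℂ] A)
    (hadd : ∀ f g a, T (f + g) a = T f a + T g a)
    (hsmul : ∀ (c : ℂ) f a, T (c • f) a = c • T f a)
    (hmul : ∀ f g a, T (f * g) a = T f (T g a))
    (hstar : ∀ f a, T (star f) a = star (T f (star a)))
    (hl : ∀ f a b, T f (a * b) = T f a * b)
    (hr : ∀ f a b, T f (a * b) = a * T f b)
    (hd : Dense {x : A | ∃ (f : C₀(X, ℂ)) (a : A), T f a = x}) : C0Algebra X A where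
  toMultiplier :=
    { toFun := fun f => ⟨(T f, T f), fun a b => by
        change T f a * b = a * T f b
        rw [← hl, hr]⟩
      map_smul' := fun c f => by
        apply DoubleCentralizer.ext
        refine Prod.ext ?_ ?_ <;> exact ContinuousLinearMap.ext fun a => hsmul c f a
      map_zero' := by
        apply DoubleCentralizer.ext
        have h0 : ∀ a, T 0 a = 0 := fun a => by simpa using hsmul 0 0 a
        refine Prod.ext ?_ ?_ <;> exact ContinuousLinearMap.ext fun a => h0 a
      map_add' := fun f g => by
        apply DoubleCentralizer.ext
        refine Prod.ext ?_ ?_ <;> exact ContinuousLinearMap.ext fun a => hadd f g a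
      map_mul' := fun f g => by
        apply DoubleCentralizer.ext
        refine Prod.ext ?_ ?_
        · exact ContinuousLinearMap.ext fun a => hmul f g a
        · refine ContinuousLinearMap.ext fun a => ?_
          change T (f * g) a = T g (T f a)
          rw [mul_comm f g, hmul]
      map_star' := fun f => by
        apply DoubleCentralizer.ext
        refine Prod.ext ?_ ?_ <;> exact ContinuousLinearMap.ext fun a => hstar f a }
  central := fun f m => by
    have faithful : ∀ x y : A, (∀ b, x * b = y * b) → x = y := fun x y h => by
      have h' := h (star (x - y))
      rwa [← sub_eq_zero, ← sub_mul, CStarRing.mul_star_self_eq_zero_iff, sub_eq_zero] at h'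
    have faithful' : ∀ x y : A, (∀ b, b * x = b * y) → x = y := fun x y h => by
      have h' := h (star (x - y))
      rwa [← sub_eq_zero, ← mul_sub, CStarRing.star_mul_self_eq_zero_iff, sub_eq_zero] at h'
    have hL : ∀ x y, m.fst (x * y) = m.fst x * y := fun x y => faithful' _ _ fun c => by
      rw [← m.central, ← mul_assoc, m.central, mul_assoc]
    have hR : ∀ x y, m.snd (x * y) = x * m.snd y := fun x y => faithful _ _ fun c => by
      rw [m.central, mul_assoc, ← m.central, mul_assoc]
    apply DoubleCentralizer.ext
    refine Prod.ext ?_ ?_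
    · refine ContinuousLinearMap.ext fun a => ?_
      change T f (m.fst a) = m.fst (T f a)
      refine faithful _ _ fun b => ?_
      rw [← hl, hr, ← hL, ← hr, hl, hL]
    · refine ContinuousLinearMap.ext fun a => ?_
      change m.snd (T f a) = T f (m.snd a)
      refine faithful' _ _ fun b => ?_
      rw [← hr, hl, ← hR, ← hR, ← hr, hl]
  nondegenerate := hd

end mk

section approx
variable {X : Type u} [TopologicalSpace X] {A : Type v} [NonUnitalCStarAlgebra A] [C0Algebra X A]

theorem exists_filter (X : Type u) [TopologicalSpace X] :
    ∃ l : Filter C₀(X, ℂ), l.NeBot ∧ (∀ᶠ f in l, ‖f‖ ≤ 1) ∧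
      ∀ g : C₀(X, ℂ), Tendsto (fun f => f * g) l (𝓝 g) := by
  let _ : PartialOrder C₀(X, ℂ) := CStarAlgebra.spectralOrder _
  have : StarOrderedRing C₀(X, ℂ) := CStarAlgebra.spectralOrderedRing _
  have h := CStarAlgebra.increasingApproximateUnit C₀(X, ℂ)
  exact ⟨_, h.neBot, h.eventually_norm, h.tendsto_mul_right⟩

/-- An approximate unit of `C₀(X)` acts as an approximate identity on a `C₀(X)`-algebra. -/
theorem exists_filter_act (X : Type u) [TopologicalSpace X] (A : Type v)
    [NonUnitalCStarAlgebra A] [C0Algebra X A] :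
    ∃ l : Filter C₀(X, ℂ), l.NeBot ∧ (∀ᶠ f in l, ‖f‖ ≤ 1) ∧
      ∀ a : A, Tendsto (fun f => act f a) l (𝓝 a) := by
  obtain ⟨l, hl, h1, h2⟩ := exists_filter X
  refine ⟨l, hl, h1, fun a => ?_⟩
  rw [Metric.tendsto_nhds]
  intro ε hε
  obtain ⟨x, hx, g, b, rfl⟩ := Metric.dense_iff.1 (nondegenerate (X := X) (A := A)) a (ε / 3)
    (by positivity)
  change act g b ∈ _ at hx
  have h3 : Tendsto (fun f => act f (act g b)) l (𝓝 (act g b)) := by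
    have : Tendsto (fun f => act (f * g) b) l (𝓝 (act g b)) := by
      rw [tendsto_iff_norm_sub_tendsto_zero]
      have h4 := (tendsto_iff_norm_sub_tendsto_zero.1 (h2 g)).mul_const ‖b‖
      rw [zero_mul] at h4
      refine squeeze_zero (fun _ => norm_nonneg _) (fun f => ?_) h4
      rw [← act_sub]
      exact norm_act_le _ _
    simpa only [act_act] using this
  filter_upwards [h1, Metric.tendsto_nhds.1 h3 (ε / 3) (by positivity)] with f hf hf'
  rw [Metric.mem_ball, dist_comm] at hx
  calc dist (act f a) a ≤ dist (act f a) (act f (act g b)) + dist (act f (act g b)) (act g b)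
        + dist (act g b) a := dist_triangle4 _ _ _ _
    _ < ε / 3 + ε / 3 + ε / 3 := by
        have : dist (act f a) (act f (act g b)) < ε / 3 := by
          rw [dist_eq_norm, ← map_sub]
          refine (norm_act_le _ _).trans_lt ?_
          rw [dist_eq_norm] at hx
          calc ‖f‖ * ‖a - act g b‖ ≤ 1 * ‖a - act g b‖ := by gcongr
            _ < ε / 3 := by rwa [one_mul]
        have h5 : dist (act g b) a < ε / 3 := by rwa [dist_comm]
        gcongr
    _ = ε := by ring

end approx

end C0Algebra

open C0Algebra unitInterval

/-! ### Paths and loops in a `C₀(X)`-algebra -/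

section paths
variable {X : Type u} [TopologicalSpace X] {B : Type w} [NonUnitalCStarAlgebra B] [C0Algebra X B]

theorem C0Algebra.tendsto_act_path {l : Filter C₀(X, ℂ)} (h1 : ∀ᶠ f in l, ‖f‖ ≤ 1)
    (h2 : ∀ b : B, Tendsto (fun f => act f b) l (𝓝 b)) (F : C(I, B)) :
    Tendsto (fun f => (⟨fun s => act f (F s), by fun_prop⟩ : C(I, B))) l (𝓝 F) := by
  rw [Metric.tendsto_nhds]
  intro ε hε
  have hc : IsCompact (Set.range F) := isCompact_range F.continuous
  obtain ⟨t, ht, htf, htc⟩ := hc.finite_cover_balls (e := ε / 4) (by positivity)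
  have h3 : ∀ᶠ f in l, ∀ b ∈ t, dist (act f b) b < ε / 4 := by
    rw [htf.eventually_all]
    exact fun b _ => Metric.tendsto_nhds.1 (h2 b) _ (by positivity)
  filter_upwards [h1, h3] with f hf hf'
  refine lt_of_le_of_lt ((ContinuousMap.dist_le (by positivity : (0 : ℝ) ≤ 3 * (ε / 4))).2 fun s => ?_)
    (by linarith : 3 * (ε / 4) < ε)
  obtain ⟨b, hb, hs⟩ := Set.mem_iUnion₂.1 (htc (Set.mem_range_self s))
  rw [Metric.mem_ball] at hs
  change dist (act f (F s)) (F s) ≤ _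
  have h4 : dist (act f (F s)) (act f b) ≤ dist (F s) b := by
    rw [dist_eq_norm, dist_eq_norm, ← map_sub]
    calc _ ≤ ‖f‖ * ‖F s - b‖ := norm_act_le _ _
      _ ≤ 1 * ‖F s - b‖ := by gcongr
      _ = _ := one_mul _
  have h5 := dist_triangle4 (act f (F s)) (act f b) b (F s)
  have h6 := hf' b hb
  rw [dist_comm b] at h5
  linarith

/-- `B[0,1] = C([0,1], B)` as a `C₀(X)`-algebra, with the pointwise action. -/
instance C0Algebra.path : C0Algebra X C(I, B) :=
  ofAction (fun f => (act (A := B) f).compLeftContinuous ℂ I)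
    (fun f g a => by ext s; exact act_add f g (a s))
    (fun c f a => by ext s; exact act_smul c f (a s))
    (fun f g a => by ext s; exact (act_act f g (a s)).symm)
    (fun f a => by
      ext s
      change act (star f) (a s) = star (act f (star (a s)))
      simp [star_act])
    (fun f a b => by ext s; exact act_mul f (a s) (b s))
    (fun f a b => by ext s; exact mul_act f (a s) (b s))
    (by
      intro F
      obtain ⟨l, hl, h1, h2⟩ := exists_filter_act X B
      refine mem_closure_of_tendsto (tendsto_act_path h1 h2 F) (Eventually.of_forall fun f => ?_)
      exact ⟨f, F, rfl⟩)

variable (B) in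
/-- The loops in `B`: continuous functions `[0,1] → B` that vanish at both endpoints. -/
def loopSubalgebra : NonUnitalStarSubalgebra ℂ C(I, B) where
  carrier := {F | F 0 = 0 ∧ F 1 = 0}
  add_mem' := by rintro F G ⟨h1, h2⟩ ⟨h3, h4⟩; simp [h1, h2, h3, h4]
  zero_mem' := by simp
  mul_mem' := by rintro F G ⟨h1, h2⟩ ⟨h3, h4⟩; simp [h1, h2, h3, h4]
  smul_mem' := by rintro c F ⟨h1, h2⟩; simp [h1, h2]
  star_mem' := by rintro F ⟨h1, h2⟩; simp [h1, h2]

instance loopSubalgebra.isClosed : IsClosed (loopSubalgebra B : Set C(I, B)) := by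
  have : (loopSubalgebra B : Set C(I, B)) = {F | F 0 = 0} ∩ {F | F 1 = 0} := rfl
  rw [this]
  exact (isClosed_eq (ContinuousEvalConst.continuous_eval_const 0) continuous_const).inter
    (isClosed_eq (ContinuousEvalConst.continuous_eval_const 1) continuous_const)

variable (B) in
/-- The suspension `SB = C₀((0,1), B)`. -/
abbrev Susp : Type w := loopSubalgebra B

instance Susp.instCStar : NonUnitalCStarAlgebra (Susp B) :=
  NonUnitalStarSubalgebra.nonUnitalCStarAlgebra _

/-- `SB` as a `C₀(X)`-algebra, with the pointwise action. -/
instance C0Algebra.susp : C0Algebra X (Susp B) :=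
  ofAction
    (fun f => (((act (A := B) f).compLeftContinuous ℂ I).comp
      (loopSubalgebra B).toSubmodule.subtypeL).codRestrict (loopSubalgebra B).toSubmodule
        (fun F => ⟨by
          change act f (F.1 0) = 0
          rw [F.2.1, map_zero], by
          change act f (F.1 1) = 0
          rw [F.2.2, map_zero]⟩))
    (fun f g a => by ext s; exact act_add f g (a.1 s))
    (fun c f a => by ext s; exact act_smul c f (a.1 s))
    (fun f g a => by ext s; exact (act_act f g (a.1 s)).symm)
    (fun f a => by
      ext s
      change act (star f) (a.1 s) = star (act f (star (a.1 s)))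
      simp [star_act])
    (fun f a b => by ext s; exact act_mul f (a.1 s) (b.1 s))
    (fun f a b => by ext s; exact mul_act f (a.1 s) (b.1 s))
    (by
      intro F
      obtain ⟨l, hl, h1, h2⟩ := exists_filter_act X B
      have h := tendsto_act_path h1 h2 F.1
      refine mem_closure_of_tendsto (f := fun f => (⟨⟨fun s => act f (F.1 s), by fun_prop⟩, by
          change act f (F.1 0) = 0
          rw [F.2.1, map_zero], by
          change act f (F.1 1) = 0
          rw [F.2.2, map_zero]⟩ : Susp B)) (b := l) ?_ (Eventually.of_forall fun f => ?_)
      · rw [tendsto_subtype_rng]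
        exact h
      · exact ⟨f, F, rfl⟩)

end paths

/-! ### Maximal tensor products -/

section maxTensor

/-- A C*-seminorm on the algebraic tensor product `A ⊙ B`.  (The bound on elementary tensors holds
for every C*-seminorm; it is recorded to make the supremum below visibly finite.) -/
structure TensorCStarSeminorm (A : Type v) (B : Type w) [NonUnitalCStarAlgebra A]
    [NonUnitalCStarAlgebra B] extends Seminorm ℂ (A ⊗[ℂ] B) where
  mul_le' : ∀ x y, toFun (x * y) ≤ toFun x * toFun y
  star_mul_self' : ∀ x, toFun (star x * x) = toFun x * toFun x
  tmul_le' : ∀ a b, toFun (a ⊗ₜ b) ≤ ‖a‖ * ‖b‖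

variable {A : Type v} {B : Type w} [NonUnitalCStarAlgebra A] [NonUnitalCStarAlgebra B]

namespace TensorCStarSeminorm

instance : Inhabited (TensorCStarSeminorm A B) :=
  ⟨{ (0 : Seminorm ℂ (A ⊗[ℂ] B)) with
    mul_le' := fun _ _ => by change (0 : ℝ) ≤ 0 * 0; simp
    star_mul_self' := fun _ => by change (0 : ℝ) = 0 * 0; simp
    tmul_le' := fun _ _ => by change (0 : ℝ) ≤ _; positivity }⟩

theorem exists_bound (x : A ⊗[ℂ] B) :
    ∃ C, ∀ p : TensorCStarSeminorm A B, p.toSeminorm x ≤ C := by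
  induction x using TensorProduct.induction_on with
  | zero => exact ⟨0, fun p => (map_zero p.toSeminorm).le⟩
  | tmul a b => exact ⟨‖a‖ * ‖b‖, fun p => p.tmul_le' a b⟩
  | add x y hx hy =>
    obtain ⟨C, hC⟩ := hx
    obtain ⟨D, hD⟩ := hy
    exact ⟨C + D, fun p => (map_add_le_add p.toSeminorm x y).trans (add_le_add (hC p) (hD p))⟩

theorem bddAbove (x : A ⊗[ℂ] B) :
    BddAbove (Set.range fun p : TensorCStarSeminorm A B => p.toSeminorm x) := by
  obtain ⟨C, hC⟩ := exists_bound x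
  exact ⟨C, by rintro _ ⟨p, rfl⟩; exact hC p⟩

theorem le_iSup (p : TensorCStarSeminorm A B) (x : A ⊗[ℂ] B) :
    p.toSeminorm x ≤ ⨆ q : TensorCStarSeminorm A B, q.toSeminorm x :=
  le_ciSup (bddAbove x) p

theorem star_eq (p : TensorCStarSeminorm A B) (x : A ⊗[ℂ] B) :
    p.toSeminorm (star x) = p.toSeminorm x := by
  have key : ∀ y, p.toSeminorm y ≤ p.toSeminorm (star y) := fun y => by
    have h1 := p.star_mul_self' y
    have h2 := p.mul_le' (star y) y
    change p.toSeminorm _ = p.toSeminorm _ * p.toSeminorm _ at h1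
    change p.toSeminorm _ ≤ p.toSeminorm _ * p.toSeminorm _ at h2
    rw [h1] at h2
    rcases (apply_nonneg p.toSeminorm y).eq_or_lt with h | h
    · rw [← h]; exact apply_nonneg _ _
    · exact le_of_mul_le_mul_right h2 h
  exact le_antisymm (by simpa using key (star x)) (key x)

variable (A B) in
/-- The maximal C*-seminorm on `A ⊙ B`: the supremum of all C*-seminorms. -/
def maximal : TensorCStarSeminorm A B where
  toFun x := ⨆ p : TensorCStarSeminorm A B, p.toSeminorm x
  map_zero' := by simp
  add_le' x y := ciSup_le fun p => (map_add_le_add p.toSeminorm x y).trans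
    (add_le_add (le_iSup p x) (le_iSup p y))
  neg' x := by simp
  smul' c x := by
    simp only [map_smul_eq_mul]
    exact (Real.mul_iSup_of_nonneg (norm_nonneg c) _).symm
  mul_le' x y := ciSup_le fun p => (p.mul_le' x y).trans
    (mul_le_mul (le_iSup p x) (le_iSup p y) (apply_nonneg p.toSeminorm _)
      ((apply_nonneg p.toSeminorm x).trans (le_iSup p x)))
  star_mul_self' x := by
    refine le_antisymm (ciSup_le fun p => ?_) ?_
    · refine (p.star_mul_self' x).le.trans ?_
      exact mul_self_le_mul_self (apply_nonneg p.toSeminorm _) (le_iSup p x)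
    · have h0 : 0 ≤ ⨆ p : TensorCStarSeminorm A B, p.toSeminorm (star x * x) :=
        (apply_nonneg (default : TensorCStarSeminorm A B).toSeminorm _).trans (le_iSup default _)
      have h : (⨆ p : TensorCStarSeminorm A B, p.toSeminorm x) ≤
          √(⨆ p : TensorCStarSeminorm A B, p.toSeminorm (star x * x)) := ciSup_le fun p => by
        refine Real.le_sqrt_of_sq_le ?_
        rw [sq]
        exact (p.star_mul_self' x).symm.le.trans (le_iSup p _)
      have h' : 0 ≤ ⨆ p : TensorCStarSeminorm A B, p.toSeminorm x :=
        (apply_nonneg (default : TensorCStarSeminorm A B).toSeminorm _).trans (le_iSup default _)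
      exact (mul_self_le_mul_self h' h).trans (Real.mul_self_sqrt h0).le
  tmul_le' a b := ciSup_le fun p => p.tmul_le' a b

end TensorCStarSeminorm

variable (A B) in
/-- The algebraic tensor product `A ⊙ B`, carrying the maximal C*-seminorm. -/
def AlgTensor : Type max v w := A ⊗[ℂ] B

namespace AlgTensor

instance : NonUnitalRing (AlgTensor A B) :=
  show NonUnitalRing (A ⊗[ℂ] B) from inferInstance
instance : Module ℂ (AlgTensor A B) := show Module ℂ (A ⊗[ℂ] B) from inferInstance
instance : StarAddMonoid (AlgTensor A B) where
  star := @star (A ⊗[ℂ] B) _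
  star_involutive := @star_star (A ⊗[ℂ] B) _
  star_add := @star_add (A ⊗[ℂ] B) _ _
instance : StarModule ℂ (AlgTensor A B) where
  star_smul := @star_smul ℂ (A ⊗[ℂ] B) _ _ _ _
instance : IsScalarTower ℂ (AlgTensor A B) (AlgTensor A B) :=
  show IsScalarTower ℂ (A ⊗[ℂ] B) (A ⊗[ℂ] B) from inferInstance
instance : SMulCommClass ℂ (AlgTensor A B) (AlgTensor A B) :=
  show SMulCommClass ℂ (A ⊗[ℂ] B) (A ⊗[ℂ] B) from inferInstance

theorem star_mul' (x y : A ⊗[ℂ] B) : star (x * y) = star y * star x := by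
  induction x using TensorProduct.induction_on with
  | zero => simp
  | add x x' hx hx' => rw [add_mul, star_add, star_add, mul_add, hx, hx']
  | tmul a b =>
    induction y using TensorProduct.induction_on with
    | zero => simp
    | add y y' hy hy' => rw [mul_add, star_add, star_add, add_mul, hy, hy']
    | tmul c d => simp [Algebra.TensorProduct.tmul_mul_tmul, TensorProduct.star_tmul]

instance : StarRing (AlgTensor A B) where
  star_mul := star_mul'
  star_add := star_add

instance : SeminormedAddCommGroup (AlgTensor A B) :=
  (TensorCStarSeminorm.maximal A B).toSeminorm.toAddGroupSeminorm.toSeminormedAddCommGroup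

theorem norm_def (x : AlgTensor A B) :
    ‖x‖ = ⨆ p : TensorCStarSeminorm A B, p.toSeminorm x := rfl

instance : NormedSpace ℂ (AlgTensor A B) where
  norm_smul_le c x := (map_smul_eq_mul (TensorCStarSeminorm.maximal A B).toSeminorm c x).le

instance : NonUnitalSeminormedRing (AlgTensor A B) where
  __ := (inferInstance : SeminormedAddCommGroup (AlgTensor A B))
  __ := (inferInstance : NonUnitalRing (AlgTensor A B))
  norm_mul_le := (TensorCStarSeminorm.maximal A B).mul_le'

instance : NormedStarGroup (AlgTensor A B) where
  norm_star_le x := ((TensorCStarSeminorm.maximal A B).star_eq x).le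

theorem norm_star_mul_self (x : AlgTensor A B) : ‖star x * x‖ = ‖x‖ * ‖x‖ :=
  (TensorCStarSeminorm.maximal A B).star_mul_self' x

end AlgTensor

variable (A B) in
/-- The maximal tensor product `A ⊗ B`: the completion of `A ⊙ B` (modulo null vectors) in the
maximal C*-seminorm. -/
def MaxTensor : Type max v w := UniformSpace.Completion (AlgTensor A B)

namespace MaxTensor

open UniformSpace UniformSpace.Completion

instance : NormedAddCommGroup (MaxTensor A B) :=
  inferInstanceAs (NormedAddCommGroup (Completion (AlgTensor A B)))

variable (A B) in
/-- The complex Banach space structure of the completion. -/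
@[irreducible]
def instNormedSpaceAux : NormedSpace ℂ (MaxTensor A B) :=
  inferInstanceAs (NormedSpace ℂ (Completion (AlgTensor A B)))

instance : NormedSpace ℂ (MaxTensor A B) := instNormedSpaceAux A B
instance : CompleteSpace (MaxTensor A B) :=
  inferInstanceAs (CompleteSpace (Completion (AlgTensor A B)))

/-- The canonical map `A ⊙ B → A ⊗ B`. -/
def ofAlg : AlgTensor A B →ₗᵢ[ℂ] MaxTensor A B where
  toFun x := (x : Completion (AlgTensor A B))
  map_add' x y := Completion.coe_add x y
  map_smul' c x := by
    change ((c • x : AlgTensor A B) : Completion (AlgTensor A B)) =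
      (instNormedSpaceAux A B).toSMul.smul c (x : Completion (AlgTensor A B))
    unfold instNormedSpaceAux
    exact Completion.coe_smul c x
  norm_map' x := Completion.norm_coe x

/-- The elementary tensor `a ⊗ b` in the maximal tensor product. -/
def tmul (a : A) (b : B) : MaxTensor A B := ofAlg (a ⊗ₜ[ℂ] b : A ⊗[ℂ] B)

theorem denseRange_ofAlg : DenseRange (ofAlg : AlgTensor A B → MaxTensor A B) :=
  Completion.denseRange_coe

theorem isDenseInducing_ofAlg : IsDenseInducing (ofAlg : AlgTensor A B → MaxTensor A B) :=
  Completion.isDenseInducing_coe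

@[elab_as_elim]
theorem induction_on {P : MaxTensor A B → Prop} (x : MaxTensor A B) (hc : IsClosed {x | P x})
    (h : ∀ y, P (ofAlg y)) : P x :=
  Completion.induction_on x hc h

/-- The product of `A ⊗ B`: the continuous extension of the product of `A ⊙ B`. -/
@[irreducible]
def mulFun (x y : MaxTensor A B) : MaxTensor A B :=
  (isDenseInducing_ofAlg.prodMap isDenseInducing_ofAlg).extend
    (fun p : AlgTensor A B × AlgTensor A B => (ofAlg (p.1 * p.2) : MaxTensor A B)) (x, y)

/-- The involution of `A ⊗ B`: the continuous extension of the involution of `A ⊙ B`. -/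
@[irreducible]
def starFun : MaxTensor A B → MaxTensor A B :=
  Completion.map (star : AlgTensor A B → AlgTensor A B)

instance : Mul (MaxTensor A B) where
  mul := mulFun

instance : Star (MaxTensor A B) where
  star := starFun

theorem ofAlg_mul (x y : AlgTensor A B) : ofAlg (x * y) = ofAlg x * ofAlg y := by
  change _ = mulFun _ _
  rw [mulFun]
  exact ((isDenseInducing_ofAlg.prodMap isDenseInducing_ofAlg).extend_eq
    (ofAlg.continuous.comp continuous_mul) (x, y)).symm

instance : ContinuousMul (MaxTensor A B) where
  continuous_mul := by
    let m : AlgTensor A B →+ AlgTensor A B →+ MaxTensor A B :=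
      (AddMonoidHom.mul : AlgTensor A B →+ AlgTensor A B →+ AlgTensor A B).compr₂
        (toCompl : AlgTensor A B →+ Completion (AlgTensor A B))
    have : Continuous fun p : AlgTensor A B × AlgTensor A B => m p.1 p.2 :=
      ofAlg.continuous.comp continuous_mul
    have di : IsDenseInducing (toCompl : AlgTensor A B → Completion (AlgTensor A B)) :=
      Completion.isDenseInducing_coe
    have h := di.extend_Z_bilin di this
    change Continuous fun p : MaxTensor A B × MaxTensor A B => mulFun p.1 p.2
    unfold mulFun
    exact h

theorem ofAlg_star (x : AlgTensor A B) : ofAlg (star x) = star (ofAlg x) := by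
  change _ = starFun _
  rw [starFun]
  exact (Completion.map_coe (star_isometry (E := AlgTensor A B)).uniformContinuous x).symm

instance : ContinuousStar (MaxTensor A B) where
  continuous_star := by
    change Continuous (starFun : MaxTensor A B → MaxTensor A B)
    rw [starFun]
    exact Completion.continuous_map

theorem left_distrib' (x y z : MaxTensor A B) : x * (y + z) = x * y + x * z := by
  refine induction_on x (isClosed_eq (by fun_prop) (by fun_prop)) fun x => ?_
  refine induction_on y (isClosed_eq (by fun_prop) (by fun_prop)) fun y => ?_
  refine induction_on z (isClosed_eq (by fun_prop) (by fun_prop)) fun z => ?_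
  rw [← map_add, ← ofAlg_mul, ← ofAlg_mul, ← ofAlg_mul, mul_add, map_add]

theorem right_distrib' (x y z : MaxTensor A B) : (x + y) * z = x * z + y * z := by
  refine induction_on x (isClosed_eq (by fun_prop) (by fun_prop)) fun x => ?_
  refine induction_on y (isClosed_eq (by fun_prop) (by fun_prop)) fun y => ?_
  refine induction_on z (isClosed_eq (by fun_prop) (by fun_prop)) fun z => ?_
  rw [← map_add, ← ofAlg_mul, ← ofAlg_mul, ← ofAlg_mul, add_mul, map_add]

theorem mul_assoc' (x y z : MaxTensor A B) : x * y * z = x * (y * z) := by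
  refine induction_on x (isClosed_eq (by fun_prop) (by fun_prop)) fun x => ?_
  refine induction_on y (isClosed_eq (by fun_prop) (by fun_prop)) fun y => ?_
  refine induction_on z (isClosed_eq (by fun_prop) (by fun_prop)) fun z => ?_
  rw [← ofAlg_mul, ← ofAlg_mul, ← ofAlg_mul, ← ofAlg_mul, mul_assoc]

theorem norm_mul_le' (x y : MaxTensor A B) : ‖x * y‖ ≤ ‖x‖ * ‖y‖ := by
  refine induction_on x (isClosed_le (by fun_prop) (by fun_prop)) fun x => ?_
  refine induction_on y (isClosed_le (by fun_prop) (by fun_prop)) fun y => ?_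
  rw [← ofAlg_mul, ofAlg.norm_map, ofAlg.norm_map, ofAlg.norm_map]
  exact norm_mul_le x y

theorem smul_mul' (c : ℂ) (x y : MaxTensor A B) : (c • x) * y = c • (x * y) := by
  refine induction_on x (isClosed_eq (by fun_prop) (by fun_prop)) fun x => ?_
  refine induction_on y (isClosed_eq (by fun_prop) (by fun_prop)) fun y => ?_
  rw [← map_smul, ← ofAlg_mul, ← ofAlg_mul, ← map_smul, smul_mul_assoc]

theorem mul_smul' (c : ℂ) (x y : MaxTensor A B) : x * (c • y) = c • (x * y) := by
  refine induction_on x (isClosed_eq (by fun_prop) (by fun_prop)) fun x => ?_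
  refine induction_on y (isClosed_eq (by fun_prop) (by fun_prop)) fun y => ?_
  rw [← map_smul, ← ofAlg_mul, ← ofAlg_mul, ← map_smul, mul_smul_comm]

theorem star_star' (x : MaxTensor A B) : star (star x) = x := by
  refine induction_on x (isClosed_eq (by fun_prop) (by fun_prop)) fun x => ?_
  rw [← ofAlg_star, ← ofAlg_star, star_star]

theorem star_mul' (x y : MaxTensor A B) : star (x * y) = star y * star x := by
  refine induction_on x (isClosed_eq (by fun_prop) (by fun_prop)) fun x => ?_
  refine induction_on y (isClosed_eq (by fun_prop) (by fun_prop)) fun y => ?_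
  rw [← ofAlg_mul, ← ofAlg_star, star_mul, ofAlg_mul, ofAlg_star, ofAlg_star]

theorem star_add' (x y : MaxTensor A B) : star (x + y) = star x + star y := by
  refine induction_on x (isClosed_eq (by fun_prop) (by fun_prop)) fun x => ?_
  refine induction_on y (isClosed_eq (by fun_prop) (by fun_prop)) fun y => ?_
  rw [← map_add, ← ofAlg_star, star_add, map_add, ofAlg_star, ofAlg_star]

theorem star_smul' (c : ℂ) (x : MaxTensor A B) : star (c • x) = star c • star x := by
  refine induction_on x (isClosed_eq (by fun_prop) (by fun_prop)) fun x => ?_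
  rw [← map_smul, ← ofAlg_star, star_smul, map_smul, ofAlg_star]

theorem norm_star_mul_self' (x : MaxTensor A B) : ‖x‖ * ‖x‖ ≤ ‖star x * x‖ := by
  refine induction_on x (isClosed_le (by fun_prop) (by fun_prop)) fun x => ?_
  rw [← ofAlg_star, ← ofAlg_mul, ofAlg.norm_map, ofAlg.norm_map, AlgTensor.norm_star_mul_self]

instance : NonUnitalNormedRing (MaxTensor A B) where
  __ := (inferInstance : NormedAddCommGroup (MaxTensor A B))
  left_distrib := left_distrib'
  right_distrib := right_distrib'
  zero_mul x := by simpa using smul_mul' 0 0 x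
  mul_zero x := by simpa using mul_smul' 0 x 0
  mul_assoc := mul_assoc'
  norm_mul_le := norm_mul_le'

instance : IsScalarTower ℂ (MaxTensor A B) (MaxTensor A B) where
  smul_assoc := smul_mul'

instance : SMulCommClass ℂ (MaxTensor A B) (MaxTensor A B) where
  smul_comm c x y := (mul_smul' c x y).symm

instance : StarRing (MaxTensor A B) where
  star_involutive := star_star'
  star_mul := star_mul'
  star_add := star_add'

instance : StarModule ℂ (MaxTensor A B) where
  star_smul := star_smul'

instance : CStarRing (MaxTensor A B) where
  norm_mul_self_le := norm_star_mul_self'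

instance : NonUnitalCStarAlgebra (MaxTensor A B) where

end MaxTensor

/-! ### The `C₀(X)`-structure on a tensor product -/

namespace MaxTensor

variable {X : Type u} [TopologicalSpace X] [C0Algebra X A]

/-- The operator `a ⊗ b ↦ (f · a) ⊗ b` on `A ⊙ B`. -/
def algAct (f : C₀(X, ℂ)) : AlgTensor A B →ₗ[ℂ] AlgTensor A B :=
  (TensorProduct.map (act (A := A) f).toLinearMap LinearMap.id : A ⊗[ℂ] B →ₗ[ℂ] A ⊗[ℂ] B)

/-- The elementary tensor `a ⊗ b` in `A ⊙ B`. -/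
def algTmul (a : A) (b : B) : AlgTensor A B := (a ⊗ₜ[ℂ] b : A ⊗[ℂ] B)

@[elab_as_elim]
theorem alg_induction {P : AlgTensor A B → Prop} (x : AlgTensor A B) (h0 : P 0)
    (ht : ∀ a b, P (algTmul a b)) (ha : ∀ x y, P x → P y → P (x + y)) : P x :=
  TensorProduct.induction_on (motive := P) x h0 ht ha

theorem algTmul_mul (a c : A) (b d : B) :
    algTmul a b * algTmul c d = algTmul (a * c) (b * d) :=
  Algebra.TensorProduct.tmul_mul_tmul a c b d

theorem star_algTmul (a : A) (b : B) : star (algTmul a b) = algTmul (star a) (star b) := rfl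

theorem algAct_tmul (f : C₀(X, ℂ)) (a : A) (b : B) :
    algAct f (algTmul a b) = algTmul (act f a) b := rfl

theorem norm_algTmul_le (a : A) (b : B) : ‖algTmul a b‖ ≤ ‖a‖ * ‖b‖ :=
  (TensorCStarSeminorm.maximal A B).tmul_le' a b

theorem algAct_add (f g : C₀(X, ℂ)) (x : AlgTensor A B) :
    algAct (f + g) x = algAct f x + algAct g x := by
  induction x using alg_induction with
  | h0 => simp
  | ht a b => simp only [algAct_tmul, act_add]; exact TensorProduct.add_tmul _ _ _
  | ha x y hx hy => simp only [map_add, hx, hy]; abel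

theorem algAct_smul (c : ℂ) (f : C₀(X, ℂ)) (x : AlgTensor A B) :
    algAct (c • f) x = c • algAct f x := by
  induction x using alg_induction with
  | h0 => simp
  | ht a b => simp only [algAct_tmul, act_smul]; exact (TensorProduct.smul_tmul' c _ _).symm
  | ha x y hx hy => simp only [map_add, hx, hy, smul_add]

theorem algAct_mul (f g : C₀(X, ℂ)) (x : AlgTensor A B) :
    algAct (f * g) x = algAct f (algAct g x) := by
  induction x using alg_induction with
  | h0 => simp
  | ht a b => simp only [algAct_tmul, act_act]
  | ha x y hx hy => simp only [map_add, hx, hy]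

theorem algAct_star (f : C₀(X, ℂ)) (x : AlgTensor A B) :
    algAct (star f) x = star (algAct f (star x)) := by
  induction x using alg_induction with
  | h0 => simp
  | ht a b => simp only [algAct_tmul, star_algTmul, star_act, star_star]
  | ha x y hx hy => simp only [map_add, star_add, hx, hy]

theorem algAct_mul_left (f : C₀(X, ℂ)) (x y : AlgTensor A B) :
    algAct f (x * y) = algAct f x * y := by
  induction x using alg_induction with
  | h0 => simp
  | ha x x' hx hx' => simp only [add_mul, map_add, hx, hx']
  | ht a b =>
    induction y using alg_induction with
    | h0 => simp
    | ha y y' hy hy' => simp only [mul_add, map_add, hy, hy']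
    | ht c d => simp only [algTmul_mul, algAct_tmul, act_mul]

theorem algAct_mul_right (f : C₀(X, ℂ)) (x y : AlgTensor A B) :
    algAct f (x * y) = x * algAct f y := by
  induction x using alg_induction with
  | h0 => simp
  | ha x x' hx hx' => simp only [add_mul, map_add, hx, hx']
  | ht a b =>
    induction y using alg_induction with
    | h0 => simp
    | ha y y' hy hy' => simp only [mul_add, map_add, hy, hy']
    | ht c d => simp only [algTmul_mul, algAct_tmul, mul_act]

theorem exists_norm_algAct_le (x : AlgTensor A B) :
    ∃ C, ∀ f : C₀(X, ℂ), ‖algAct f x‖ ≤ ‖f‖ * C := by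
  induction x using alg_induction with
  | h0 => exact ⟨0, by simp⟩
  | ht a b =>
    refine ⟨‖a‖ * ‖b‖, fun f => ?_⟩
    rw [algAct_tmul, ← mul_assoc]
    exact (norm_algTmul_le _ _).trans (by gcongr; exact norm_act_le f a)
  | ha x y hx hy =>
    obtain ⟨C, hC⟩ := hx
    obtain ⟨D, hD⟩ := hy
    refine ⟨C + D, fun f => ?_⟩
    rw [map_add, mul_add]
    exact (norm_add_le _ _).trans (add_le_add (hC f) (hD f))

theorem norm_algAct_le (f : C₀(X, ℂ)) (x : AlgTensor A B) : ‖algAct f x‖ ≤ ‖f‖ * ‖x‖ := by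
  obtain ⟨C, hC⟩ := exists_norm_algAct_le (X := X) x
  have hC0 : ∀ g : C₀(X, ℂ), ‖g‖ ≤ 1 → ‖algAct g x‖ ≤ |C| := fun g hg =>
    (hC g).trans ((mul_le_mul_of_nonneg_left (le_abs_self C) (norm_nonneg g)).trans
      (mul_le_of_le_one_left (abs_nonneg C) hg))
  let M : ℝ := ⨆ g : {g : C₀(X, ℂ) // ‖g‖ ≤ 1}, ‖algAct g.1 x‖
  have hb : BddAbove (Set.range fun g : {g : C₀(X, ℂ) // ‖g‖ ≤ 1} => ‖algAct g.1 x‖) :=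
    ⟨|C|, by rintro _ ⟨g, rfl⟩; exact hC0 g.1 g.2⟩
  have hle : ∀ g : C₀(X, ℂ), ‖g‖ ≤ 1 → ‖algAct g x‖ ≤ M := fun g hg => le_ciSup hb ⟨g, hg⟩
  have hM0 : 0 ≤ M := (norm_nonneg _).trans (hle 0 (by simp))
  have hsq : ∀ g : C₀(X, ℂ), ‖g‖ ≤ 1 → ‖algAct g x‖ * ‖algAct g x‖ ≤ ‖x‖ * M := fun g hg => by
    rw [← AlgTensor.norm_star_mul_self]
    have h1 : star (algAct g x) * algAct g x = star x * algAct (star g * g) x := by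
      have h4 := algAct_star g (star x)
      rw [star_star] at h4
      rw [algAct_mul, ← h4, ← algAct_mul_left (star g), algAct_mul_right (star g)]
    rw [h1]
    refine (norm_mul_le _ _).trans ?_
    rw [norm_star]
    gcongr
    refine hle _ ((norm_mul_le _ _).trans ?_)
    rw [norm_star (E := C₀(X, ℂ))]
    exact mul_le_one₀ hg (norm_nonneg g) hg
  have hMx : M ≤ ‖x‖ := by
    have h1 : M ≤ √(‖x‖ * M) := by
      have : Nonempty {g : C₀(X, ℂ) // ‖g‖ ≤ 1} := ⟨⟨0, by simp⟩⟩
      exact ciSup_le fun g => Real.le_sqrt_of_sq_le (by rw [sq]; exact hsq g.1 g.2)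
    have h2 : M * M ≤ ‖x‖ * M :=
      (mul_self_le_mul_self hM0 h1).trans (Real.mul_self_sqrt (by positivity)).le
    rcases hM0.eq_or_lt with h | h
    · rw [← h]; exact norm_nonneg x
    · exact le_of_mul_le_mul_right h2 h
  rcases eq_or_ne f 0 with rfl | hf
  · have h0 : algAct (0 : C₀(X, ℂ)) x = 0 := by simpa using algAct_smul 0 (0 : C₀(X, ℂ)) x
    rw [h0, norm_zero, norm_zero, zero_mul]
  · have hf0 : ‖f‖ ≠ 0 := norm_ne_zero_iff.2 hf
    have h1 := (hle ((‖f‖ : ℂ)⁻¹ • f) (by simp [norm_smul, hf0])).trans hMx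
    rw [algAct_smul, norm_smul, norm_inv, Complex.norm_real, norm_norm] at h1
    rwa [inv_mul_le_iff₀ (by positivity)] at h1

/-- The operator on `A ⊗ B` extending `a ⊗ b ↦ (f · a) ⊗ b`. -/
@[irreducible]
def actCLM (f : C₀(X, ℂ)) : MaxTensor A B →L[ℂ] MaxTensor A B :=
  ContinuousLinearMap.extend
    (ofAlg.toContinuousLinearMap.comp ((algAct f).mkContinuous ‖f‖ (norm_algAct_le f)))
    (ofAlg (A := A) (B := B)).toContinuousLinearMap

theorem actCLM_ofAlg (f : C₀(X, ℂ)) (x : AlgTensor A B) :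
    actCLM f (ofAlg x) = ofAlg (algAct f x) := by
  rw [actCLM]
  exact ContinuousLinearMap.extend_eq _ (e := (ofAlg (A := A) (B := B)).toContinuousLinearMap)
    denseRange_ofAlg ofAlg.isometry.isUniformInducing x

theorem actCLM_tmul (f : C₀(X, ℂ)) (a : A) (b : B) :
    actCLM f (tmul a b) = tmul (act f a) b := actCLM_ofAlg f (algTmul a b)

theorem norm_actCLM_le (f : C₀(X, ℂ)) (x : MaxTensor A B) : ‖actCLM f x‖ ≤ ‖f‖ * ‖x‖ := by
  refine induction_on x (isClosed_le (by fun_prop) (by fun_prop)) fun x => ?_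
  rw [actCLM_ofAlg, ofAlg.norm_map, ofAlg.norm_map]
  exact norm_algAct_le f x

/-- `A ⊗ B` as a `C₀(X)`-algebra, with `f · (a ⊗ b) = (f · a) ⊗ b`. -/
instance _root_.C0Algebra.maxTensor : C0Algebra X (MaxTensor A B) :=
  ofAction actCLM
    (fun f g x => by
      refine induction_on x (isClosed_eq (by fun_prop) (by fun_prop)) fun x => ?_
      simp only [actCLM_ofAlg, algAct_add, map_add])
    (fun c f x => by
      refine induction_on x (isClosed_eq (by fun_prop) (by fun_prop)) fun x => ?_
      simp only [actCLM_ofAlg, algAct_smul, map_smul])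
    (fun f g x => by
      refine induction_on x (isClosed_eq (by fun_prop) (by fun_prop)) fun x => ?_
      simp only [actCLM_ofAlg, algAct_mul])
    (fun f x => by
      refine induction_on x (isClosed_eq (by fun_prop) (by fun_prop)) fun x => ?_
      simp only [actCLM_ofAlg, ← ofAlg_star, algAct_star])
    (fun f x y => by
      refine induction_on x (isClosed_eq (by fun_prop) (by fun_prop)) fun x => ?_
      refine induction_on y (isClosed_eq (by fun_prop) (by fun_prop)) fun y => ?_
      simp only [actCLM_ofAlg, ← ofAlg_mul, algAct_mul_left])
    (fun f x y => by
      refine induction_on x (isClosed_eq (by fun_prop) (by fun_prop)) fun x => ?_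
      refine induction_on y (isClosed_eq (by fun_prop) (by fun_prop)) fun y => ?_
      simp only [actCLM_ofAlg, ← ofAlg_mul, algAct_mul_right])
    (by
      obtain ⟨l, hl, h1, h2⟩ := exists_filter_act X A
      have h3 : ∀ x : AlgTensor A B, Tendsto (fun f => algAct f x) l (𝓝 x) := fun x => by
        induction x using alg_induction with
        | h0 => simpa using tendsto_const_nhds
        | ha x y hx hy => simpa only [map_add] using hx.add hy
        | ht a b =>
          rw [tendsto_iff_norm_sub_tendsto_zero]
          have h4 := (tendsto_iff_norm_sub_tendsto_zero.1 (h2 a)).mul_const ‖b‖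
          rw [zero_mul] at h4
          refine squeeze_zero (fun _ => norm_nonneg _) (fun f => ?_) h4
          have h5 : algAct f (algTmul a b) - algTmul a b = algTmul (act f a - a) b :=
            (TensorProduct.sub_tmul (R := ℂ) (act f a) a b).symm
          rw [h5]
          exact norm_algTmul_le _ _
      intro x
      refine induction_on x isClosed_closure fun x => ?_
      refine mem_closure_of_tendsto
        ((ofAlg (A := A) (B := B)).continuous.continuousAt.tendsto.comp (h3 x))
        (Eventually.of_forall fun f => ?_)
      exact ⟨f, ofAlg x, actCLM_ofAlg f x⟩)

end MaxTensor
end maxTensor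

/-! ### The compact operators -/

section compacts

/-- The separable Hilbert space `ℓ²(ℕ)`. -/
abbrev HilbertSeq : Type := lp (fun _ : ℕ => ℂ) 2

theorem isCompactOperator_adjoint {T : HilbertSeq →L[ℂ] HilbertSeq} (hT : IsCompactOperator T) :
    IsCompactOperator (ContinuousLinearMap.adjoint T) := by
  set S := ContinuousLinearMap.adjoint T with hS
  have hc : IsCompactOperator (T ∘L S) := hT.comp_clm S
  have key : ∀ x y : HilbertSeq, ‖S x - S y‖ ^ 2 ≤ ‖x - y‖ * ‖(T ∘L S) x - (T ∘L S) y‖ := by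
    intro x y
    have h1 : ((‖S (x - y)‖ : ℂ)) ^ 2 = inner ℂ (x - y) (T (S (x - y))) := by
      rw [← ContinuousLinearMap.adjoint_inner_left, ← hS, inner_self_eq_norm_sq_to_K]
      rfl
    have h2 := norm_inner_le_norm (𝕜 := ℂ) (x - y) (T (S (x - y)))
    rw [← h1, norm_pow, Complex.norm_real, norm_norm] at h2
    simpa [map_sub] using h2
  obtain ⟨L, hL, hsub⟩ := IsCompactOperator.image_closedBall_subset_compact
    (f := ((T ∘L S : HilbertSeq →L[ℂ] HilbertSeq) : HilbertSeq →ₗ[ℂ] HilbertSeq)) hc 1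
  have hb := hL.totallyBounded.subset hsub
  change IsCompactOperator ((S : HilbertSeq →L[ℂ] HilbertSeq) : HilbertSeq →ₗ[ℂ] HilbertSeq)
  rw [isCompactOperator_iff_isCompact_closure_image_closedBall
    (S : HilbertSeq →ₗ[ℂ] HilbertSeq) zero_lt_one]
  refine TotallyBounded.isCompact_of_isClosed (TotallyBounded.closure ?_) isClosed_closure
  rw [Metric.totallyBounded_iff]
  intro ε hε
  obtain ⟨t, hts, htf, htc⟩ := Metric.finite_approx_of_totallyBounded hb (ε ^ 2 / 4) (by positivity)
  have hts' : ∀ y ∈ t, ∃ x : HilbertSeq, x ∈ Metric.closedBall (0 : HilbertSeq) 1 ∧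
    (T ∘L S) x = y := fun y hy => hts hy
  choose! g hg using hts'
  refine ⟨(fun y => S (g y)) '' t, htf.image _, ?_⟩
  rintro _ ⟨x, hx, rfl⟩
  obtain ⟨y, hy, hxy⟩ := Set.mem_iUnion₂.1 (htc (Set.mem_image_of_mem _ hx))
  refine Set.mem_iUnion₂.2 ⟨S (g y), ⟨y, hy, rfl⟩, ?_⟩
  have h1 := (hg y hy).1
  have h2 := (hg y hy).2
  rw [Metric.mem_ball, dist_eq_norm] at hxy ⊢
  rw [← h2] at hxy
  rw [Metric.mem_closedBall, dist_zero_right] at h1 hx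
  have h3 := key x (g y)
  have h4 : ‖x - g y‖ ≤ 2 := (norm_sub_le _ _).trans (by linarith)
  change ‖(T ∘L S) x - (T ∘L S) (g y)‖ < _ at hxy
  change ‖S x - S (g y)‖ < ε
  have h5 : ‖S x - S (g y)‖ ^ 2 < ε ^ 2 := by
    calc _ ≤ _ := h3
      _ ≤ 2 * (ε ^ 2 / 4) := by gcongr
      _ < ε ^ 2 := by nlinarith [sq_pos_of_pos hε]
  exact lt_of_pow_lt_pow_left₀ 2 hε.le h5

/-- The C*-algebra `K` of compact operators on `ℓ²(ℕ)`. -/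
def compactSubalgebra : NonUnitalStarSubalgebra ℂ (HilbertSeq →L[ℂ] HilbertSeq) where
  carrier := {T | IsCompactOperator T}
  add_mem' h1 h2 := h1.add h2
  zero_mem' := isCompactOperator_zero
  mul_mem' {_ T} h1 _ := h1.comp_clm T
  smul_mem' c _ h := h.smul c
  star_mem' h := isCompactOperator_adjoint h

instance compactSubalgebra.isClosed :
    IsClosed (compactSubalgebra : Set (HilbertSeq →L[ℂ] HilbertSeq)) :=
  isClosed_setOfPred_isCompactOperator

/-- The C*-algebra `K` of compact operators on `ℓ²(ℕ)`. -/
abbrev Compacts : Type := compactSubalgebra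

instance Compacts.instCStar : NonUnitalCStarAlgebra Compacts :=
  NonUnitalStarSubalgebra.nonUnitalCStarAlgebra _

end compacts

/-! ### Asymptotic `C₀(X)`-morphisms and their homotopy classes -/

/-- An asymptotic `C₀(X)`-morphism `{ψ_t} : A → B`, `t ∈ [1, ∞)`: a family of maps such that
`t ↦ ψ_t(a)` is continuous and bounded for each `a`, and which is asymptotically linear,
multiplicative, `*`-preserving and `C₀(X)`-linear. -/
@[ext]
structure AsymptoticMorphism (X : Type u) [TopologicalSpace X] (A : Type v) (B : Type w)
    [NonUnitalCStarAlgebra A] [NonUnitalCStarAlgebra B] [C0Algebra X A] [C0Algebra X B] where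
  toFun : Set.Ici (1 : ℝ) → A → B
  continuous' : ∀ a, Continuous fun t => toFun t a
  bounded' : ∀ a, ∃ C, ∀ t, ‖toFun t a‖ ≤ C
  add' : ∀ a b, Tendsto (fun t => toFun t (a + b) - (toFun t a + toFun t b)) atTop (𝓝 0)
  smul' : ∀ (c : ℂ) a, Tendsto (fun t => toFun t (c • a) - c • toFun t a) atTop (𝓝 0)
  mul' : ∀ a b, Tendsto (fun t => toFun t (a * b) - toFun t a * toFun t b) atTop (𝓝 0)
  star' : ∀ a, Tendsto (fun t => toFun t (star a) - star (toFun t a)) atTop (𝓝 0)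
  act' : ∀ (f : C₀(X, ℂ)) a, Tendsto (fun t => toFun t (act f a) - act f (toFun t a)) atTop (𝓝 0)

namespace AsymptoticMorphism

variable {X : Type u} [TopologicalSpace X] {A : Type v} {B : Type w} {C : Type*}
  [NonUnitalCStarAlgebra A] [NonUnitalCStarAlgebra B] [NonUnitalCStarAlgebra C]
  [C0Algebra X A] [C0Algebra X B] [C0Algebra X C]

instance : CoeFun (AsymptoticMorphism X A B) fun _ => Set.Ici (1 : ℝ) → A → B := ⟨toFun⟩

/-- The zero morphism. -/
instance : Zero (AsymptoticMorphism X A B) where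
  zero :=
    { toFun := fun _ _ => 0
      continuous' := fun _ => continuous_const
      bounded' := fun _ => ⟨0, by simp⟩
      add' := by simp
      smul' := by simp
      mul' := by simp
      star' := by simp
      act' := by simp }

/-- Composition of an asymptotic `C₀(X)`-morphism with a `C₀(X)`-morphism. -/
def map (φ : B →⋆ₙₐ[ℂ] C) (hφ : ∀ (f : C₀(X, ℂ)) b, φ (act f b) = act f (φ b))
    (ψ : AsymptoticMorphism X A B) : AsymptoticMorphism X A C :=
  have hc : Continuous φ := AddMonoidHomClass.continuous_of_bound φ 1 fun b => by
    simpa using NonUnitalStarAlgHom.norm_apply_le φ b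
  have h0 : Tendsto φ (𝓝 0) (𝓝 0) := by simpa using hc.tendsto 0
  { toFun := fun t a => φ (ψ t a)
    continuous' := fun a => hc.comp (ψ.continuous' a)
    bounded' := fun a => by
      obtain ⟨C, hC⟩ := ψ.bounded' a
      exact ⟨C, fun t => (NonUnitalStarAlgHom.norm_apply_le φ _).trans (hC t)⟩
    add' := fun a b => by simpa [Function.comp_def] using h0.comp (ψ.add' a b)
    smul' := fun c a => by simpa [Function.comp_def] using h0.comp (ψ.smul' c a)
    mul' := fun a b => by simpa [Function.comp_def] using h0.comp (ψ.mul' a b)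
    star' := fun a => by simpa [Function.comp_def, map_star] using h0.comp (ψ.star' a)
    act' := fun f a => by simpa [Function.comp_def, hφ] using h0.comp (ψ.act' f a) }

/-- `C₀(X)`-homotopy of asymptotic `C₀(X)`-morphisms. -/
def Homotopic (ψ φ : AsymptoticMorphism X A B) : Prop :=
  ∃ Ψ : AsymptoticMorphism X A C(I, B), (∀ t a, Ψ t a 0 = ψ t a) ∧ ∀ t a, Ψ t a 1 = φ t a

theorem Homotopic.refl (ψ : AsymptoticMorphism X A B) : Homotopic ψ ψ :=
  ⟨ψ.map (C := C(I, B))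
    { toFun := fun b => ContinuousMap.const I b
      map_smul' := fun _ _ => rfl
      map_zero' := rfl
      map_add' := fun _ _ => rfl
      map_mul' := fun _ _ => rfl
      map_star' := fun _ => rfl } (fun _ _ => rfl), fun _ _ => rfl, fun _ _ => rfl⟩

theorem Homotopic.symm {ψ φ : AsymptoticMorphism X A B} (h : Homotopic ψ φ) : Homotopic φ ψ := by
  obtain ⟨Ψ, h0, h1⟩ := h
  refine ⟨Ψ.map (C := C(I, B))
    { toFun := fun F => F.comp ⟨σ, continuous_symm⟩
      map_smul' := fun _ _ => rfl
      map_zero' := rfl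
      map_add' := fun _ _ => rfl
      map_mul' := fun _ _ => rfl
      map_star' := fun _ => rfl } (fun _ _ => rfl), fun t a => ?_, fun t a => ?_⟩
  · change Ψ t a (σ 0) = _
    rw [symm_zero, h1]
  · change Ψ t a (σ 1) = _
    rw [symm_one, h0]

theorem path_act_apply (f : C₀(X, ℂ)) (F : C(I, B)) (s : I) : act f F s = act f (F s) := rfl

/-- Concatenation of paths in `B`. -/
def concat (F G : C(I, B)) (h : F 1 = G 0) : C(I, B) :=
  ((⟨F, rfl, h⟩ : Path (F 0) (G 0)).trans ⟨G, rfl, rfl⟩).toContinuousMap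

theorem concat_apply (F G : C(I, B)) (h : F 1 = G 0) (s : I) :
    concat F G h s = if h : (s : ℝ) ≤ 1 / 2 then
      F ⟨2 * s, (mul_pos_mem_iff zero_lt_two).2 ⟨s.2.1, h⟩⟩
      else G ⟨2 * s - 1, two_mul_sub_one_mem_iff.2 ⟨(not_le.1 h).le, s.2.2⟩⟩ :=
  Path.trans_apply _ _ s

theorem concat_halves (s : I) :
    (∃ r : I, ∀ (F G : C(I, B)) (h : F 1 = G 0), concat F G h s = F r) ∨
      ∃ r : I, ∀ (F G : C(I, B)) (h : F 1 = G 0), concat F G h s = G r := by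
  by_cases hs : (s : ℝ) ≤ 1 / 2
  · exact Or.inl ⟨_, fun F G h => by rw [concat_apply, dif_pos hs]⟩
  · exact Or.inr ⟨_, fun F G h => by rw [concat_apply, dif_neg hs]⟩

/-- A path whose values are, on each half of `[0,1]`, values of `F` or `G`. -/
theorem norm_le_of_halves {H F G : C(I, B)} (h : ∀ s, (∃ r, H s = F r) ∨ ∃ r, H s = G r) :
    ‖H‖ ≤ ‖F‖ + ‖G‖ := by
  refine (ContinuousMap.norm_le _ (by positivity)).2 fun s => ?_
  rcases h s with ⟨r, hr⟩ | ⟨r, hr⟩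
  · rw [hr]
    exact (F.norm_coe_le_norm r).trans (by simp)
  · rw [hr]
    exact (G.norm_coe_le_norm r).trans (by simp)

theorem tendsto_of_halves {T : Type*} {l : Filter T} {H F G : T → C(I, B)}
    (h : ∀ t s, (∃ r, H t s = F t r) ∨ ∃ r, H t s = G t r)
    (hF : Tendsto F l (𝓝 0)) (hG : Tendsto G l (𝓝 0)) : Tendsto H l (𝓝 0) := by
  refine squeeze_zero_norm (a := fun t => ‖F t‖ + ‖G t‖) (fun t => norm_le_of_halves (h t)) ?_
  simpa using hF.norm.add hG.norm

theorem Homotopic.trans {ψ φ χ : AsymptoticMorphism X A B} (h : Homotopic ψ φ)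
    (h' : Homotopic φ χ) : Homotopic ψ χ := by
  obtain ⟨Ψ, hΨ0, hΨ1⟩ := h
  obtain ⟨Φ, hΦ0, hΦ1⟩ := h'
  have hm : ∀ t a, Ψ t a 1 = Φ t a 0 := fun t a => by rw [hΨ1, hΦ0]
  refine ⟨
    { toFun := fun t a => concat (Ψ t a) (Φ t a) (hm t a)
      continuous' := fun a => ?_
      bounded' := fun a => ?_
      add' := fun a b => tendsto_of_halves (fun t s => ?_) (Ψ.add' a b) (Φ.add' a b)
      smul' := fun c a => tendsto_of_halves (fun t s => ?_) (Ψ.smul' c a) (Φ.smul' c a)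
      mul' := fun a b => tendsto_of_halves (fun t s => ?_) (Ψ.mul' a b) (Φ.mul' a b)
      star' := fun a => tendsto_of_halves (fun t s => ?_) (Ψ.star' a) (Φ.star' a)
      act' := fun f a => tendsto_of_halves (fun t s => ?_) (Ψ.act' f a) (Φ.act' f a) },
    fun t a => ?_, fun t a => ?_⟩
  · rw [continuous_iff_continuousAt]
    intro t₀
    rw [ContinuousAt, ← tendsto_sub_nhds_zero_iff]
    refine tendsto_of_halves (fun t s => ?_)
      (tendsto_sub_nhds_zero_iff.2 ((Ψ.continuous' a).tendsto t₀))
      (tendsto_sub_nhds_zero_iff.2 ((Φ.continuous' a).tendsto t₀))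
    rcases concat_halves (B := B) s with ⟨r, hr⟩ | ⟨r, hr⟩
    · exact Or.inl ⟨r, by simp only [ContinuousMap.sub_apply, hr]⟩
    · exact Or.inr ⟨r, by simp only [ContinuousMap.sub_apply, hr]⟩
  · obtain ⟨C, hC⟩ := Ψ.bounded' a
    obtain ⟨D, hD⟩ := Φ.bounded' a
    refine ⟨C + D, fun t => (norm_le_of_halves fun s => ?_).trans (add_le_add (hC t) (hD t))⟩
    exact (concat_halves (B := B) s).imp (fun ⟨r, hr⟩ => ⟨r, hr _ _ _⟩) fun ⟨r, hr⟩ => ⟨r, hr _ _ _⟩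
  · rcases concat_halves (B := B) s with ⟨r, hr⟩ | ⟨r, hr⟩
    · exact Or.inl ⟨r, by simp only [ContinuousMap.sub_apply, ContinuousMap.add_apply, hr]⟩
    · exact Or.inr ⟨r, by simp only [ContinuousMap.sub_apply, ContinuousMap.add_apply, hr]⟩
  · rcases concat_halves (B := B) s with ⟨r, hr⟩ | ⟨r, hr⟩
    · exact Or.inl ⟨r, by simp only [ContinuousMap.sub_apply, ContinuousMap.smul_apply, hr]⟩
    · exact Or.inr ⟨r, by simp only [ContinuousMap.sub_apply, ContinuousMap.smul_apply, hr]⟩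
  · rcases concat_halves (B := B) s with ⟨r, hr⟩ | ⟨r, hr⟩
    · exact Or.inl ⟨r, by simp only [ContinuousMap.sub_apply, ContinuousMap.mul_apply, hr]⟩
    · exact Or.inr ⟨r, by simp only [ContinuousMap.sub_apply, ContinuousMap.mul_apply, hr]⟩
  · rcases concat_halves (B := B) s with ⟨r, hr⟩ | ⟨r, hr⟩
    · exact Or.inl ⟨r, by simp only [ContinuousMap.sub_apply, ContinuousMap.star_apply, hr]⟩
    · exact Or.inr ⟨r, by simp only [ContinuousMap.sub_apply, ContinuousMap.star_apply, hr]⟩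
  · rcases concat_halves (B := B) s with ⟨r, hr⟩ | ⟨r, hr⟩
    · exact Or.inl ⟨r, by simp only [ContinuousMap.sub_apply, path_act_apply, hr]⟩
    · exact Or.inr ⟨r, by simp only [ContinuousMap.sub_apply, path_act_apply, hr]⟩
  · exact (Path.source _).trans (hΨ0 t a)
  · exact (Path.target _).trans (hΦ1 t a)

instance setoid (X : Type u) [TopologicalSpace X] (A : Type v) (B : Type w)
    [NonUnitalCStarAlgebra A] [NonUnitalCStarAlgebra B] [C0Algebra X A] [C0Algebra X B] :
    Setoid (AsymptoticMorphism X A B) :=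
  ⟨Homotopic, Homotopic.refl, Homotopic.symm, Homotopic.trans⟩

end AsymptoticMorphism

/-- The set `⟦A, B⟧_X` of `C₀(X)`-homotopy classes of asymptotic `C₀(X)`-morphisms `A → B`. -/
def HomotopyClasses (X : Type u) [TopologicalSpace X] (A : Type v) (B : Type w)
    [NonUnitalCStarAlgebra A] [NonUnitalCStarAlgebra B] [C0Algebra X A] [C0Algebra X B] :
    Type (max v w) := Quotient (AsymptoticMorphism.setoid X A B)

namespace HomotopyClasses

variable {X : Type u} [TopologicalSpace X] {A : Type v} {B : Type w}
  [NonUnitalCStarAlgebra A] [NonUnitalCStarAlgebra B] [C0Algebra X A] [C0Algebra X B]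

/-- The class `⟦ψ_t⟧_X` of an asymptotic `C₀(X)`-morphism. -/
def mk (ψ : AsymptoticMorphism X A B) : HomotopyClasses X A B :=
  Quotient.mk (AsymptoticMorphism.setoid X A B) ψ

theorem mk_eq_mk {ψ φ : AsymptoticMorphism X A B} : mk ψ = mk φ ↔ ψ.Homotopic φ := Quotient.eq

end HomotopyClasses

/-! ### Stability, direct sums and loop composition -/

section operations

variable (X : Type u) [TopologicalSpace X]

/-- `B` is `C₀(X)`-stable: `B ≅ B ⊗ K` by a `C₀(X)`-linear `*`-isomorphism. -/
def IsC0Stable (B : Type w) [NonUnitalCStarAlgebra B] [C0Algebra X B] : Prop :=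
  ∃ ρ : B ≃⋆ₐ[ℂ] MaxTensor B Compacts, ∀ (f : C₀(X, ℂ)) b, ρ (act f b) = act f (ρ b)

variable {B : Type w} [NonUnitalCStarAlgebra B]

/-- The matrix in `M₂(B)` with entry `b` at `(i, j)` and zeros elsewhere. -/
def matrixSingle (i j : Fin 2) (b : B) : CStarMatrix (Fin 2) (Fin 2) B :=
  CStarMatrix.ofMatrix (Matrix.single i j b)

/-- The matrix `diag(b, c)` in `M₂(B)`. -/
def matrixDiag (b c : B) : CStarMatrix (Fin 2) (Fin 2) B :=
  CStarMatrix.ofMatrix !![b, 0; 0, c]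

variable [C0Algebra X B]

/-- A `C₀(X)`-linear `*`-isomorphism `θ : M₂(B) ≅ B` is *induced by a stabilization* if it is the
composite `M₂(B) ≅ M₂(C ⊗ K) ≅ C ⊗ M₂(K) ≅ C ⊗ K ≅ B` for a `C₀(X)`-algebra `C`, a `C₀(X)`-linear
`*`-isomorphism `ρ : B ≅ C ⊗ K` and a `*`-isomorphism `κ : M₂(K) ≅ K`. -/
def IsStabilizationIso (θ : CStarMatrix (Fin 2) (Fin 2) B ≃⋆ₐ[ℂ] B) : Prop :=
  (∀ (f : C₀(X, ℂ)) (M : CStarMatrix (Fin 2) (Fin 2) B),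
    θ (CStarMatrix.ofMatrix fun i j => act f (M i j)) = act f (θ M)) ∧
  ∃ (C : Type w) (_ : NonUnitalCStarAlgebra C) (_ : C0Algebra X C)
    (ρ : B ≃⋆ₐ[ℂ] MaxTensor C Compacts) (κ : CStarMatrix (Fin 2) (Fin 2) Compacts ≃⋆ₐ[ℂ] Compacts),
    (∀ (f : C₀(X, ℂ)) b, ρ (act f b) = act f (ρ b)) ∧
    ∀ (i j : Fin 2) (c : C) (k : Compacts),
      ρ (θ (matrixSingle i j (ρ.symm (MaxTensor.tmul c k)))) =
        MaxTensor.tmul c (κ (matrixSingle i j k))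

end operations

namespace AsymptoticMorphism

variable {X : Type u} [TopologicalSpace X] {A : Type v} {B : Type w}
  [NonUnitalCStarAlgebra A] [NonUnitalCStarAlgebra B] [C0Algebra X A] [C0Algebra X B]

/-- `χ` is the direct sum of `ψ` and `φ`, i.e. `χ_t(a) = diag(ψ_t(a), φ_t(a))` in `M₂(B) ≅ B`. -/
def IsDirectSum (θ : CStarMatrix (Fin 2) (Fin 2) B ≃⋆ₐ[ℂ] B)
    (ψ φ χ : AsymptoticMorphism X A B) : Prop :=
  ∀ t a, χ t a = θ (matrixDiag (ψ t a) (φ t a))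

/-- `χ` is the loop composition of `ψ` and `φ`: for each `t` and `a`, the loop `χ_t(a)` runs through
`ψ_t(a)` on `[0, 1/2]` and through `φ_t(a)` on `[1/2, 1]`. -/
def IsLoopComposition (ψ φ χ : AsymptoticMorphism X A (Susp B)) : Prop :=
  ∀ t a (s : I), (χ t a).1 s =
    if h : (s : ℝ) ≤ 1 / 2 then
      (ψ t a).1 ⟨2 * s, (mul_pos_mem_iff zero_lt_two).2 ⟨s.2.1, h⟩⟩
    else (φ t a).1 ⟨2 * s - 1, two_mul_sub_one_mem_iff.2 ⟨(not_le.1 h).le, s.2.2⟩⟩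

end AsymptoticMorphism

end

noncomputable section

open Filter Topology MultiplierAlgebra ZeroAtInfty TensorProduct

open C0Algebra unitInterval
open AsymptoticMorphism

/-! ### Equivariant homomorphisms and orthogonal sums -/

/-! Every operation in the theorem has the form `(ψ, φ) ↦ α ∘ ψ + β ∘ φ`, where `α` and `β` are
`C₀(X)`-linear endomorphisms of the target `D` with `α(x) β(y) = 0`. Orthogonality makes the sum an
asymptotic morphism, and applying `α` and `β` pointwise to homotopies makes it well defined on
classes. For loop composition `α` and `β` squeeze a loop into one half of `[0,1]`. For a direct sum
they are conjugations by isometries `v₀, v₁ ∈ M(D)` with `v₀v₀* + v₁v₁* = 1`.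

An algebraic law then follows from one endomorphism `γ` of `D` that carries one side of the law
exactly to the other and is trivial up to homotopy (`ActsTrivially`). For loops `γ` is a
reparametrization of `[0,1]` fixing the endpoints, trivial by convexity; inverses come from
contracting a reversed loop followed by the loop. For direct sums `γ` is conjugation by an isometry
`m ∈ M(D)`. If `D ≅ C ⊗ K`, every such conjugation is trivial: a strictly continuous path of
isometries joins `1` to `v₀`, isometries with orthogonal ranges are joined by a rotation, and so `m
~ v₀m ~ v₁ ~ v₀ ~ 1` at the level of conjugations (`conj_actsTrivially`).

Two analytic facts connect this with the given definitions. Every isomorphism `M₂(K) ≅ K` is spatial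
(`exists_isometryPair`), so each stabilization isomorphism acts on diagonal matrices through a pair
of isometries; any two pairs differ by a unitary, hence all direct sums agree. Moreover `S(B ⊗ K) ≅
SB ⊗ K` (`suspEquiv`), so `S(B ⊗ K)` is itself stable. Injectivity there needs slice maps `a ⊗ k ↦
⟨e_i, k e_j⟩ a` that are bounded for the maximal norm; the bound comes from a C*-seminorm built from
compressions to `M_n(A)`.

On `S(B ⊗ K)` reparametrizing the loop commutes with conjugating its values, so the two operations
satisfy the interchange law. They share the unit `0`, and the Eckmann–Hilton argument identifies
them (`loop_eq_pairOp`); the group is then abelian. -/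

/-- A `C₀(X)`-linear `*`-homomorphism. -/
structure C0Hom (X : Type u) [TopologicalSpace X] (D E : Type*) [NonUnitalCStarAlgebra D]
    [NonUnitalCStarAlgebra E] [C0Algebra X D] [C0Algebra X E] where
  toHom : D →⋆ₙₐ[ℂ] E
  map_act' : ∀ (f : C₀(X, ℂ)) d, toHom (act f d) = act f (toHom d)

namespace C0Hom

variable {X : Type u} [TopologicalSpace X] {D E : Type*} [NonUnitalCStarAlgebra D]
  [NonUnitalCStarAlgebra E] [C0Algebra X D] [C0Algebra X E]

instance : CoeFun (C0Hom X D E) fun _ => D → E := ⟨fun φ => φ.toHom⟩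

theorem map_act (φ : C0Hom X D E) (f : C₀(X, ℂ)) (d : D) : φ (act f d) = act f (φ d) :=
  φ.map_act' f d

theorem norm_apply_le (φ : C0Hom X D E) (d : D) : ‖φ d‖ ≤ ‖d‖ :=
  NonUnitalStarAlgHom.norm_apply_le φ.toHom d

theorem continuous (φ : C0Hom X D E) : Continuous φ :=
  AddMonoidHomClass.continuous_of_bound φ.toHom 1 fun b => by simpa using φ.norm_apply_le b

/-- Pointwise application of a homomorphism to a path. -/
def path (φ : C0Hom X D E) : C0Hom X C(I, D) C(I, E) where
  toHom :=
    { toFun := fun p => ⟨fun s => φ (p s), φ.continuous.comp p.continuous⟩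
      map_smul' := fun c p => by ext s; exact map_smul φ.toHom c (p s)
      map_zero' := by ext s; exact map_zero φ.toHom
      map_add' := fun p q => by ext s; exact map_add φ.toHom (p s) (q s)
      map_mul' := fun p q => by ext s; exact map_mul φ.toHom (p s) (q s)
      map_star' := fun p => by ext s; exact map_star φ.toHom (p s) }
  map_act' := fun f p => by ext s; exact φ.map_act f (p s)

@[simp] theorem path_apply (φ : C0Hom X D E) (p : C(I, D)) (s : I) : φ.path p s = φ (p s) := rfl

/-- A pointwise continuous family of homomorphisms, as a homomorphism into paths. -/
def ofFamily (φ : I → C0Hom X D E) (h : ∀ d, Continuous fun s => φ s d) :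
    C0Hom X D C(I, E) where
  toHom :=
    { toFun := fun d => ⟨fun s => φ s d, h d⟩
      map_smul' := fun c d => by ext s; exact map_smul (φ s).toHom c d
      map_zero' := by ext s; exact map_zero (φ s).toHom
      map_add' := fun d e => by ext s; exact map_add (φ s).toHom d e
      map_mul' := fun d e => by ext s; exact map_mul (φ s).toHom d e
      map_star' := fun d => by ext s; exact map_star (φ s).toHom d }
  map_act' := fun f d => by ext s; exact (φ s).map_act f d

@[simp] theorem ofFamily_apply (φ : I → C0Hom X D E) (h : ∀ d, Continuous fun s => φ s d) (d : D)
    (s : I) : ofFamily φ h d s = φ s d := rfl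

/-- Two homomorphisms have orthogonal ranges. -/
def Orthogonal (α β : C0Hom X D E) : Prop := ∀ x y, α x * β y = 0

theorem Orthogonal.symm {α β : C0Hom X D E} (h : Orthogonal α β) : Orthogonal β α := fun x y => by
  have h1 := congrArg star (h (star y) (star x))
  rw [star_mul, star_zero, ← map_star, ← map_star, star_star, star_star] at h1
  exact h1

theorem Orthogonal.path {α β : C0Hom X D E} (h : Orthogonal α β) :
    Orthogonal α.path β.path := fun x y => by
  ext s
  exact h (x s) (y s)

end C0Hom

namespace AsymptoticMorphism

variable {X : Type u} [TopologicalSpace X] {A : Type v} {D E : Type*} [NonUnitalCStarAlgebra A]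
  [NonUnitalCStarAlgebra D] [NonUnitalCStarAlgebra E] [C0Algebra X A] [C0Algebra X D]
  [C0Algebra X E]

/-- The composite of an asymptotic morphism with a homomorphism. -/
def push (φ : C0Hom X D E) (ψ : AsymptoticMorphism X A D) : AsymptoticMorphism X A E :=
  ψ.map φ.toHom φ.map_act

@[simp] theorem push_apply (φ : C0Hom X D E) (ψ : AsymptoticMorphism X A D) (t : Set.Ici (1 : ℝ))
    (a : A) : ψ.push φ t a = φ (ψ t a) := rfl

/-- The sum of two asymptotic morphisms pushed forward along homomorphisms with orthogonal
ranges. -/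
def orthSum (α β : C0Hom X D E) (h : α.Orthogonal β) (ψ φ : AsymptoticMorphism X A D) :
    AsymptoticMorphism X A E where
  toFun t a := α (ψ t a) + β (φ t a)
  continuous' a := ((ψ.push α).continuous' a).add ((φ.push β).continuous' a)
  bounded' a := by
    obtain ⟨C, hC⟩ := (ψ.push α).bounded' a
    obtain ⟨C', hC'⟩ := (φ.push β).bounded' a
    exact ⟨C + C', fun t => (norm_add_le _ _).trans (add_le_add (hC t) (hC' t))⟩
  add' a b := by
    have h1 := ((ψ.push α).add' a b).add ((φ.push β).add' a b)
    rw [add_zero] at h1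
    refine h1.congr fun t => ?_
    simp only [push_apply]
    abel
  smul' c a := by
    have h1 := ((ψ.push α).smul' c a).add ((φ.push β).smul' c a)
    rw [add_zero] at h1
    refine h1.congr fun t => ?_
    simp only [push_apply, smul_add]
    abel
  mul' a b := by
    have h1 := ((ψ.push α).mul' a b).add ((φ.push β).mul' a b)
    rw [add_zero] at h1
    refine h1.congr fun t => ?_
    -- Orthogonality, in both orders, removes the two cross terms of the product.
    simp only [push_apply, add_mul, mul_add, h _ _, h.symm _ _]
    abel
  star' a := by
    have h1 := ((ψ.push α).star' a).add ((φ.push β).star' a)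
    rw [add_zero] at h1
    refine h1.congr fun t => ?_
    simp only [push_apply, star_add]
    abel
  act' f a := by
    have h1 := ((ψ.push α).act' f a).add ((φ.push β).act' f a)
    rw [add_zero] at h1
    refine h1.congr fun t => ?_
    simp only [push_apply, map_add]
    abel

@[simp] theorem orthSum_apply (α β : C0Hom X D E) (h : α.Orthogonal β)
    (ψ φ : AsymptoticMorphism X A D) (t : Set.Ici (1 : ℝ)) (a : A) :
    orthSum α β h ψ φ t a = α (ψ t a) + β (φ t a) := rfl

@[simp] theorem zero_apply (t : Set.Ici (1 : ℝ)) (a : A) :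
    (0 : AsymptoticMorphism X A D) t a = 0 := rfl

theorem ext_apply {ψ φ : AsymptoticMorphism X A D} (h : ∀ t a, ψ t a = φ t a) : ψ = φ :=
  AsymptoticMorphism.ext (funext fun t => funext fun a => h t a)

theorem Homotopic.push {ψ φ : AsymptoticMorphism X A D} (h : Homotopic ψ φ) (α : C0Hom X D E) :
    Homotopic (ψ.push α) (φ.push α) := by
  obtain ⟨Ψ, h0, h1⟩ := h
  exact ⟨Ψ.push α.path, fun t a => by simp [h0], fun t a => by simp [h1]⟩

theorem Homotopic.orthSum {α β : C0Hom X D E} (h : α.Orthogonal β)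
    {ψ ψ' φ φ' : AsymptoticMorphism X A D} (h1 : Homotopic ψ ψ') (h2 : Homotopic φ φ') :
    Homotopic (orthSum α β h ψ φ) (orthSum α β h ψ' φ') := by
  obtain ⟨Ψ, hΨ0, hΨ1⟩ := h1
  obtain ⟨Φ, hΦ0, hΦ1⟩ := h2
  exact ⟨AsymptoticMorphism.orthSum α.path β.path h.path Ψ Φ, fun t a => by simp [hΨ0, hΦ0],
    fun t a => by simp [hΨ1, hΦ1]⟩

/-- A path of homomorphisms gives a homotopy. -/
theorem Homotopic.of_path (H : C0Hom X D C(I, E)) {α β : C0Hom X D E} (h0 : ∀ d, H d 0 = α d)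
    (h1 : ∀ d, H d 1 = β d) (ψ : AsymptoticMorphism X A D) :
    Homotopic (ψ.push α) (ψ.push β) :=
  ⟨ψ.push H, fun t a => by simp [h0], fun t a => by simp [h1]⟩

end AsymptoticMorphism

namespace C0Hom

variable {X : Type u} [TopologicalSpace X] (A : Type v) {D : Type*} [NonUnitalCStarAlgebra A]
  [NonUnitalCStarAlgebra D] [C0Algebra X A] [C0Algebra X D]

/-- The endomorphism `γ` of `D` induces the identity on homotopy classes of asymptotic morphisms
`A → D`. -/
def ActsTrivially (γ : C0Hom X D D) : Prop :=
  ∀ ψ : AsymptoticMorphism X A D, Homotopic (ψ.push γ) ψ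

end C0Hom

/-! ### Operations on homotopy classes and their laws -/

namespace HomotopyClasses

variable {X : Type u} [TopologicalSpace X] {A : Type v} {D : Type*} [NonUnitalCStarAlgebra A]
  [NonUnitalCStarAlgebra D] [C0Algebra X A] [C0Algebra X D]

/-- The operation on homotopy classes induced by a pair of endomorphisms with orthogonal ranges. -/
def op (α β : C0Hom X D D) (h : α.Orthogonal β) :
    HomotopyClasses X A D → HomotopyClasses X A D → HomotopyClasses X A D :=
  Quotient.map₂ (orthSum α β h) fun _ _ h1 _ _ h2 => Homotopic.orthSum h h1 h2

variable {α β γ : C0Hom X D D} (h : α.Orthogonal β)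

theorem op_mk (ψ φ : AsymptoticMorphism X A D) : op α β h (mk ψ) (mk φ) = mk (orthSum α β h ψ φ) :=
  rfl

theorem ind {P : HomotopyClasses X A D → Prop} (hP : ∀ ψ, P (mk ψ)) (x : HomotopyClasses X A D) :
    P x := Quotient.ind hP x

/-- Only the `β`-component survives, and `β` is trivial up to homotopy. -/
theorem op_zero_left (hβ : β.ActsTrivially A) (x : HomotopyClasses X A D) :
    op α β h (mk 0) x = x := by
  induction x using ind with | _ ψ => ?_
  rw [op_mk, mk_eq_mk]
  convert hβ ψ using 1
  exact ext_apply fun t a => by simp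

theorem op_zero_right (hα : α.ActsTrivially A) (x : HomotopyClasses X A D) :
    op α β h x (mk 0) = x := by
  induction x using ind with | _ ψ => ?_
  rw [op_mk, mk_eq_mk]
  convert hα ψ using 1
  exact ext_apply fun t a => by simp

/-- The three summands occupy the slots `αα, αβ, β` in one bracketing and `α, βα, ββ` in the other;
`γ` carries the first list to the second. -/
theorem op_assoc (hγ : γ.ActsTrivially A) (h1 : ∀ d, γ (α (α d)) = α d)
    (h2 : ∀ d, γ (α (β d)) = β (α d)) (h3 : ∀ d, γ (β d) = β (β d))
    (x y z : HomotopyClasses X A D) :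
    op α β h (op α β h x y) z = op α β h x (op α β h y z) := by
  induction x using ind with | _ ψ => ?_
  induction y using ind with | _ φ => ?_
  induction z using ind with | _ χ => ?_
  rw [op_mk, op_mk, op_mk, op_mk, mk_eq_mk]
  -- Up to homotopy `γ` may be applied to the left-hand side, after which both sides coincide for
  -- every `t` and `a`.
  refine (hγ _).symm.trans ?_
  convert Homotopic.refl _ using 1
  exact ext_apply fun t a => by simp [h1, h2, h3, add_assoc]

theorem op_comm (hγ : γ.ActsTrivially A) (h1 : ∀ d, γ (α d) = β d) (h2 : ∀ d, γ (β d) = α d)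
    (x y : HomotopyClasses X A D) : op α β h x y = op α β h y x := by
  induction x using ind with | _ ψ => ?_
  induction y using ind with | _ φ => ?_
  rw [op_mk, op_mk, mk_eq_mk]
  refine (hγ _).symm.trans ?_
  convert Homotopic.refl _ using 1
  exact ext_apply fun t a => by simp [h1, h2, add_comm]

/-- Taking for `γ` the conjugation that carries one pair of isometries to another, this makes the
direct sum independent of the pair. -/
theorem op_eq_op (hγ : γ.ActsTrivially A) {α' β' : C0Hom X D D} (h' : α'.Orthogonal β')
    (h1 : ∀ d, γ (α d) = α' d) (h2 : ∀ d, γ (β d) = β' d) (x y : HomotopyClasses X A D) :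
    op α β h x y = op α' β' h' x y := by
  induction x using ind with | _ ψ => ?_
  induction y using ind with | _ φ => ?_
  rw [op_mk, op_mk, mk_eq_mk]
  refine (hγ _).symm.trans ?_
  convert Homotopic.refl _ using 1
  exact ext_apply fun t a => by simp [h1, h2]

/-- Operations given by commuting pairs satisfy the interchange law. -/
theorem op_interchange {α' β' : C0Hom X D D} (h' : α'.Orthogonal β')
    (haa : ∀ d, α (α' d) = α' (α d)) (hab : ∀ d, α (β' d) = β' (α d))
    (hba : ∀ d, β (α' d) = α' (β d)) (hbb : ∀ d, β (β' d) = β' (β d))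
    (a b c d : HomotopyClasses X A D) :
    op α β h (op α' β' h' a b) (op α' β' h' c d) =
      op α' β' h' (op α β h a c) (op α β h b d) := by
  induction a using ind with | _ a => ?_
  induction b using ind with | _ b => ?_
  induction c using ind with | _ c => ?_
  induction d using ind with | _ d => ?_
  simp only [op_mk]
  congr 1
  -- No homotopy is needed: after commuting, both sides are the same sum of four terms.
  exact ext_apply fun t x => by simp [haa, hab, hba, hbb]; abel

/-- A path of homomorphisms from `0` to `αδ + βε` contracts the sum of `δψ` and `εψ`. This is the
source of inverses. -/
theorem op_push_eq_zero {δ ε : C0Hom X D D} (H : C0Hom X D C(I, D)) (h0 : ∀ d, H d 0 = 0)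
    (h1 : ∀ d, H d 1 = α (δ d) + β (ε d)) (ψ : AsymptoticMorphism X A D) :
    op α β h (mk (ψ.push δ)) (mk (ψ.push ε)) = mk 0 := by
  rw [op_mk, mk_eq_mk]
  exact Homotopic.symm ⟨ψ.push H, fun t a => by simp [h0], fun t a => by simp [h1]⟩

end HomotopyClasses

/-! ### Loops -/

namespace C0Hom

section substitution

variable {X : Type u} [TopologicalSpace X] {B : Type w} [NonUnitalCStarAlgebra B] [C0Algebra X B]

theorem susp_eval_eq_zero (F : Susp B) {s : I} (h : s = 0 ∨ s = 1) : F.1 s = 0 := by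
  rcases h with rfl | rfl
  exacts [F.2.1, F.2.2]

/-- Substitution of a continuous function `[0,1] → [0,1]` into loops. -/
def subst (h : C(I, I)) (h0 : h 0 = 0 ∨ h 0 = 1) (h1 : h 1 = 0 ∨ h 1 = 1) :
    C0Hom X (Susp B) (Susp B) where
  toHom :=
    { toFun := fun F => ⟨F.1.comp h, susp_eval_eq_zero F h0, susp_eval_eq_zero F h1⟩
      map_smul' := fun _ _ => rfl
      map_zero' := rfl
      map_add' := fun _ _ => rfl
      map_mul' := fun _ _ => rfl
      map_star' := fun _ => rfl }
  map_act' := fun f F => by ext s; rfl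

@[simp] theorem subst_apply (h : C(I, I)) (h0 : h 0 = 0 ∨ h 0 = 1) (h1 : h 1 = 0 ∨ h 1 = 1)
    (F : Susp B) (r : I) : (subst (X := X) h h0 h1 F).1 r = F.1 (h r) := rfl

theorem continuous_subst (H : C(I, C(I, I))) (h0 : ∀ s, H s 0 = 0 ∨ H s 0 = 1)
    (h1 : ∀ s, H s 1 = 0 ∨ H s 1 = 1) (F : Susp B) :
    Continuous fun s => subst (X := X) (H s) (h0 s) (h1 s) F :=
  Continuous.subtype_mk ((ContinuousMap.continuous_postcomp F.1).comp H.continuous) _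

/-- The homotopy of substitutions induced by a homotopy of functions `[0,1] → [0,1]`. -/
def substPath (H : C(I, C(I, I))) (h0 : ∀ s, H s 0 = 0 ∨ H s 0 = 1)
    (h1 : ∀ s, H s 1 = 0 ∨ H s 1 = 1) : C0Hom X (Susp B) C(I, Susp B) :=
  ofFamily (fun s => subst (H s) (h0 s) (h1 s)) (continuous_subst H h0 h1)

@[simp] theorem substPath_apply (H : C(I, C(I, I))) (h0 : ∀ s, H s 0 = 0 ∨ H s 0 = 1)
    (h1 : ∀ s, H s 1 = 0 ∨ H s 1 = 1) (F : Susp B) (s r : I) :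
    (substPath (X := X) H h0 h1 F s).1 r = F.1 (H s r) := rfl

/-- The closest point of `[0,1]`. -/
abbrev clamp (x : ℝ) : I := Set.projIcc 0 1 zero_le_one x

theorem coe_clamp (x : ℝ) : (clamp x : ℝ) = max 0 (min 1 x) := Set.coe_projIcc _ _ _ _

theorem clamp_of_nonpos {x : ℝ} (h : x ≤ 0) : clamp x = 0 := Set.projIcc_of_le_left _ h

theorem clamp_of_one_le {x : ℝ} (h : 1 ≤ x) : clamp x = 1 := Set.projIcc_of_right_le _ h

theorem clamp_of_mem {x : ℝ} (h : x ∈ I) : clamp x = ⟨x, h⟩ := Set.projIcc_of_mem _ h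

theorem continuous_clamp : Continuous clamp := continuous_projIcc

/-- A homotopy of real functions, clamped to `[0,1]`. -/
def clampHomotopy (H : I × I → ℝ) (hH : Continuous H) : C(I, C(I, I)) :=
  ContinuousMap.curry ⟨fun p => clamp (H p), continuous_clamp.comp hH⟩

@[simp] theorem clampHomotopy_apply (H : I × I → ℝ) (hH : Continuous H) (s r : I) :
    clampHomotopy H hH s r = clamp (H (s, r)) := rfl

/-- Convexity of `[0,1]`: the straight line from `h` to the identity keeps both endpoints fixed,
hence maps loops to loops throughout. -/
theorem subst_actsTrivially (A : Type v) [NonUnitalCStarAlgebra A] [C0Algebra X A] (h : C(I, I))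
    (h0 : h 0 = 0) (h1 : h 1 = 1) :
    (subst (X := X) (B := B) h (Or.inl h0) (Or.inr h1)).ActsTrivially A := fun ψ => by
  -- The values are convex combinations of points of `[0,1]`, so clamping does not alter them; it
  -- only supplies the codomain.
  let H := clampHomotopy (fun p => (1 - p.1) * h p.2 + p.1 * p.2) (by fun_prop)
  have key := Homotopic.of_path (A := A) (X := X) (substPath (B := B) H
    (fun s => Or.inl (by simp [H, h0]))
    (fun s => Or.inr (by simp [H, h1])))
    (α := subst h (Or.inl h0) (Or.inr h1))
    (β := subst (ContinuousMap.id I) (Or.inl rfl) (Or.inr rfl))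
    (fun F => by ext r; simp [H])
    (fun F => by ext r; simp [H]) ψ
  exact key

/-- Running through a loop on the first half of `[0,1]`. -/
def firstHalf : C0Hom X (Susp B) (Susp B) :=
  subst ⟨fun r => clamp (2 * r), continuous_clamp.comp (by fun_prop)⟩
    (Or.inl (clamp_of_nonpos (by simp))) (Or.inr (clamp_of_one_le (by simp)))

/-- Running through a loop on the second half of `[0,1]`. -/
def secondHalf : C0Hom X (Susp B) (Susp B) :=
  subst ⟨fun r => clamp (2 * r - 1), continuous_clamp.comp (by fun_prop)⟩
    (Or.inl (clamp_of_nonpos (by simp))) (Or.inr (clamp_of_one_le (by norm_num)))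

theorem firstHalf_apply (F : Susp B) (r : I) :
    (firstHalf (X := X) F).1 r = F.1 (clamp (2 * r)) := rfl

theorem secondHalf_apply (F : Susp B) (r : I) :
    (secondHalf (X := X) F).1 r = F.1 (clamp (2 * r - 1)) := rfl

variable (X B) in
-- At each parameter one of the two arguments is clamped to an endpoint, where loops vanish.
theorem halves_orthogonal : (firstHalf (X := X) (B := B)).Orthogonal secondHalf := fun F G => by
  ext r
  change (firstHalf (X := X) F).1 r * (secondHalf (X := X) G).1 r = 0
  rw [firstHalf_apply, secondHalf_apply]
  rcases le_total (r : ℝ) (1 / 2) with h | h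
  · rw [clamp_of_nonpos (x := 2 * r - 1) (by linarith), G.2.1, mul_zero]
  · rw [clamp_of_one_le (by linarith), F.2.2, zero_mul]

theorem firstHalf_actsTrivially (A : Type v) [NonUnitalCStarAlgebra A] [C0Algebra X A] :
    (firstHalf (X := X) (B := B)).ActsTrivially A :=
  subst_actsTrivially A _ (clamp_of_nonpos (by simp)) (clamp_of_one_le (by simp))

theorem secondHalf_actsTrivially (A : Type v) [NonUnitalCStarAlgebra A] [C0Algebra X A] :
    (secondHalf (X := X) (B := B)).ActsTrivially A :=
  subst_actsTrivially A _ (clamp_of_nonpos (by simp)) (clamp_of_one_le (by norm_num))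

/-- The reparametrization relating the two bracketings of a threefold loop composition. -/
def rebracket : C(I, I) :=
  -- The three linear pieces send `[0,1/2]`, `[1/2,3/4]`, `[3/4,1]` onto `[0,1/4]`, `[1/4,1/2]`,
  -- `[1/2,1]`. Their slopes `1/2, 1, 2` increase, so the function is convex and equals the maximum
  -- of its pieces.
  ⟨fun r => clamp (max ((r : ℝ) / 2) (max ((r : ℝ) - 1 / 4) (2 * (r : ℝ) - 1))),
    continuous_clamp.comp (by fun_prop)⟩

theorem coe_rebracket (r : I) :
    (rebracket r : ℝ) = max ((r : ℝ) / 2) (max ((r : ℝ) - 1 / 4) (2 * (r : ℝ) - 1)) := by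
  have h := r.2.1
  have h' := r.2.2
  change (clamp _ : ℝ) = _
  rw [coe_clamp, min_eq_right (max_le (by linarith) (max_le (by linarith) (by linarith))),
    max_eq_right (le_max_of_le_left (by linarith))]

theorem rebracket_zero : rebracket 0 = 0 := Subtype.ext (by rw [coe_rebracket]; norm_num)

theorem rebracket_one : rebracket 1 = 1 := Subtype.ext (by rw [coe_rebracket]; norm_num)

/-- This and the next two identities are the three hypotheses of `op_assoc` with `γ` the
substitution of `rebracket`, one for each of the three loops. -/
theorem clamp_rebracket₁ (r : I) : clamp (2 * clamp (2 * rebracket r)) = clamp (2 * r) := by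
  have h := r.2.1
  have h' := r.2.2
  apply Subtype.ext
  simp only [coe_clamp, coe_rebracket]
  grind

theorem clamp_rebracket₂ (r : I) :
    clamp (2 * clamp (2 * rebracket r) - 1) = clamp (2 * clamp (2 * r - 1)) := by
  have h := r.2.1
  have h' := r.2.2
  apply Subtype.ext
  simp only [coe_clamp, coe_rebracket]
  grind

theorem clamp_rebracket₃ (r : I) :
    clamp (2 * rebracket r - 1) = clamp (2 * clamp (2 * r - 1) - 1) := by
  have h := r.2.1
  have h' := r.2.2
  apply Subtype.ext
  simp only [coe_clamp, coe_rebracket]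
  grind

/-- Running backwards through a loop. -/
def reverse : C0Hom X (Susp B) (Susp B) :=
  subst ⟨σ, continuous_symm⟩ (Or.inr symm_zero) (Or.inl symm_one)

/-- The contraction of a loop composed with its reverse. -/
def contraction : C0Hom X (Susp B) C(I, Susp B) :=
  -- At `s = 1` the parameter is `|1 - 2r|`, running from `1` down to `0` and back; at `s = 0` it is
  -- constantly `1`, where loops vanish. For every `s` the value at `r = 0` and `r = 1` is `1`, so
  -- each stage is a loop.
  substPath (clampHomotopy (fun p => 1 - (p.1 : ℝ) * (1 - |1 - 2 * (p.2 : ℝ)|)) (by fun_prop))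
    (fun s => Or.inr (by simp))
    (fun s => Or.inr (by
      rw [clampHomotopy_apply, clamp_of_one_le]
      norm_num))

theorem contraction_zero (F : Susp B) : contraction (X := X) F 0 = 0 := by
  ext r
  change F.1 (clamp _) = 0
  rw [clamp_of_one_le (by simp), F.2.2]

theorem contraction_one (F : Susp B) :
    contraction (X := X) F 1 = firstHalf (X := X) (reverse (X := X) F) + secondHalf (X := X) F := by
  ext r
  have h := r.2.1
  have h' := r.2.2
  change F.1 (clamp (1 - (1 : ℝ) * (1 - |1 - 2 * (r : ℝ)|))) =
    F.1 (σ (clamp (2 * r))) + F.1 (clamp (2 * r - 1))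
  rcases le_total (r : ℝ) (1 / 2) with h2 | h2
  · rw [clamp_of_nonpos (x := 2 * r - 1) (by linarith), F.2.1, add_zero]
    congr 1
    apply Subtype.ext
    simp only [coe_clamp, coe_symm_eq]
    grind
  · rw [clamp_of_one_le (x := 2 * r) (by linarith), symm_one, F.2.1, zero_add]
    congr 1
    apply Subtype.ext
    simp only [coe_clamp]
    grind

end substitution

end C0Hom

open C0Hom

/-! ### The group defined by loop composition -/

namespace HomotopyClasses

variable (X : Type u) [TopologicalSpace X] (A : Type v) (B : Type w) [NonUnitalCStarAlgebra A]
  [NonUnitalCStarAlgebra B] [C0Algebra X A] [C0Algebra X B]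

/-- The group structure on `⟦A, SB⟧_X` given by loop composition. -/
@[reducible]
def loopGroup : Group (HomotopyClasses X A (Susp B)) :=
  { mul := op firstHalf secondHalf (halves_orthogonal X B)
    one := mk 0
    inv := Quotient.map (push reverse) fun _ _ h => h.push reverse
    mul_assoc := op_assoc _ (subst_actsTrivially A rebracket rebracket_zero rebracket_one)
      (fun F => by ext r; exact congrArg F.1 (clamp_rebracket₁ r))
      (fun F => by ext r; exact congrArg F.1 (clamp_rebracket₂ r))
      (fun F => by ext r; exact congrArg F.1 (clamp_rebracket₃ r))
    one_mul := op_zero_left _ (secondHalf_actsTrivially A)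
    mul_one := op_zero_right _ (firstHalf_actsTrivially A)
    inv_mul_cancel := fun x => by
      induction x using ind with | _ ψ => ?_
      -- The second loop is `ψ` itself, written as a push-forward along the identity substitution.
      exact op_push_eq_zero (halves_orthogonal X B) (δ := reverse)
        (ε := subst (ContinuousMap.id I) (Or.inl rfl) (Or.inr rfl)) contraction contraction_zero
        contraction_one ψ }

end HomotopyClasses

theorem AsymptoticMorphism.isLoopComposition_orthSum {X : Type u} [TopologicalSpace X] {A : Type v}
    {B : Type w} [NonUnitalCStarAlgebra A] [NonUnitalCStarAlgebra B] [C0Algebra X A]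
    [C0Algebra X B] (ψ φ : AsymptoticMorphism X A (Susp B)) :
    IsLoopComposition ψ φ (orthSum firstHalf secondHalf (halves_orthogonal X B) ψ φ) := by
  intro t a s
  have h := s.2.1
  have h' := s.2.2
  change (ψ t a).1 (clamp (2 * s)) + (φ t a).1 (clamp (2 * s - 1)) = _
  split_ifs with hs
  · rw [clamp_of_nonpos (x := 2 * s - 1) (by linarith), (φ t a).2.1, add_zero, clamp_of_mem]
  · rw [clamp_of_one_le (x := 2 * s) (by linarith), (ψ t a).2.2, zero_add, clamp_of_mem]

/-! ### Conjugation by multipliers -/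

namespace Multiplier

section algebra

variable {D : Type*} [NonUnitalCStarAlgebra D]

/-- Testing on `b = (x - y)*` gives `(x - y)(x - y)* = 0`, and the C*-identity concludes. -/
theorem eq_of_mul_right {x y : D} (h : ∀ b, x * b = y * b) : x = y := by
  have h' := h (star (x - y))
  rwa [← sub_eq_zero, ← sub_mul, CStarRing.mul_star_self_eq_zero_iff, sub_eq_zero] at h'

theorem eq_of_mul_left {x y : D} (h : ∀ b, b * x = b * y) : x = y := by
  have h' := h (star (x - y))
  rwa [← sub_eq_zero, ← mul_sub, CStarRing.star_mul_self_eq_zero_iff, sub_eq_zero] at h'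

theorem fst_mul (m : 𝓜(ℂ, D)) (x y : D) : m.fst (x * y) = m.fst x * y :=
  eq_of_mul_left fun c => by rw [← m.central, ← mul_assoc, m.central, mul_assoc]

theorem snd_mul (m : 𝓜(ℂ, D)) (x y : D) : m.snd (x * y) = x * m.snd y :=
  eq_of_mul_right fun c => by rw [m.central, mul_assoc, ← m.central, mul_assoc]

/-- Identities for `m x n` can therefore be checked inside the associative algebra `M(D)`. -/
theorem coe_injective : Function.Injective (DoubleCentralizer.coe ℂ : D → 𝓜(ℂ, D)) :=
  fun _ _ h => eq_of_mul_right fun b => congrArg (fun m : 𝓜(ℂ, D) => m.fst b) h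

theorem coe_mul (x y : D) :
    DoubleCentralizer.coe ℂ (x * y) = DoubleCentralizer.coe ℂ x * DoubleCentralizer.coe ℂ y :=
  map_mul (DoubleCentralizer.coeHom (𝕜 := ℂ) (A := D)) x y

theorem coe_star (x : D) :
    DoubleCentralizer.coe ℂ (star x) = star (DoubleCentralizer.coe ℂ x) :=
  map_star (DoubleCentralizer.coeHom (𝕜 := ℂ) (A := D)) x

theorem coe_fst_apply (m : 𝓜(ℂ, D)) (x : D) :
    DoubleCentralizer.coe ℂ (m.fst x) = m * DoubleCentralizer.coe ℂ x := by
  apply DoubleCentralizer.ext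
  refine Prod.ext ?_ ?_
  · exact ContinuousLinearMap.ext fun y => (fst_mul m x y).symm
  · exact ContinuousLinearMap.ext fun y => (m.central y x).symm

theorem coe_snd_apply (m : 𝓜(ℂ, D)) (x : D) :
    DoubleCentralizer.coe ℂ (m.snd x) = DoubleCentralizer.coe ℂ x * m := by
  apply DoubleCentralizer.ext
  refine Prod.ext ?_ ?_
  · exact ContinuousLinearMap.ext fun y => m.central x y
  · exact ContinuousLinearMap.ext fun y => (snd_mul m y x).symm

/-- The map `x ↦ m x n`, for multipliers `m` and `n`. -/
def sandwich (m n : 𝓜(ℂ, D)) : D →L[ℂ] D := m.fst.comp n.snd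

theorem sandwich_apply (m n : 𝓜(ℂ, D)) (x : D) : sandwich m n x = m.fst (n.snd x) := rfl

theorem coe_sandwich (m n : 𝓜(ℂ, D)) (x : D) :
    DoubleCentralizer.coe ℂ (sandwich m n x) = m * DoubleCentralizer.coe ℂ x * n := by
  rw [sandwich_apply, coe_fst_apply, coe_snd_apply, mul_assoc]

theorem sandwich_sandwich (m n m' n' : 𝓜(ℂ, D)) (x : D) :
    sandwich m n (sandwich m' n' x) = sandwich (m * m') (n' * n) x :=
  coe_injective (by simp only [coe_sandwich, mul_assoc])

theorem sandwich_mul_sandwich (m n m' n' : 𝓜(ℂ, D)) (x y : D) :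
    sandwich m n x * sandwich m' n' y = sandwich m n' (x * (n * m').fst y) :=
  coe_injective (by simp only [coe_sandwich, coe_mul, coe_fst_apply, mul_assoc])

theorem star_sandwich (m n : 𝓜(ℂ, D)) (x : D) :
    star (sandwich m n x) = sandwich (star n) (star m) (star x) :=
  coe_injective (by simp only [coe_sandwich, coe_star, star_mul, mul_assoc])

theorem sandwich_one (x : D) : sandwich (1 : 𝓜(ℂ, D)) 1 x = x := rfl

theorem sandwich_zero_left (n : 𝓜(ℂ, D)) (x : D) : sandwich 0 n x = 0 := rfl

theorem sandwich_zero_right (m : 𝓜(ℂ, D)) (x : D) : sandwich m 0 x = 0 := map_zero m.fst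

theorem sandwich_add_left (m m' n : 𝓜(ℂ, D)) (x : D) :
    sandwich (m + m') n x = sandwich m n x + sandwich m' n x := rfl

theorem sandwich_add_right (m n n' : 𝓜(ℂ, D)) (x : D) :
    sandwich m (n + n') x = sandwich m n x + sandwich m n' x := map_add m.fst _ _

/-- Only an inequality is possible in general, since the unit of `M(D)` has norm `0` when `D = 0`.
-/
theorem norm_le_one {m : 𝓜(ℂ, D)} (hm : star m * m = 1) : ‖m‖ ≤ 1 := by
  have h1 : ‖m‖ * ‖m‖ = ‖(1 : 𝓜(ℂ, D))‖ := by rw [← CStarRing.norm_star_mul_self, hm]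
  have h2 : ‖(1 : 𝓜(ℂ, D))‖ ≤ 1 := by
    rw [← DoubleCentralizer.norm_fst]
    exact ContinuousLinearMap.opNorm_le_bound _ zero_le_one fun x => by
      rw [one_mul]; exact le_refl ‖x‖
  nlinarith [norm_nonneg m]

theorem norm_fst_apply_le (m : 𝓜(ℂ, D)) (x : D) : ‖m.fst x‖ ≤ ‖m‖ * ‖x‖ := by
  rw [← DoubleCentralizer.norm_fst]
  exact m.fst.le_opNorm x

theorem norm_snd_apply_le (m : 𝓜(ℂ, D)) (x : D) : ‖m.snd x‖ ≤ ‖m‖ * ‖x‖ := by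
  rw [← DoubleCentralizer.norm_snd]
  exact m.snd.le_opNorm x

theorem norm_sandwich_le (m n : 𝓜(ℂ, D)) (x : D) : ‖sandwich m n x‖ ≤ ‖m‖ * (‖n‖ * ‖x‖) :=
  (norm_fst_apply_le m _).trans (by gcongr; exact norm_snd_apply_le n x)

/-- Strict convergence of bounded nets of multipliers implies convergence of conjugations. -/
theorem tendsto_sandwich {T : Type*} {l : Filter T} {m : T → 𝓜(ℂ, D)} {m₀ : 𝓜(ℂ, D)} {C : ℝ}
    (hC : ∀ t, ‖m t‖ ≤ C) (h : ∀ x, Tendsto (fun t => (m t).fst x) l (𝓝 (m₀.fst x))) (x : D) :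
    Tendsto (fun t => sandwich (m t) (star (m t)) x) l (𝓝 (sandwich m₀ (star m₀) x)) := by
  -- Since `x m* = (m x*)*`, convergence of left multiplication already gives convergence of right
  -- multiplication by the adjoints.
  have h1 : Tendsto (fun t => (star (m t)).snd x) l (𝓝 ((star m₀).snd x)) := by
    simp only [DoubleCentralizer.star_snd]
    exact (h (star x)).star
  -- Here boundedness enters: `m_t (x m_t* - x m₀*)` tends to `0`, leaving only `m_t (x m₀*)`.
  have h2 : Tendsto (fun t => (m t).fst ((star (m t)).snd x - (star m₀).snd x)) l (𝓝 0) := by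
    have h3 := (tendsto_iff_norm_sub_tendsto_zero.1 h1).const_mul C
    rw [mul_zero] at h3
    refine squeeze_zero_norm (fun t => (norm_fst_apply_le _ _).trans ?_) h3
    gcongr
    exact hC t
  have h4 := h2.add (h ((star m₀).snd x))
  rw [zero_add] at h4
  refine h4.congr fun t => ?_
  rw [map_sub, sub_add_cancel, sandwich_apply]

end algebra

/-! ### Conjugation by isometries and rotations between them -/

section adjoint

variable {X : Type u} [TopologicalSpace X] {D : Type*} [NonUnitalCStarAlgebra D] [C0Algebra X D]

theorem fst_act (m : 𝓜(ℂ, D)) (f : C₀(X, ℂ)) (x : D) : m.fst (act f x) = act f (m.fst x) :=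
  (congrArg (fun n : 𝓜(ℂ, D) => n.fst x) (central f m).eq).symm

theorem snd_act (m : 𝓜(ℂ, D)) (f : C₀(X, ℂ)) (x : D) : m.snd (act f x) = act f (m.snd x) := by
  refine eq_of_mul_right fun b => ?_
  rw [m.central, ← act_mul, ← act_mul, m.central]

theorem sandwich_act (m n : 𝓜(ℂ, D)) (f : C₀(X, ℂ)) (x : D) :
    sandwich m n (act f x) = act f (sandwich m n x) := by
  rw [sandwich_apply, snd_act, fst_act, sandwich_apply]

/-- Conjugation `x ↦ m x m*` by an isometry `m` in the multiplier algebra. -/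
def conj (m : 𝓜(ℂ, D)) (hm : star m * m = 1) : C0Hom X D D where
  toHom :=
    { toFun := sandwich m (star m)
      map_smul' := fun c x => map_smul _ c x
      map_zero' := map_zero _
      map_add' := map_add _
      map_mul' := fun x y => by rw [sandwich_mul_sandwich, hm]; rfl
      map_star' := fun x => by rw [star_sandwich, star_star] }
  map_act' := sandwich_act m (star m)

@[simp] theorem conj_apply (m : 𝓜(ℂ, D)) (hm : star m * m = 1) (x : D) :
    conj (X := X) m hm x = sandwich m (star m) x := rfl

theorem conj_orthogonal {m n : 𝓜(ℂ, D)} (hm : star m * m = 1) (hn : star n * n = 1)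
    (h : star m * n = 0) : (conj (X := X) m hm).Orthogonal (conj n hn) := fun x y => by
  change sandwich _ _ x * sandwich _ _ y = 0
  rw [sandwich_mul_sandwich, h]
  change sandwich m (star n) (x * 0) = 0
  rw [mul_zero, map_zero]

theorem mul_isometry {m n : 𝓜(ℂ, D)} (hm : star m * m = 1) (hn : star n * n = 1) :
    star (m * n) * (m * n) = 1 := by
  rw [star_mul, mul_assoc, ← mul_assoc (star m), hm, one_mul, hn]

/-- A strictly continuous path of isometries gives a homotopy of conjugations. -/
theorem homotopic_conj {A : Type v} [NonUnitalCStarAlgebra A] [C0Algebra X A] (m : I → 𝓜(ℂ, D))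
    (hm : ∀ s, star (m s) * m s = 1) (hc : ∀ x, Continuous fun s => (m s).fst x)
    (ψ : AsymptoticMorphism X A D) :
    Homotopic (ψ.push (conj (m 0) (hm 0))) (ψ.push (conj (m 1) (hm 1))) :=
  Homotopic.of_path (ofFamily (fun s => conj (m s) (hm s)) fun x =>
    continuous_iff_continuousAt.2 fun s =>
      tendsto_sandwich (fun t => norm_le_one (hm t)) (fun y => (hc y).tendsto s) x)
    (fun _ => rfl) (fun _ => rfl) ψ

/-- The rotation from an isometry `p` to an isometry `q` with orthogonal range. -/
def rotation (p q : 𝓜(ℂ, D)) (s : I) : 𝓜(ℂ, D) :=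
  ((√(1 - s) : ℝ) : ℂ) • p + ((√(s : ℝ) : ℝ) : ℂ) • q

/-- The cross terms vanish because `p*q = 0`, and the squares of the coefficients add up to `(1 - s)
+ s = 1`. -/
theorem star_rotation_mul {p q : 𝓜(ℂ, D)} (hp : star p * p = 1) (hq : star q * q = 1)
    (h : star p * q = 0) (s : I) : star (rotation p q s) * rotation p q s = 1 := by
  have h' : star q * p = 0 := by
    have := congrArg star h
    rwa [star_mul, star_star, star_zero] at this
  have h1 : ((√(1 - s) : ℝ) : ℂ) * ((√(1 - s) : ℝ) : ℂ) = ((1 - s : ℝ) : ℂ) := by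
    rw [← Complex.ofReal_mul, Real.mul_self_sqrt (sub_nonneg.2 s.2.2)]
  have h2 : ((√(s : ℝ) : ℝ) : ℂ) * ((√(s : ℝ) : ℝ) : ℂ) = ((s : ℝ) : ℂ) := by
    rw [← Complex.ofReal_mul, Real.mul_self_sqrt s.2.1]
  simp only [rotation, star_add, star_smul, add_mul, mul_add, smul_mul_smul_comm, hp, hq, h, h',
    smul_zero, add_zero, zero_add, Complex.star_def, Complex.conj_ofReal, h1, h2]
  rw [← add_smul, ← Complex.ofReal_add, sub_add_cancel, Complex.ofReal_one, one_smul]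

theorem continuous_rotation (p q : 𝓜(ℂ, D)) (x : D) :
    Continuous fun s => (rotation p q s).fst x := by
  change Continuous fun s : I => ((√(1 - s) : ℝ) : ℂ) • p.fst x + ((√(s : ℝ) : ℝ) : ℂ) • q.fst x
  fun_prop

theorem homotopic_conj_of_orthogonal {A : Type v} [NonUnitalCStarAlgebra A] [C0Algebra X A]
    {p q : 𝓜(ℂ, D)} (hp : star p * p = 1) (hq : star q * q = 1) (h : star p * q = 0)
    (ψ : AsymptoticMorphism X A D) : Homotopic (ψ.push (conj p hp)) (ψ.push (conj q hq)) := by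
  have key := homotopic_conj (rotation p q) (star_rotation_mul hp hq h) (continuous_rotation p q) ψ
  have h0 : rotation p q 0 = p := by simp [rotation]
  have h1 : rotation p q 1 = q := by simp [rotation]
  simpa only [h0, h1] using key

end adjoint

/-! ### Pairs of isometries with complementary ranges -/

/-- A pair of isometries in a unital `*`-ring whose ranges are complementary. -/
structure IsometryPair (R : Type*) [Ring R] [StarRing R] where
  v : Fin 2 → R
  star_v_mul : ∀ i j, star (v i) * v j = if i = j then 1 else 0
  sum_mul_star : v 0 * star (v 0) + v 1 * star (v 1) = 1

namespace IsometryPair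

/-- The image of a pair of isometries under a homomorphism. -/
def map {R S : Type*} [Ring R] [StarRing R] [Algebra ℂ R] [Ring S] [StarRing S] [Algebra ℂ S]
    (τ : R →⋆ₐ[ℂ] S) (P : IsometryPair R) : IsometryPair S where
  v i := τ (P.v i)
  star_v_mul i j := by
    rw [← map_star, ← map_mul, P.star_v_mul]
    split_ifs <;> simp
  sum_mul_star := by
    rw [← map_star, ← map_star, ← map_mul, ← map_mul, ← map_add, P.sum_mul_star, map_one]

section equiv

variable {D : Type*} [NonUnitalCStarAlgebra D] (P : IsometryPair 𝓜(ℂ, D))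

theorem isometry (i : Fin 2) : star (P.v i) * P.v i = 1 := by simp [P.star_v_mul]

theorem sandwich_mul (i j k l : Fin 2) (x y : D) :
    sandwich (P.v i) (star (P.v j)) x * sandwich (P.v k) (star (P.v l)) y =
      if j = k then sandwich (P.v i) (star (P.v l)) (x * y) else 0 := by
  rw [sandwich_mul_sandwich, P.star_v_mul]
  split_ifs
  · rfl
  · change sandwich _ _ (x * 0) = 0
    rw [mul_zero, map_zero]

/-- The isomorphism `M₂(D) ≅ D`, `M ↦ ∑ v_i M_{ij} v_j*`. -/
def matrixHom : CStarMatrix (Fin 2) (Fin 2) D →⋆ₙₐ[ℂ] D where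
  toFun M := ∑ i, ∑ j, sandwich (P.v i) (star (P.v j)) (M i j)
  map_smul' c M := by
    simp only [Fin.sum_univ_two, CStarMatrix.smul_apply, map_smul, smul_add, MonoidHom.id_apply]
  map_zero' := by simp
  map_add' M N := by
    simp only [Fin.sum_univ_two, CStarMatrix.add_apply, map_add]
    abel
  map_mul' M N := by
    simp only [Fin.sum_univ_two, CStarMatrix.mul_apply, map_add, add_mul, mul_add, P.sandwich_mul]
    simp only [Fin.isValue, if_true, zero_ne_one, one_ne_zero, if_false, add_zero, zero_add]
    abel
  map_star' M := by
    simp only [Fin.sum_univ_two, CStarMatrix.star_apply, star_add, star_sandwich, star_star]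
    abel

theorem matrixHom_apply (M : CStarMatrix (Fin 2) (Fin 2) D) :
    P.matrixHom M = ∑ i, ∑ j, sandwich (P.v i) (star (P.v j)) (M i j) := rfl

/-- The relations `v_k* v_i = δ_{ki}` let the compression `v_k* · v_l` pick out one matrix entry,
which gives the inverse of `matrixHom`. -/
theorem sandwich_matrixHom (k l : Fin 2) (M : CStarMatrix (Fin 2) (Fin 2) D) :
    sandwich (star (P.v k)) (P.v l) (P.matrixHom M) = M k l := by
  simp only [matrixHom_apply, map_sum, sandwich_sandwich, P.star_v_mul]
  rw [Finset.sum_eq_single k, Finset.sum_eq_single l]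
  · simp only [if_true]
    rfl
  · intro j _ hj
    rw [if_pos rfl, if_neg hj, sandwich_zero_right]
  · simp
  · intro i _ hi
    refine Finset.sum_eq_zero fun j _ => ?_
    rw [if_neg hi.symm, sandwich_zero_left]
  · simp

/-- Entries recover the matrix, which is injectivity. Surjectivity is `x = ∑ v_i (v_i* x v_j) v_j*`,
a consequence of `∑ v_i v_i* = 1`. -/
theorem matrixHom_bijective : Function.Bijective P.matrixHom := by
  refine ⟨fun M N h => CStarMatrix.ext fun i j => ?_, fun x => ?_⟩
  · exact (P.sandwich_matrixHom i j M).symm.trans (h ▸ P.sandwich_matrixHom i j N)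
  · refine ⟨CStarMatrix.ofMatrix fun i j => sandwich (star (P.v i)) (P.v j) x, ?_⟩
    have h : ∀ i j, sandwich (P.v i) (star (P.v j))
        (CStarMatrix.ofMatrix (fun i j => sandwich (star (P.v i)) (P.v j) x) i j) =
        sandwich (P.v i * star (P.v i)) (P.v j * star (P.v j)) x := fun i j => by
      rw [← sandwich_sandwich]
      rfl
    simp only [matrixHom_apply, h, Fin.sum_univ_two, ← sandwich_add_left, ← sandwich_add_right,
      P.sum_mul_star, sandwich_one]

/-- The isomorphism `M₂(D) ≅ D`, `M ↦ ∑ v_i M_{ij} v_j*`. -/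
def matrixEquiv : CStarMatrix (Fin 2) (Fin 2) D ≃⋆ₐ[ℂ] D :=
  StarAlgEquiv.ofBijective P.matrixHom P.matrixHom_bijective

theorem matrixEquiv_apply (M : CStarMatrix (Fin 2) (Fin 2) D) :
    P.matrixEquiv M = ∑ i, ∑ j, sandwich (P.v i) (star (P.v j)) (M i j) := rfl

theorem matrixEquiv_single (i j : Fin 2) (x : D) :
    P.matrixEquiv (matrixSingle i j x) = sandwich (P.v i) (star (P.v j)) x := by
  rw [matrixEquiv_apply, Finset.sum_eq_single i, Finset.sum_eq_single j]
  · congr 1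
    exact Matrix.single_apply_same i j x
  · intro l _ hl
    have : matrixSingle i j x i l = 0 := Matrix.single_apply_of_ne _ _ _ _ _ (by simp [hl.symm])
    rw [this, map_zero]
  · simp
  · intro k _ hk
    refine Finset.sum_eq_zero fun l _ => ?_
    have : matrixSingle i j x k l = 0 := Matrix.single_apply_of_ne _ _ _ _ _ (by simp [hk.symm])
    rw [this, map_zero]
  · simp

end equiv

variable {X : Type u} [TopologicalSpace X] {D : Type*} [NonUnitalCStarAlgebra D] [C0Algebra X D]
  (P Q : IsometryPair 𝓜(ℂ, D))

/-- Conjugation by the isometries of the pair. -/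
def hom (i : Fin 2) : C0Hom X D D := conj (P.v i) (P.isometry i)

@[simp] theorem hom_apply (i : Fin 2) (x : D) :
    P.hom (X := X) i x = sandwich (P.v i) (star (P.v i)) x := rfl

variable (X) in
theorem hom_orthogonal : (P.hom (X := X) 0).Orthogonal (P.hom 1) :=
  conj_orthogonal _ _ (by simp [P.star_v_mul])

/-- The unitary with `u v_i = w_i` for two pairs of isometries. -/
def transition : 𝓜(ℂ, D) := Q.v 0 * star (P.v 0) + Q.v 1 * star (P.v 1)

theorem star_v_mul_apply (i j : Fin 2) (m : 𝓜(ℂ, D)) :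
    star (P.v i) * (P.v j * m) = if i = j then m else 0 := by
  rw [← mul_assoc, P.star_v_mul]
  split_ifs <;> simp

/-- Orthogonality of the ranges of the `w_i` reduces `u*u` to `∑ v_i v_i* = 1`. -/
theorem transition_isometry : star (transition P Q) * transition P Q = 1 := by
  simp only [transition, star_add, star_mul, star_star, add_mul, mul_add, mul_assoc,
    Q.star_v_mul_apply]
  simpa using P.sum_mul_star

theorem transition_mul (i : Fin 2) : transition P Q * P.v i = Q.v i := by
  fin_cases i <;> simp [transition, add_mul, mul_assoc, P.star_v_mul]

theorem conj_transition (i : Fin 2) (x : D) :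
    conj (X := X) _ (transition_isometry P Q) (P.hom (X := X) i x) = Q.hom (X := X) i x := by
  rw [conj_apply, hom_apply, hom_apply, sandwich_sandwich, ← star_mul, transition_mul]

/-- The flip of a pair. -/
def flip : IsometryPair 𝓜(ℂ, D) where
  v i := P.v (i + 1)
  star_v_mul i j := by simp [P.star_v_mul]
  sum_mul_star := by
    rw [add_comm]
    exact P.sum_mul_star

/-- The unitary relating the two bracketings of a threefold direct sum. -/
def associator : 𝓜(ℂ, D) :=
  -- One summand for each slot: `v₀v₀ ↦ v₀`, `v₀v₁ ↦ v₁v₀`, `v₁ ↦ v₁v₁`.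
  P.v 0 * (star (P.v 0) * star (P.v 0)) + P.v 1 * (P.v 0 * (star (P.v 1) * star (P.v 0))) +
    P.v 1 * (P.v 1 * star (P.v 1))

/-- The target isometries `v₀, v₁v₀, v₁v₁` have orthogonal ranges, so only the projections of the
source slots `v₀v₀, v₀v₁, v₁` remain; these sum to `1` by two uses of `∑ v_i v_i* = 1`. -/
theorem associator_isometry : star P.associator * P.associator = 1 := by
  have h : P.v 0 * (P.v 0 * (star (P.v 0) * star (P.v 0))) +
      P.v 0 * (P.v 1 * (star (P.v 1) * star (P.v 0))) = P.v 0 * star (P.v 0) := by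
    rw [← mul_add, ← mul_assoc, ← mul_assoc (P.v 1), ← add_mul, P.sum_mul_star, one_mul]
  have h' : star P.associator * P.associator =
      P.v 0 * (P.v 0 * (star (P.v 0) * star (P.v 0))) +
        P.v 0 * (P.v 1 * (star (P.v 1) * star (P.v 0))) + P.v 1 * star (P.v 1) := by
    simp [associator, add_mul, mul_add, mul_assoc, P.star_v_mul_apply]
  rw [h', h, P.sum_mul_star]

theorem associator_mul₁ : P.associator * (P.v 0 * P.v 0) = P.v 0 := by
  simp [associator, add_mul, mul_assoc, P.star_v_mul_apply, P.star_v_mul]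

theorem associator_mul₂ : P.associator * (P.v 0 * P.v 1) = P.v 1 * P.v 0 := by
  simp [associator, add_mul, mul_assoc, P.star_v_mul_apply, P.star_v_mul]

theorem associator_mul₃ : P.associator * P.v 1 = P.v 1 * P.v 1 := by
  simp [associator, add_mul, mul_assoc, P.star_v_mul]

/-- If the first isometry of the pair is strictly connected to the identity, conjugation by any
isometry is trivial up to homotopy. -/
theorem conj_actsTrivially {A : Type v} [NonUnitalCStarAlgebra A] [C0Algebra X A] (w : I → 𝓜(ℂ, D))
    (hw : ∀ s, star (w s) * w s = 1) (hc : ∀ x, Continuous fun s => (w s).fst x) (hw0 : w 0 = 1)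
    (hw1 : w 1 = P.v 0) (m : 𝓜(ℂ, D)) (hm : star m * m = 1) :
    (conj (X := X) m hm).ActsTrivially A := fun ψ => by
  -- The path `w` from `1` to `v₀` makes conjugation by `v₀` trivial.
  have h1 : ∀ φ : AsymptoticMorphism X A D, Homotopic φ (φ.push (P.hom 0)) := fun φ => by
    have h := homotopic_conj w hw hc φ
    convert h using 1
    · refine ext_apply fun t a => ?_
      simp only [push_apply, conj_apply, hw0, star_one, sandwich_one]
    · refine ext_apply fun t a => ?_
      simp only [push_apply, conj_apply, hom_apply, hw1]
  have h2 : Homotopic (ψ.push (conj (P.v 0 * m) (mul_isometry (P.isometry 0) hm)))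
      (ψ.push (P.hom 1)) :=
    homotopic_conj_of_orthogonal _ _ (by simp [mul_assoc, P.star_v_mul]) ψ
  have h3 : Homotopic (ψ.push (P.hom 0)) (ψ.push (P.hom 1)) :=
    homotopic_conj_of_orthogonal _ _ (by simp [P.star_v_mul]) ψ
  -- The chain is `m ~ v₀m ~ v₁ ~ v₀ ~ 1`. Passing to `v₀m` is the point: unlike `m`, its range is
  -- orthogonal to that of `v₁`, so a rotation exists.
  refine (h1 _).trans (Homotopic.trans ?_ (h2.trans (h3.symm.trans (h1 ψ).symm)))
  convert Homotopic.refl _ using 1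
  refine ext_apply fun t a => ?_
  simp only [push_apply, conj_apply, hom_apply, sandwich_sandwich, star_mul]

end IsometryPair

end Multiplier

open InnerProductSpace (rankOne)

/-! ### Compact operators on `ℓ²(ℕ)` -/

/-- The uniform bound `C` allows an arbitrary vector to be replaced by a nearby vector of the dense
set. -/
theorem tendsto_apply_of_dense {T E F : Type*} [NormedAddCommGroup E] [NormedSpace ℂ E]
    [NormedAddCommGroup F] [NormedSpace ℂ F] {l : Filter T} {S : T → E →L[ℂ] F} {S₀ : E →L[ℂ] F}
    {C : ℝ} (hC : ∀ t x, ‖S t x‖ ≤ C * ‖x‖) {s : Set E} (hs : Dense s)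
    (h : ∀ x ∈ s, Tendsto (fun t => S t x) l (𝓝 (S₀ x))) (x : E) :
    Tendsto (fun t => S t x) l (𝓝 (S₀ x)) := by
  rw [Metric.tendsto_nhds]
  intro ε hε
  -- `M` bounds `S t - S₀` for all `t`; the summand `1` makes it positive, so that it can be divided
  -- by.
  set M := |C| + ‖S₀‖ + 1 with hM
  have hM0 : 0 < M := by positivity
  obtain ⟨y, hy, hxy⟩ := Metric.dense_iff.1 hs x (ε / 2 / M) (by positivity)
  filter_upwards [Metric.tendsto_nhds.1 (h y hxy) (ε / 2) (by positivity)] with t ht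
  rw [Metric.mem_ball, dist_comm, dist_eq_norm] at hy
  rw [dist_eq_norm] at ht ⊢
  have h1 : S t x - S₀ x = (S t (x - y) - S₀ (x - y)) + (S t y - S₀ y) := by
    simp only [map_sub]; abel
  have h2 : ‖S t (x - y) - S₀ (x - y)‖ ≤ M * ‖x - y‖ := by
    refine (norm_sub_le _ _).trans ?_
    have h3 := hC t (x - y)
    have h4 := S₀.le_opNorm (x - y)
    have h5 : C * ‖x - y‖ ≤ |C| * ‖x - y‖ := by gcongr; exact le_abs_self C
    nlinarith [norm_nonneg (x - y)]
  have h3 : M * ‖x - y‖ < ε / 2 := by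
    rwa [lt_div_iff₀ hM0, mul_comm] at hy
  rw [h1]
  linarith [norm_add_le (S t (x - y) - S₀ (x - y)) (S t y - S₀ y)]

namespace Compacts

theorem isCompactOperator_rankOne (x y : HilbertSeq) : IsCompactOperator (rankOne ℂ x y) := by
  rw [InnerProductSpace.rankOne_def']
  have h : IsCompactOperator (ContinuousLinearMap.toSpanSingleton ℂ x : ℂ →L[ℂ] HilbertSeq) :=
    isCompactOperator_of_locallyCompactSpace_rng
      (ContinuousLinearMap.toSpanSingleton ℂ x : ℂ →L[ℂ] HilbertSeq)
  exact h.comp_clm (innerSL ℂ y)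

/-- The rank one operator `|x⟩⟨y|`. -/
def rk (x y : HilbertSeq) : Compacts := ⟨rankOne ℂ x y, isCompactOperator_rankOne x y⟩

theorem coe_rk_apply (x y z : HilbertSeq) : (rk x y).1 z = inner ℂ y z • x := rfl

theorem rk_add (x x' y : HilbertSeq) : rk (x + x') y = rk x y + rk x' y :=
  Subtype.ext (by simp [rk])

theorem rk_smul (c : ℂ) (x y : HilbertSeq) : rk (c • x) y = c • rk x y :=
  Subtype.ext (by simp [rk])

theorem mul_rk (k : Compacts) (x y : HilbertSeq) : k * rk x y = rk (k.1 x) y :=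
  Subtype.ext (InnerProductSpace.comp_rankOne x y k.1)

theorem star_rk (x y : HilbertSeq) : star (rk x y) = rk y x :=
  Subtype.ext (InnerProductSpace.adjoint_rankOne x y)

theorem rk_mul_rk (x y z t : HilbertSeq) : rk x y * rk z t = inner ℂ y z • rk x t := by
  rw [mul_rk, coe_rk_apply, rk_smul]

theorem ext_apply {k l : Compacts} (h : ∀ x, k.1 x = l.1 x) : k = l :=
  Subtype.ext (ContinuousLinearMap.ext h)

/-- Left multiplication of compact operators by a bounded operator. -/
def leftMul (T : HilbertSeq →L[ℂ] HilbertSeq) : Compacts →L[ℂ] Compacts :=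
  LinearMap.mkContinuous
    { toFun := fun k => ⟨T * k.1, k.2.clm_comp T⟩
      map_add' := fun k l => Subtype.ext (mul_add T k.1 l.1)
      map_smul' := fun c k => Subtype.ext (mul_smul_comm c T k.1) } ‖T‖
    fun k => norm_mul_le T k.1

/-- Right multiplication of compact operators by a bounded operator. -/
def rightMul (T : HilbertSeq →L[ℂ] HilbertSeq) : Compacts →L[ℂ] Compacts :=
  LinearMap.mkContinuous
    { toFun := fun k => ⟨k.1 * T, IsCompactOperator.comp_clm k.2 T⟩
      map_add' := fun k l => Subtype.ext (add_mul k.1 l.1 T)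
      map_smul' := fun c k => Subtype.ext (smul_mul_assoc c k.1 T) } ‖T‖
    fun k => (norm_mul_le k.1 T).trans (mul_comm _ _).le

/-- Bounded operators as multipliers of the compact operators. -/
def multiplier : (HilbertSeq →L[ℂ] HilbertSeq) →⋆ₐ[ℂ] 𝓜(ℂ, Compacts) where
  toFun T := ⟨(leftMul T, rightMul T), fun k l => Subtype.ext (mul_assoc k.1 T l.1)⟩
  map_one' := by
    apply DoubleCentralizer.ext
    refine Prod.ext ?_ ?_ <;> refine ContinuousLinearMap.ext fun k => Subtype.ext ?_
    exacts [one_mul k.1, mul_one k.1]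
  map_mul' S T := by
    apply DoubleCentralizer.ext
    refine Prod.ext ?_ ?_ <;> refine ContinuousLinearMap.ext fun k => Subtype.ext ?_
    exacts [mul_assoc S T k.1, (mul_assoc k.1 S T).symm]
  map_zero' := by
    apply DoubleCentralizer.ext
    refine Prod.ext ?_ ?_ <;> refine ContinuousLinearMap.ext fun k => Subtype.ext ?_
    exacts [zero_mul k.1, mul_zero k.1]
  map_add' S T := by
    apply DoubleCentralizer.ext
    refine Prod.ext ?_ ?_ <;> refine ContinuousLinearMap.ext fun k => Subtype.ext ?_
    exacts [add_mul S T k.1, mul_add k.1 S T]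
  commutes' c := by
    apply DoubleCentralizer.ext
    refine Prod.ext ?_ ?_ <;> refine ContinuousLinearMap.ext fun k => Subtype.ext ?_
    exacts [Algebra.algebraMap_eq_smul_one (A := HilbertSeq →L[ℂ] HilbertSeq) c ▸
        (smul_one_mul c k.1),
      Algebra.algebraMap_eq_smul_one (A := HilbertSeq →L[ℂ] HilbertSeq) c ▸ (mul_smul_one c k.1)]
  map_star' T := by
    apply DoubleCentralizer.ext
    refine Prod.ext ?_ ?_ <;> refine ContinuousLinearMap.ext fun k => Subtype.ext ?_
    · change star T * k.1 = star (star k.1 * T)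
      rw [star_mul, star_star]
    · change k.1 * star T = star (T * star k.1)
      rw [star_mul, star_star]

theorem coe_sandwich_multiplier (S T : HilbertSeq →L[ℂ] HilbertSeq) (k : Compacts) :
    (Multiplier.sandwich (multiplier S) (multiplier T) k).1 = S * (k.1 * T) := rfl

/-- Bounded strongly convergent nets of operators converge in norm after multiplication by a compact
operator. -/
theorem tendsto_leftMul {T : Type*} {l : Filter T} {S : T → HilbertSeq →L[ℂ] HilbertSeq}
    {S₀ : HilbertSeq →L[ℂ] HilbertSeq} {C : ℝ} (hC : ∀ t, ‖S t‖ ≤ C)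
    (h : ∀ x, Tendsto (fun t => S t x) l (𝓝 (S₀ x))) (k : Compacts) :
    Tendsto (fun t => leftMul (S t) k) l (𝓝 (leftMul S₀ k)) := by
  rw [Metric.tendsto_nhds]
  intro ε hε
  set M := |C| + ‖S₀‖ + 1 with hM
  have hM0 : 0 < M := by positivity
  -- A bounded, strongly convergent net converges uniformly on compact sets, here on a compact set
  -- containing the image of the unit ball under `k`. Finitely many test vectors suffice.
  obtain ⟨L, hL, hsub⟩ := IsCompactOperator.image_closedBall_subset_compact
    (f := (k.1 : HilbertSeq →ₗ[ℂ] HilbertSeq)) k.2 1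
  obtain ⟨t, -, htf, htc⟩ := hL.finite_cover_balls (e := ε / 3 / M) (by positivity)
  have h1 : ∀ᶠ i in l, ∀ y ∈ t, ‖S i y - S₀ y‖ < ε / 3 := by
    rw [htf.eventually_all]
    intro y _
    simpa only [dist_eq_norm] using Metric.tendsto_nhds.1 (h y) _ (by positivity)
  filter_upwards [h1] with i hi
  have h2 : ‖(S i - S₀) * k.1‖ ≤ 2 * (ε / 3) := by
    refine ContinuousLinearMap.opNorm_le_of_unit_norm (by positivity) fun x hx => ?_
    obtain ⟨y, hy, hxy⟩ := Set.mem_iUnion₂.1 (htc (hsub (Set.mem_image_of_mem _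
      (by rw [Metric.mem_closedBall, dist_zero_right, hx] : x ∈ Metric.closedBall _ _))))
    rw [Metric.mem_ball, dist_eq_norm] at hxy
    change ‖k.1 x - y‖ < _ at hxy
    have h3 : ((S i - S₀) * k.1) x = (S i (k.1 x - y) - S₀ (k.1 x - y)) + (S i y - S₀ y) := by
      change S i (k.1 x) - S₀ (k.1 x) = _
      simp only [map_sub]; abel
    have h4 : ‖S i (k.1 x - y) - S₀ (k.1 x - y)‖ ≤ M * ‖k.1 x - y‖ := by
      refine (norm_sub_le _ _).trans ?_
      have h5 := (S i).le_of_opNorm_le ((hC i).trans (le_abs_self C)) (k.1 x - y)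
      have h6 := S₀.le_opNorm (k.1 x - y)
      nlinarith [norm_nonneg (k.1 x - y)]
    have h5 : M * ‖k.1 x - y‖ < ε / 3 := by rwa [lt_div_iff₀ hM0, mul_comm] at hxy
    rw [h3]
    linarith [norm_add_le (S i (k.1 x - y) - S₀ (k.1 x - y)) (S i y - S₀ y), hi y hy]
  have h3 : dist (leftMul (S i) k) (leftMul S₀ k) = ‖(S i - S₀) * k.1‖ := by
    rw [dist_eq_norm, sub_mul]
    rfl
  rw [h3]
  linarith

/-! ### The standard basis and a strongly continuous path of isometries -/

/-- The standard Hilbert basis of `ℓ²(ℕ)`. -/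
def basis : HilbertBasis ℕ ℂ HilbertSeq := default

theorem basis_eq (n : ℕ) : basis n = lp.single 2 n 1 := basis.repr_self n

theorem inner_basis (i j : ℕ) : inner ℂ (basis i) (basis j) = if i = j then 1 else 0 :=
  orthonormal_iff_ite.1 basis.orthonormal i j

theorem norm_basis (i : ℕ) : ‖basis i‖ = 1 := basis.orthonormal.1 i

theorem dense_span_basis : Dense (Submodule.span ℂ (Set.range basis) : Set HilbertSeq) := by
  rw [dense_iff_closure_eq, ← Submodule.topologicalClosure_coe, basis.dense_span,
    Submodule.top_coe]

theorem op_ext {S T : HilbertSeq →L[ℂ] HilbertSeq} (h : ∀ n, S (basis n) = T (basis n)) : S = T :=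
  ContinuousLinearMap.ext_on dense_span_basis (by rintro _ ⟨n, rfl⟩; exact h n)

theorem tendsto_op_apply {T : Type*} {l : Filter T} {S : T → HilbertSeq →L[ℂ] HilbertSeq}
    {S₀ : HilbertSeq →L[ℂ] HilbertSeq} {C : ℝ} (hC : ∀ t, ‖S t‖ ≤ C)
    (h : ∀ n, Tendsto (fun t => S t (basis n)) l (𝓝 (S₀ (basis n)))) (x : HilbertSeq) :
    Tendsto (fun t => S t x) l (𝓝 (S₀ x)) := by
  refine tendsto_apply_of_dense (fun t x => (S t).le_of_opNorm_le (hC t) x) dense_span_basis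
    (fun y hy => ?_) x
  induction hy using Submodule.span_induction with
  | mem y hy => obtain ⟨n, rfl⟩ := hy; exact h n
  | zero => simpa using tendsto_const_nhds
  | add y z _ _ hy hz => simpa using hy.add hz
  | smul c y _ hy => simpa using hy.const_smul c

/-- The isometry of `ℓ²(ℕ)` determined by an orthonormal sequence. -/
def isometryOf {e : ℕ → HilbertSeq} (he : Orthonormal ℂ e) : HilbertSeq →L[ℂ] HilbertSeq :=
  he.orthogonalFamily.linearIsometry.toContinuousLinearMap

theorem isometryOf_basis {e : ℕ → HilbertSeq} (he : Orthonormal ℂ e) (n : ℕ) :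
    isometryOf he (basis n) = e n := by
  rw [basis_eq]
  refine (he.orthogonalFamily.linearIsometry_apply_single (1 : ℂ)).trans ?_
  simp

theorem star_mul_of_isometry (V : HilbertSeq →ₗᵢ[ℂ] HilbertSeq) :
    star V.toContinuousLinearMap * V.toContinuousLinearMap = 1 :=
  (ContinuousLinearMap.norm_map_iff_adjoint_comp_self _).1 V.norm_map

theorem isometryOf_star_mul {e : ℕ → HilbertSeq} (he : Orthonormal ℂ e) :
    star (isometryOf he) * isometryOf he = 1 := star_mul_of_isometry _

theorem norm_isometryOf_le {e : ℕ → HilbertSeq} (he : Orthonormal ℂ e) : ‖isometryOf he‖ ≤ 1 :=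
  LinearIsometry.norm_toContinuousLinearMap_le _

/-- The parameter of the rotation taking `e_n` to `e_{2n+1}`. -/
def shiftParam (s : I) (n : ℕ) : I := clamp (((n : ℝ) + 1) * (n + 2) * s - (n + 1))

/-- An orthonormal sequence depending continuously on `s`, which joins `e_n` to `e_{2n+1}`: the
rotations of `e_n` for different `n` take place one after the other. -/
def shiftSeq (s : I) (n : ℕ) : HilbertSeq :=
  ((√(1 - shiftParam s n) : ℝ) : ℂ) • basis n +
    ((√(shiftParam s n : ℝ) : ℝ) : ℂ) • basis (2 * n + 1)

/-- The rotation of `e_n` takes place for `s` between `1/(n+2)` and `1/(n+1)`, so larger indices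
move first. As `2n+1 > n`, the vector `e_{2n+1}` has left its place before `e_n` begins to move into
it. -/
theorem shiftParam_seq (s : I) (n : ℕ) :
    shiftParam s n = 0 ∨ shiftParam s (2 * n + 1) = 1 := by
  rcases le_total (((n : ℝ) + 2) * s) 1 with h | h
  · left
    refine clamp_of_nonpos ?_
    have : (0 : ℝ) ≤ n := n.cast_nonneg
    nlinarith
  · right
    refine clamp_of_one_le ?_
    have h0 : (0 : ℝ) ≤ n := n.cast_nonneg
    have h1 := s.2.1
    push_cast
    -- From `(n+2)s ≥ 1` follows `(2n+2)s ≥ 1`: the rotation with index `2n+1` is already complete.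
    have h2 : 1 ≤ (2 * (n : ℝ) + 1 + 1) * s := by nlinarith
    nlinarith

theorem shiftSeq_orthonormal (s : I) : Orthonormal ℂ (shiftSeq s) := by
  rw [orthonormal_iff_ite]
  have h0 : ∀ n, ((√(1 - shiftParam s n) : ℝ) : ℂ) * ((√(1 - shiftParam s n) : ℝ) : ℂ) =
      ((1 - shiftParam s n : ℝ) : ℂ) := fun n => by
    rw [← Complex.ofReal_mul, Real.mul_self_sqrt (sub_nonneg.2 (shiftParam s n).2.2)]
  have h1 : ∀ n, ((√(shiftParam s n : ℝ) : ℝ) : ℂ) * ((√(shiftParam s n : ℝ) : ℝ) : ℂ) =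
      ((shiftParam s n : ℝ) : ℂ) := fun n => by
    rw [← Complex.ofReal_mul, Real.mul_self_sqrt (shiftParam s n).2.1]
  -- Two members of the sequence can overlap only when their indices are `n` and `2n+1`. The overlap
  -- is this product, and one factor vanishes at each time.
  have h2 : ∀ n, ((√(shiftParam s n : ℝ) : ℝ) : ℂ) *
      ((√(1 - shiftParam s (2 * n + 1)) : ℝ) : ℂ) = 0 := fun n => by
    rcases shiftParam_seq s n with h | h <;> simp [h]
  intro i j
  simp only [shiftSeq, inner_add_left, inner_add_right, inner_smul_left, inner_smul_right,
    inner_basis, Complex.conj_ofReal]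
  by_cases hij : i = j
  · subst hij
    have h3 : i ≠ 2 * i + 1 := by omega
    simp only [if_true, if_neg h3, if_neg h3.symm, mul_one, mul_zero, add_zero, zero_add, h0, h1]
    push_cast
    ring
  · have h3 : 2 * i + 1 ≠ 2 * j + 1 := by omega
    rw [if_neg hij, if_neg h3]
    by_cases h4 : i = 2 * j + 1
    · have h5 : 2 * i + 1 ≠ j := by omega
      subst h4
      rw [if_pos rfl, if_neg h5]
      simp [h2 j]
    · rw [if_neg h4]
      by_cases h5 : 2 * i + 1 = j
      · subst h5
        simp [mul_comm _ ((√(shiftParam s i : ℝ) : ℝ) : ℂ), h2 i]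
      · simp [if_neg h5]

theorem shiftSeq_zero (n : ℕ) : shiftSeq 0 n = basis n := by
  have : shiftParam 0 n = 0 := clamp_of_nonpos (by
    have : (0 : ℝ) ≤ n := n.cast_nonneg
    simp only [Set.Icc.coe_zero]
    nlinarith)
  simp [shiftSeq, this]

theorem shiftSeq_one (n : ℕ) : shiftSeq 1 n = basis (2 * n + 1) := by
  have : shiftParam 1 n = 1 := clamp_of_one_le (by
    have : (0 : ℝ) ≤ n := n.cast_nonneg
    simp only [Set.Icc.coe_one]
    nlinarith)
  simp [shiftSeq, this]

theorem continuous_shiftSeq (n : ℕ) : Continuous fun s => shiftSeq s n := by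
  have : Continuous fun s => shiftParam s n := continuous_clamp.comp (by fun_prop)
  unfold shiftSeq
  fun_prop

/-- A strongly continuous path of isometries of `ℓ²(ℕ)`. -/
def shift (s : I) : HilbertSeq →L[ℂ] HilbertSeq := isometryOf (shiftSeq_orthonormal s)

theorem shift_zero : shift 0 = 1 :=
  op_ext fun n => by rw [shift, isometryOf_basis, shiftSeq_zero]; rfl

theorem shift_one_basis (n : ℕ) : shift 1 (basis n) = basis (2 * n + 1) := by
  rw [shift, isometryOf_basis, shiftSeq_one]

/-- The rotation intervals accumulate at `s = 0`, but strong continuity of isometries needs checking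
only on basis vectors, each of which moves during a single interval. -/
theorem continuous_shift_apply (x : HilbertSeq) : Continuous fun s => shift s x :=
  continuous_iff_continuousAt.2 fun s =>
    tendsto_op_apply (fun t => norm_isometryOf_le (shiftSeq_orthonormal t)) (fun n => by
      simp only [shift, isometryOf_basis]
      exact (continuous_shiftSeq n).tendsto s) x

theorem evenSeq_orthonormal : Orthonormal ℂ fun n => basis (2 * n) :=
  basis.orthonormal.comp _ fun _ _ h => by simpa using h

theorem star_mul_eq_zero {S T : HilbertSeq →L[ℂ] HilbertSeq}
    (h : ∀ i j, inner ℂ (S (basis i)) (T (basis j)) = 0) : star S * T = 0 :=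
  op_ext fun n => basis.repr.injective <| by
    ext i
    simp only [HilbertBasis.repr_apply_apply]
    change inner ℂ (basis i) (ContinuousLinearMap.adjoint S (T (basis n))) = inner ℂ (basis i) 0
    rw [ContinuousLinearMap.adjoint_inner_right, h, inner_zero_right]

/-- The isometry `e_n ↦ e_{2n}`. -/
def double : HilbertSeq →L[ℂ] HilbertSeq := isometryOf evenSeq_orthonormal

theorem double_basis (n : ℕ) : double (basis n) = basis (2 * n) := isometryOf_basis _ n

theorem star_shift_mul_double : star (shift 1) * double = 0 := star_mul_eq_zero fun i j => by
  rw [shift_one_basis, double_basis, inner_basis, if_neg (by omega)]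

theorem star_double_mul_shift : star double * shift 1 = 0 := star_mul_eq_zero fun i j => by
  rw [shift_one_basis, double_basis, inner_basis, if_neg (by omega)]

theorem star_shift_mul_shift (s : I) : star (shift s) * shift s = 1 := isometryOf_star_mul _

theorem star_double_mul_double : star double * double = 1 := isometryOf_star_mul _

/-- The isometries `e_n ↦ e_{2n+1}` and `e_n ↦ e_{2n}`. -/
def pair : Multiplier.IsometryPair (HilbertSeq →L[ℂ] HilbertSeq) where
  -- The order matters: the isometry reached by the path from `1` must be the first of the pair, as
  -- `conj_actsTrivially` demands.
  v := ![shift 1, double]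
  star_v_mul i j := by
    fin_cases i <;> fin_cases j <;>
      simp [star_shift_mul_double, star_double_mul_shift, star_shift_mul_shift,
        star_double_mul_double]
  sum_mul_star := by
    refine op_ext fun n => ?_
    change (shift 1 * star (shift 1) + double * star double) (basis n) = basis n
    rcases Nat.even_or_odd' n with ⟨m, rfl | rfl⟩
    · rw [← double_basis]
      change ((shift 1 * star (shift 1) + double * star double) * double) (basis m) = _
      rw [add_mul, mul_assoc, mul_assoc, star_shift_mul_double, star_double_mul_double, mul_zero,
        mul_one, zero_add]
    · rw [← shift_one_basis]
      change ((shift 1 * star (shift 1) + double * star double) * shift 1) (basis m) = _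
      rw [add_mul, mul_assoc, mul_assoc, star_double_mul_shift, star_shift_mul_shift, mul_zero,
        mul_one, add_zero]

/-! ### Isomorphisms `M₂(K) ≅ K` are spatial -/

section matrixSingle

variable {B : Type*} [NonUnitalCStarAlgebra B]

theorem matrixSingle_add (i j : Fin 2) (a b : B) :
    matrixSingle i j (a + b) = matrixSingle i j a + matrixSingle i j b :=
  Matrix.single_add i j a b

theorem matrixSingle_smul (i j : Fin 2) (c : ℂ) (a : B) :
    matrixSingle i j (c • a) = c • matrixSingle i j a :=
  (Matrix.smul_single c i j a).symm

theorem matrixSingle_zero (i j : Fin 2) : matrixSingle i j (0 : B) = 0 := Matrix.single_zero i j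

theorem matrixSingle_mul (i j k l : Fin 2) (a b : B) :
    matrixSingle i j a * matrixSingle k l b = if j = k then matrixSingle i l (a * b) else 0 := by
  split_ifs with h
  · subst h
    exact Matrix.single_mul_single_same a i j l b
  · exact Matrix.single_mul_single_of_ne a i j k h b

theorem star_matrixSingle (i j : Fin 2) (a : B) :
    star (matrixSingle i j a) = matrixSingle j i (star a) :=
  Matrix.conjTranspose_single i j a

theorem eq_sum_matrixSingle (M : CStarMatrix (Fin 2) (Fin 2) B) :
    M = ∑ i, ∑ j, matrixSingle i j (M i j) :=
  Matrix.matrix_eq_sum_single (M : Matrix (Fin 2) (Fin 2) B)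

theorem matrixDiag_eq (a b : B) : matrixDiag a b = matrixSingle 0 0 a + matrixSingle 1 1 b := by
  refine CStarMatrix.ext fun i j => ?_
  change (!![a, 0; 0, b] : Matrix (Fin 2) (Fin 2) B) i j =
    Matrix.single 0 0 a i j + Matrix.single 1 1 b i j
  fin_cases i <;> fin_cases j <;> simp [Matrix.single]

end matrixSingle

theorem exists_unit_fixed_vector {q : HilbertSeq →L[ℂ] HilbertSeq} (hq : q ≠ 0)
    (hqq : q * q = q) : ∃ ξ : HilbertSeq, ‖ξ‖ = 1 ∧ q ξ = ξ := by
  obtain ⟨η, hη⟩ : ∃ η, q η ≠ 0 := by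
    by_contra! h
    exact hq (ContinuousLinearMap.ext h)
  refine ⟨((‖q η‖ : ℂ))⁻¹ • q η, ?_, ?_⟩
  · rw [norm_smul, norm_inv, Complex.norm_real, norm_norm, inv_mul_cancel₀ (norm_ne_zero_iff.2 hη)]
  · rw [map_smul]
    congr 1
    exact congrArg (fun k : HilbertSeq →L[ℂ] HilbertSeq => k η) hqq

/-- The operator `η ↦ π(E_{i0} ⊗ |η⟩⟨e₀|) ξ`. -/
def spatialMap (π : CStarMatrix (Fin 2) (Fin 2) Compacts →ₗ[ℂ] HilbertSeq →L[ℂ] HilbertSeq)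
    (ξ : HilbertSeq) (i : Fin 2) : HilbertSeq →ₗ[ℂ] HilbertSeq where
  toFun η := π (matrixSingle i 0 (rk η (basis 0))) ξ
  map_add' η ζ := by rw [rk_add, matrixSingle_add, map_add]; rfl
  map_smul' c η := by rw [rk_smul, matrixSingle_smul, map_smul]; rfl

theorem spatialMap_apply
    (π : CStarMatrix (Fin 2) (Fin 2) Compacts →ₗ[ℂ] HilbertSeq →L[ℂ] HilbertSeq)
    (ξ : HilbertSeq) (i : Fin 2) (η : HilbertSeq) :
    spatialMap π ξ i η = π (matrixSingle i 0 (rk η (basis 0))) ξ := rfl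

/-- In `M₂(K)`, `(E_{ij} ⊗ k)(E_{l0} ⊗ |η⟩⟨e₀|) = δ_{jl} E_{i0} ⊗ |kη⟩⟨e₀|`. So the spatial maps
intertwine `π` with the standard action of `M₂(K)` on two copies of `ℓ²(ℕ)`. -/
theorem rep_spatialMap {π : CStarMatrix (Fin 2) (Fin 2) Compacts →ₗ[ℂ] HilbertSeq →L[ℂ] HilbertSeq}
    (hmul : ∀ M N, π (M * N) = π M * π N) (ξ : HilbertSeq) (i j l : Fin 2) (k : Compacts)
    (η : HilbertSeq) : π (matrixSingle i j k) (spatialMap π ξ l η) =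
      if j = l then spatialMap π ξ i (k.1 η) else 0 := by
  have h1 : π (matrixSingle i j k) (spatialMap π ξ l η) =
      (π (matrixSingle i j k) * π (matrixSingle l 0 (rk η (basis 0)))) ξ := rfl
  rw [h1, ← hmul, matrixSingle_mul]
  split_ifs
  · rw [mul_rk, spatialMap_apply]
  · rw [map_zero]
    rfl

/-- The product of the adjoint of one matrix unit with the other is `δ_{ij} ⟨η, ζ⟩ E₀₀ ⊗ |e₀⟩⟨e₀|`,
whose image fixes the unit vector `ξ`. -/
theorem inner_spatialMap
    {π : CStarMatrix (Fin 2) (Fin 2) Compacts →ₗ[ℂ] HilbertSeq →L[ℂ] HilbertSeq}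
    (hmul : ∀ M N, π (M * N) = π M * π N) (hstar : ∀ M, π (star M) = star (π M)) {ξ : HilbertSeq}
    (hξ : ‖ξ‖ = 1) (hq : π (matrixSingle 0 0 (rk (basis 0) (basis 0))) ξ = ξ) (i j : Fin 2)
    (η ζ : HilbertSeq) :
    inner ℂ (spatialMap π ξ i η) (spatialMap π ξ j ζ) = if i = j then inner ℂ η ζ else 0 := by
  have h1 : inner ℂ (spatialMap π ξ i η) (spatialMap π ξ j ζ) =
      inner ℂ ξ ((star (π (matrixSingle i 0 (rk η (basis 0)))) *
        π (matrixSingle j 0 (rk ζ (basis 0)))) ξ) :=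
    (ContinuousLinearMap.adjoint_inner_right (π (matrixSingle i 0 (rk η (basis 0)))) ξ _).symm
  rw [h1, ← hstar, ← hmul, star_matrixSingle, matrixSingle_mul]
  split_ifs
  · rw [star_rk, rk_mul_rk, matrixSingle_smul, map_smul]
    change inner ℂ ξ (inner ℂ η ζ • π (matrixSingle 0 0 (rk (basis 0) (basis 0))) ξ) = _
    rw [hq, inner_smul_right, inner_self_eq_norm_sq_to_K, hξ]
    simp
  · rw [map_zero]
    exact inner_zero_right ξ

/-- Since the range of `π` contains all compact operators, `|η⟩⟨ξ| = π(M)` for some `M`. Applying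
this to `ξ = V₀ e₀` expresses `η` through the first column of `M`. -/
theorem exists_spatialMap_sum
    {π : CStarMatrix (Fin 2) (Fin 2) Compacts →ₗ[ℂ] HilbertSeq →L[ℂ] HilbertSeq}
    (hmul : ∀ M N, π (M * N) = π M * π N) (hsurj : ∀ k : Compacts, ∃ M, π M = k.1) {ξ : HilbertSeq}
    (hξ : ‖ξ‖ = 1) (hq : π (matrixSingle 0 0 (rk (basis 0) (basis 0))) ξ = ξ) (η : HilbertSeq) :
    ∃ x : Fin 2 → HilbertSeq, η = spatialMap π ξ 0 (x 0) + spatialMap π ξ 1 (x 1) := by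
  obtain ⟨M, hM⟩ := hsurj (rk η ξ)
  refine ⟨fun i => (M i 0).1 (basis 0), ?_⟩
  have h1 : spatialMap π ξ 0 (basis 0) = ξ := hq
  have h2 : π M (spatialMap π ξ 0 (basis 0)) = η := by
    rw [h1, hM, coe_rk_apply, inner_self_eq_norm_sq_to_K, hξ]
    simp
  have h3 := rep_spatialMap hmul ξ
  conv_lhs => rw [← h2, eq_sum_matrixSingle M]
  simp only [Fin.sum_univ_two, map_add, add_apply, h3]
  simp

/-- Isometries with orthogonal ranges that span `ℓ²(ℕ)` form a pair. -/
def pairOfRange (S : Fin 2 → HilbertSeq →L[ℂ] HilbertSeq)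
    (h : ∀ i j, star (S i) * S j = if i = j then 1 else 0)
    (hr : ∀ η, ∃ x y, η = S 0 x + S 1 y) :
    Multiplier.IsometryPair (HilbertSeq →L[ℂ] HilbertSeq) where
  v := S
  star_v_mul := h
  sum_mul_star := by
    have h1 : ∀ i, (S 0 * star (S 0) + S 1 * star (S 1)) * S i = S i := fun i => by
      rw [add_mul, mul_assoc, mul_assoc, h, h]
      fin_cases i <;> simp
    refine ContinuousLinearMap.ext fun η => ?_
    obtain ⟨x, y, rfl⟩ := hr η
    rw [map_add, ← mul_apply_eq_comp, ← mul_apply_eq_comp, h1 0, h1 1]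
    rfl

/-- An irreducible representation of `M₂(K)` by compact operators is implemented by a pair of
isometries. -/
theorem exists_isometryPair_of_rep
    {π : CStarMatrix (Fin 2) (Fin 2) Compacts →ₗ[ℂ] HilbertSeq →L[ℂ] HilbertSeq}
    (hmul : ∀ M N, π (M * N) = π M * π N) (hstar : ∀ M, π (star M) = star (π M))
    (hinj : Function.Injective π) (hsurj : ∀ k : Compacts, ∃ M, π M = k.1) :
    ∃ P : Multiplier.IsometryPair (HilbertSeq →L[ℂ] HilbertSeq), ∀ (i : Fin 2) (k : Compacts),
      π (matrixSingle i i k) = P.v i * k.1 * star (P.v i) := by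
  have hpp : rk (basis 0) (basis 0) * rk (basis 0) (basis 0) = rk (basis 0) (basis 0) := by
    rw [rk_mul_rk, inner_basis, if_pos rfl, one_smul]
  have hq0 : π (matrixSingle 0 0 (rk (basis 0) (basis 0))) ≠ 0 := fun h => by
    have h1 : matrixSingle 0 0 (rk (basis 0) (basis 0)) = 0 := hinj (h.trans (map_zero π).symm)
    have h2 : rk (basis 0) (basis 0) = 0 :=
      (Matrix.single_apply_same (0 : Fin 2) (0 : Fin 2) (rk (basis 0) (basis 0))).symm.trans
        (congrArg (fun M : CStarMatrix (Fin 2) (Fin 2) Compacts => M 0 0) h1)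
    have h3 : (rk (basis 0) (basis 0)).1 (basis 0) = 0 := by rw [h2]; rfl
    rw [coe_rk_apply, inner_basis, if_pos rfl, one_smul] at h3
    have h4 := norm_basis 0
    rw [h3, norm_zero] at h4
    exact zero_ne_one h4
  -- Any unit vector in the range of the nonzero projection `π(E₀₀ ⊗ |e₀⟩⟨e₀|)` serves as the image
  -- of `e₀` under the first isometry.
  obtain ⟨ξ, hξ, hqξ⟩ := exists_unit_fixed_vector hq0 (by
    rw [← hmul, matrixSingle_mul, if_pos rfl, hpp])
  have hinner := inner_spatialMap hmul hstar hξ hqξ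
  let V : Fin 2 → HilbertSeq →ₗᵢ[ℂ] HilbertSeq := fun i =>
    (spatialMap π ξ i).isometryOfInner fun η ζ => by rw [hinner, if_pos rfl]
  have hV : ∀ i η, V i η = spatialMap π ξ i η := fun _ _ => rfl
  have hVstar : ∀ i j, star (V i).toContinuousLinearMap * (V j).toContinuousLinearMap =
      if i = j then 1 else 0 := by
    intro i j
    split_ifs with h
    · subst h
      exact star_mul_of_isometry (V i)
    · exact star_mul_eq_zero fun m n => (hinner i j _ _).trans (if_neg h)
  obtain ⟨S, hS⟩ : ∃ S : Fin 2 → HilbertSeq →L[ℂ] HilbertSeq,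
      S = fun i => (V i).toContinuousLinearMap := ⟨_, rfl⟩
  have hSV : ∀ i η, S i η = spatialMap π ξ i η := fun i η => by rw [hS]; rfl
  have hSS : ∀ i j, star (S i) * S j = if i = j then 1 else 0 := by rw [hS]; exact hVstar
  clear_value V
  let P := pairOfRange S hSS fun η => by
    obtain ⟨x, hx⟩ := exists_spatialMap_sum hmul hsurj hξ hqξ η
    exact ⟨x 0, x 1, by rw [hSV, hSV]; exact hx⟩
  have hP : P.v = S := rfl
  clear_value P
  refine ⟨P, fun i k => ?_⟩
  -- The intertwining relation as an operator identity. Multiplying `π(E_{ii} ⊗ k)` by `∑ v_j v_j* =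
  -- 1` then leaves `v_i k v_i*`.
  have h1 : ∀ j, π (matrixSingle i i k) * P.v j = if i = j then P.v i * k.1 else 0 := by
    intro j
    rw [hP]
    refine ContinuousLinearMap.ext fun η => ?_
    rw [mul_apply_eq_comp, hSV, rep_spatialMap hmul ξ i i j k η]
    split_ifs
    · rw [mul_apply_eq_comp, hSV]
    · rfl
  rw [← mul_one (π (matrixSingle i i k)), ← P.sum_mul_star, mul_add, ← mul_assoc, ← mul_assoc, h1,
    h1]
  fin_cases i <;> simp

/-- Every isomorphism `M₂(K) ≅ K` is implemented by a pair of isometries. -/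
theorem exists_isometryPair (κ : CStarMatrix (Fin 2) (Fin 2) Compacts ≃⋆ₐ[ℂ] Compacts) :
    ∃ P : Multiplier.IsometryPair (HilbertSeq →L[ℂ] HilbertSeq), ∀ (i : Fin 2) (k : Compacts),
      (κ (matrixSingle i i k)).1 = P.v i * k.1 * star (P.v i) :=
  exists_isometryPair_of_rep
    (π := { toFun := fun M => (κ M).1
            map_add' := fun M N => congrArg Subtype.val (map_add κ M N)
            map_smul' := fun c M => congrArg Subtype.val (map_smul κ c M) })
    (fun M N => congrArg Subtype.val (map_mul κ M N))
    (fun M => congrArg Subtype.val (map_star κ M))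
    (fun _ _ h => κ.injective (Subtype.ext h))
    (fun k => ⟨κ.symm k, congrArg Subtype.val (κ.apply_symm_apply k)⟩)

end Compacts

/-! ### Multipliers of tensor products -/

/-- Taking `2^k`-th roots sends the constant `K` to `1`. With the C*-identity, which squares norms,
this turns a crude bound into a sharp one. -/
theorem le_of_pow_two_pow_le {a b K : ℝ} (hb : 0 ≤ b)
    (h : ∀ k : ℕ, a ^ 2 ^ k ≤ K * b ^ 2 ^ k) : a ≤ b := by
  by_contra! hab
  have ha0 : 0 < a := hb.trans_lt hab
  have hr : b / a < 1 := (div_lt_one ha0).2 hab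
  have h1 : Tendsto (fun k : ℕ => K * (b / a) ^ 2 ^ k) atTop (𝓝 (K * 0)) :=
    ((tendsto_pow_atTop_nhds_zero_of_lt_one (by positivity) hr).comp
      (tendsto_pow_atTop_atTop_of_one_lt (r := 2) one_lt_two)).const_mul K
  rw [mul_zero] at h1
  obtain ⟨k, hk⟩ := (h1.eventually (gt_mem_nhds zero_lt_one)).exists
  have h2 := h k
  rw [div_pow, ← mul_div_assoc, div_lt_one (by positivity)] at hk
  linarith

namespace MaxTensor

variable {A : Type v} {B : Type w} [NonUnitalCStarAlgebra A] [NonUnitalCStarAlgebra B]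

section lift

variable {F : Type*} [NormedAddCommGroup F] [NormedSpace ℂ F]

/-- The extension of a bounded linear map to the completed tensor product. -/
@[irreducible]
def extendCLM [CompleteSpace F] (T : AlgTensor A B →ₗ[ℂ] F) (C : ℝ) (h : ∀ x, ‖T x‖ ≤ C * ‖x‖) :
    MaxTensor A B →L[ℂ] F :=
  ContinuousLinearMap.extend (T.mkContinuous C h)
    (ofAlg (A := A) (B := B)).toContinuousLinearMap

theorem extendCLM_ofAlg [CompleteSpace F] (T : AlgTensor A B →ₗ[ℂ] F) (C : ℝ) (h : ∀ x, ‖T x‖ ≤ C * ‖x‖)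
    (x : AlgTensor A B) : extendCLM T C h (ofAlg x) = T x := by
  rw [extendCLM]
  exact ContinuousLinearMap.extend_eq _ (e := (ofAlg (A := A) (B := B)).toContinuousLinearMap)
    denseRange_ofAlg ofAlg.isometry.isUniformInducing x

theorem extendCLM_tmul [CompleteSpace F] (T : AlgTensor A B →ₗ[ℂ] F) (C : ℝ) (h : ∀ x, ‖T x‖ ≤ C * ‖x‖)
    (a : A) (b : B) : extendCLM T C h (tmul a b) = T (algTmul a b) :=
  extendCLM_ofAlg T C h (algTmul a b)

/-- Continuous linear maps that agree on elementary tensors are equal. -/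
theorem clm_ext {S T : MaxTensor A B →L[ℂ] F} (h : ∀ a b, S (tmul a b) = T (tmul a b)) :
    S = T := by
  refine ContinuousLinearMap.ext fun x => ?_
  refine induction_on x (isClosed_eq S.continuous T.continuous) fun x => ?_
  induction x using alg_induction with
  | h0 => simp
  | ht a b => exact h a b
  | ha x y hx hy => rw [map_add, map_add, map_add, hx, hy]

end lift

theorem tmul_add (a : A) (b b' : B) : tmul a (b + b') = tmul a b + tmul a b' :=
  (congrArg ofAlg (TensorProduct.tmul_add (R := ℂ) a b b')).trans (map_add ofAlg _ _)

theorem add_tmul (a a' : A) (b : B) : tmul (a + a') b = tmul a b + tmul a' b :=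
  (congrArg ofAlg (TensorProduct.add_tmul (R := ℂ) a a' b)).trans (map_add ofAlg _ _)

theorem smul_tmul (c : ℂ) (a : A) (b : B) : tmul (c • a) b = c • tmul a b :=
  (congrArg ofAlg (TensorProduct.smul_tmul' (R := ℂ) c a b).symm).trans (map_smul ofAlg _ _)

theorem tmul_smul (c : ℂ) (a : A) (b : B) : tmul a (c • b) = c • tmul a b :=
  (congrArg ofAlg (TensorProduct.tmul_smul (R := ℂ) c a b)).trans (map_smul ofAlg _ _)

theorem tmul_mul_tmul (a a' : A) (b b' : B) :
    tmul a b * tmul a' b' = tmul (a * a') (b * b') :=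
  (ofAlg_mul _ _).symm.trans (congrArg ofAlg (algTmul_mul a a' b b'))

theorem star_tmul (a : A) (b : B) : star (tmul a b) = tmul (star a) (star b) :=
  (ofAlg_star _).symm

theorem norm_tmul_le (a : A) (b : B) : ‖tmul a b‖ ≤ ‖a‖ * ‖b‖ :=
  (ofAlg.norm_map _).trans_le (norm_algTmul_le a b)

variable (A B) in
/-- Elementary tensors as a bilinear map. -/
def tmulBilin : A →ₗ[ℂ] B →ₗ[ℂ] MaxTensor A B :=
  LinearMap.mk₂ ℂ tmul add_tmul smul_tmul tmul_add tmul_smul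

theorem continuous_tmul : Continuous fun p : A × B => tmul p.1 p.2 := by
  have : (fun p : A × B => tmul p.1 p.2) =
      fun p : A × B => (tmulBilin A B).mkContinuous₂ 1 (fun a b => by
        rw [one_mul]; exact norm_tmul_le a b) p.1 p.2 := rfl
  rw [this]
  fun_prop

/-- The operator `a ⊗ b ↦ a ⊗ m b` on the algebraic tensor product. -/
def algLeft (m : 𝓜(ℂ, B)) : AlgTensor A B →ₗ[ℂ] AlgTensor A B :=
  (TensorProduct.map LinearMap.id m.fst.toLinearMap : A ⊗[ℂ] B →ₗ[ℂ] A ⊗[ℂ] B)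

/-- The operator `a ⊗ b ↦ a ⊗ b m` on the algebraic tensor product. -/
def algRight (m : 𝓜(ℂ, B)) : AlgTensor A B →ₗ[ℂ] AlgTensor A B :=
  (TensorProduct.map LinearMap.id m.snd.toLinearMap : A ⊗[ℂ] B →ₗ[ℂ] A ⊗[ℂ] B)

theorem algLeft_tmul (m : 𝓜(ℂ, B)) (a : A) (b : B) :
    algLeft m (algTmul a b) = algTmul a (m.fst b) := rfl

theorem algRight_tmul (m : 𝓜(ℂ, B)) (a : A) (b : B) :
    algRight m (algTmul a b) = algTmul a (m.snd b) := rfl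

theorem algRight_mul (m : 𝓜(ℂ, B)) (x y : AlgTensor A B) :
    algRight m x * y = x * algLeft m y := by
  induction x using alg_induction with
  | h0 => simp
  | ha x x' hx hx' => simp only [add_mul, map_add, hx, hx']
  | ht a b =>
    induction y using alg_induction with
    | h0 => simp
    | ha y y' hy hy' => simp only [mul_add, map_add, hy, hy']
    | ht c d => simp only [algRight_tmul, algLeft_tmul, algTmul_mul, m.central]

theorem star_algLeft (m : 𝓜(ℂ, B)) (x : AlgTensor A B) :
    star (algLeft m x) = algRight (star m) (star x) := by
  induction x using alg_induction with
  | h0 => simp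
  | ha x x' hx hx' => simp only [map_add, star_add, hx, hx']
  | ht a b =>
    simp only [algLeft_tmul, star_algTmul, algRight_tmul, DoubleCentralizer.star_snd, star_star]

theorem algLeft_mul (m n : 𝓜(ℂ, B)) (x : AlgTensor A B) :
    algLeft (m * n) x = algLeft m (algLeft n x) := by
  induction x using alg_induction with
  | h0 => simp
  | ha x x' hx hx' => simp only [map_add, hx, hx']
  | ht a b => rfl

/-- A crude bound read off from a representation of `x` as a sum of elementary tensors; its constant
depends on `x` but not on `m`. -/
theorem exists_norm_algLeft_le (x : AlgTensor A B) :
    ∃ C, ∀ m : 𝓜(ℂ, B), ‖algLeft m x‖ ≤ ‖m‖ * C := by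
  induction x using alg_induction with
  | h0 => exact ⟨0, by simp⟩
  | ht a b =>
    refine ⟨‖a‖ * ‖b‖, fun m => (norm_algTmul_le _ _).trans ?_⟩
    calc ‖a‖ * ‖m.fst b‖ ≤ ‖a‖ * (‖m‖ * ‖b‖) := by
          gcongr; exact Multiplier.norm_fst_apply_le m b
      _ = _ := by ring
  | ha x y hx hy =>
    obtain ⟨C, hC⟩ := hx
    obtain ⟨D, hD⟩ := hy
    refine ⟨C + D, fun m => ?_⟩
    rw [map_add, mul_add]
    exact (norm_add_le _ _).trans (add_le_add (hC m) (hD m))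

theorem norm_algLeft_sq_le (m : 𝓜(ℂ, B)) (x : AlgTensor A B) :
    ‖algLeft m x‖ ^ 2 ≤ ‖x‖ * ‖algLeft (star m * m) x‖ := by
  have h1 : star (algLeft m x) * algLeft m x = star x * algLeft (star m * m) x := by
    rw [star_algLeft, algRight_mul, algLeft_mul]
  rw [sq, ← AlgTensor.norm_star_mul_self, h1]
  exact (norm_mul_le _ _).trans_eq (by rw [norm_star])

/-- Iterating `norm_algLeft_sq_le` replaces `m` by `m*m` and doubles the exponent, while the crude
constant stays fixed; taking roots removes it. -/
theorem norm_algLeft_le (m : 𝓜(ℂ, B)) (x : AlgTensor A B) : ‖algLeft m x‖ ≤ ‖m‖ * ‖x‖ := by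
  obtain ⟨C, hC⟩ := exists_norm_algLeft_le x
  -- The norm on `A ⊙ B` is only known to be a seminorm here, and the constant below divides by
  -- `‖x‖`; null vectors are handled directly.
  rcases (norm_nonneg x).eq_or_lt with hx | hx
  · have h1 := norm_algLeft_sq_le m x
    rw [← hx, zero_mul] at h1
    have h2 : ‖algLeft m x‖ = 0 := by nlinarith [norm_nonneg (algLeft m x)]
    rw [h2]
    positivity
  refine le_of_pow_two_pow_le (K := C / ‖x‖) (by positivity) fun k => ?_
  rw [div_mul_eq_mul_div, le_div_iff₀ hx]
  induction k generalizing m with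
  | zero =>
    have := hC m
    simp only [pow_zero, pow_one]
    nlinarith
  | succ k ih =>
    calc ‖algLeft m x‖ ^ 2 ^ (k + 1) * ‖x‖ = (‖algLeft m x‖ ^ 2) ^ 2 ^ k * ‖x‖ := by
          rw [← pow_mul, pow_succ']
      _ ≤ (‖x‖ * ‖algLeft (star m * m) x‖) ^ 2 ^ k * ‖x‖ := by
          gcongr; exact norm_algLeft_sq_le m x
      _ = ‖x‖ ^ 2 ^ k * (‖algLeft (star m * m) x‖ ^ 2 ^ k * ‖x‖) := by rw [mul_pow]; ring
      _ ≤ ‖x‖ ^ 2 ^ k * (C * (‖star m * m‖ * ‖x‖) ^ 2 ^ k) :=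
          mul_le_mul_of_nonneg_left (ih (star m * m)) (by positivity)
      _ = C * (‖m‖ * ‖x‖) ^ 2 ^ (k + 1) := by
          rw [CStarRing.norm_star_mul_self, pow_succ' 2 k, pow_mul, mul_pow, mul_pow, mul_pow]
          ring

theorem norm_algRight_le (m : 𝓜(ℂ, B)) (x : AlgTensor A B) : ‖algRight m x‖ ≤ ‖m‖ * ‖x‖ := by
  have h := star_algLeft (star m) (star x)
  rw [star_star, star_star] at h
  rw [← h, norm_star, ← norm_star x, ← norm_star m]
  exact norm_algLeft_le _ _

/-- Left multiplication by `1 ⊗ m`. -/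
def leftCLM (m : 𝓜(ℂ, B)) : MaxTensor A B →L[ℂ] MaxTensor A B :=
  extendCLM (ofAlg.toLinearMap.comp (algLeft m)) ‖m‖ fun x =>
    (ofAlg.norm_map _).trans_le (norm_algLeft_le m x)

/-- Right multiplication by `1 ⊗ m`. -/
def rightCLM (m : 𝓜(ℂ, B)) : MaxTensor A B →L[ℂ] MaxTensor A B :=
  extendCLM (ofAlg.toLinearMap.comp (algRight m)) ‖m‖ fun x =>
    (ofAlg.norm_map _).trans_le (norm_algRight_le m x)

theorem leftCLM_ofAlg (m : 𝓜(ℂ, B)) (x : AlgTensor A B) :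
    leftCLM m (ofAlg x) = ofAlg (algLeft m x) := extendCLM_ofAlg _ _ _ x

theorem rightCLM_ofAlg (m : 𝓜(ℂ, B)) (x : AlgTensor A B) :
    rightCLM m (ofAlg x) = ofAlg (algRight m x) := extendCLM_ofAlg _ _ _ x

theorem leftCLM_tmul (m : 𝓜(ℂ, B)) (a : A) (b : B) :
    leftCLM m (tmul a b) = tmul a (m.fst b) := leftCLM_ofAlg m (algTmul a b)

theorem rightCLM_tmul (m : 𝓜(ℂ, B)) (a : A) (b : B) :
    rightCLM m (tmul a b) = tmul a (m.snd b) := rightCLM_ofAlg m (algTmul a b)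

theorem star_rightCLM (m : 𝓜(ℂ, B)) (x : MaxTensor A B) :
    star (rightCLM m (star x)) = leftCLM (star m) x := by
  refine induction_on x (isClosed_eq (by fun_prop) (by fun_prop)) fun x => ?_
  have h := star_algLeft (star m) x
  rw [star_star] at h
  rw [← ofAlg_star, rightCLM_ofAlg, ← ofAlg_star, leftCLM_ofAlg, ← h, star_star]

theorem star_leftCLM (m : 𝓜(ℂ, B)) (x : MaxTensor A B) :
    star (leftCLM m (star x)) = rightCLM (star m) x := by
  refine induction_on x (isClosed_eq (by fun_prop) (by fun_prop)) fun x => ?_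
  rw [← ofAlg_star, rightCLM_ofAlg, leftCLM_ofAlg, ← ofAlg_star, star_algLeft, star_star]

variable (A B) in
/-- The homomorphism `m ↦ 1 ⊗ m` from `M(B)` to `M(A ⊗ B)`. -/
def multiplier : 𝓜(ℂ, B) →⋆ₐ[ℂ] 𝓜(ℂ, MaxTensor A B) where
  toFun m := ⟨(leftCLM m, rightCLM m), fun x y => by
    change rightCLM m x * y = x * leftCLM m y
    refine induction_on x (isClosed_eq (by fun_prop) (by fun_prop)) fun x => ?_
    refine induction_on y (isClosed_eq (by fun_prop) (by fun_prop)) fun y => ?_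
    rw [rightCLM_ofAlg, leftCLM_ofAlg, ← ofAlg_mul, ← ofAlg_mul, algRight_mul]⟩
  map_one' := by
    apply DoubleCentralizer.ext
    refine Prod.ext ?_ ?_ <;> refine clm_ext fun a b => ?_
    · exact leftCLM_tmul 1 a b
    · exact rightCLM_tmul 1 a b
  map_mul' m n := by
    apply DoubleCentralizer.ext
    refine Prod.ext ?_ ?_ <;> refine clm_ext fun a b => ?_
    · change leftCLM (m * n) (tmul a b) = leftCLM m (leftCLM n (tmul a b))
      rw [leftCLM_tmul, leftCLM_tmul, leftCLM_tmul]
      rfl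
    · change rightCLM (m * n) (tmul a b) = rightCLM n (rightCLM m (tmul a b))
      rw [rightCLM_tmul, rightCLM_tmul, rightCLM_tmul]
      rfl
  map_zero' := by
    apply DoubleCentralizer.ext
    refine Prod.ext ?_ ?_ <;> refine clm_ext fun a b => ?_
    · change leftCLM 0 (tmul a b) = 0
      rw [leftCLM_tmul]
      exact map_zero (tmulBilin A B a)
    · change rightCLM 0 (tmul a b) = 0
      rw [rightCLM_tmul]
      exact map_zero (tmulBilin A B a)
  map_add' m n := by
    apply DoubleCentralizer.ext
    refine Prod.ext ?_ ?_ <;> refine clm_ext fun a b => ?_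
    · change leftCLM (m + n) (tmul a b) = leftCLM m (tmul a b) + leftCLM n (tmul a b)
      rw [leftCLM_tmul, leftCLM_tmul, leftCLM_tmul]
      exact tmul_add a _ _
    · change rightCLM (m + n) (tmul a b) = rightCLM m (tmul a b) + rightCLM n (tmul a b)
      rw [rightCLM_tmul, rightCLM_tmul, rightCLM_tmul]
      exact tmul_add a _ _
  commutes' c := by
    rw [Algebra.algebraMap_eq_smul_one, Algebra.algebraMap_eq_smul_one]
    apply DoubleCentralizer.ext
    refine Prod.ext ?_ ?_ <;> refine clm_ext fun a b => ?_
    · change leftCLM _ (tmul a b) = c • tmul a b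
      rw [leftCLM_tmul]
      exact tmul_smul c a b
    · change rightCLM _ (tmul a b) = c • tmul a b
      rw [rightCLM_tmul]
      exact tmul_smul c a b
  map_star' m := by
    apply DoubleCentralizer.ext
    refine Prod.ext ?_ ?_ <;> refine ContinuousLinearMap.ext fun x => ?_
    · exact (star_rightCLM m x).symm
    · exact (star_leftCLM m x).symm

theorem multiplier_fst_tmul (m : 𝓜(ℂ, B)) (a : A) (b : B) :
    (multiplier A B m).fst (tmul a b) = tmul a (m.fst b) := leftCLM_tmul m a b

theorem multiplier_snd_tmul (m : 𝓜(ℂ, B)) (a : A) (b : B) :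
    (multiplier A B m).snd (tmul a b) = tmul a (m.snd b) := rightCLM_tmul m a b

theorem sandwich_multiplier_tmul (m n : 𝓜(ℂ, B)) (a : A) (b : B) :
    Multiplier.sandwich (multiplier A B m) (multiplier A B n) (tmul a b) =
      tmul a (Multiplier.sandwich m n b) := by
  rw [Multiplier.sandwich_apply, multiplier_snd_tmul, multiplier_fst_tmul, Multiplier.sandwich_apply]

variable (A) in
/-- Bounded operators on `ℓ²(ℕ)` as multipliers `1 ⊗ T` of `A ⊗ K`. -/
def opMultiplier : (HilbertSeq →L[ℂ] HilbertSeq) →⋆ₐ[ℂ] 𝓜(ℂ, MaxTensor A Compacts) :=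
  (multiplier A Compacts).comp Compacts.multiplier

theorem opMultiplier_fst_tmul (T : HilbertSeq →L[ℂ] HilbertSeq) (a : A) (k : Compacts) :
    (opMultiplier A T).fst (tmul a k) = tmul a (Compacts.leftMul T k) :=
  multiplier_fst_tmul _ a k

theorem sandwich_opMultiplier_tmul (S T : HilbertSeq →L[ℂ] HilbertSeq) (a : A) (k : Compacts) :
    Multiplier.sandwich (opMultiplier A S) (opMultiplier A T) (tmul a k) =
      tmul a (Multiplier.sandwich (Compacts.multiplier S) (Compacts.multiplier T) k) :=
  sandwich_multiplier_tmul _ _ a k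

/-- By boundedness it suffices to test on `A ⊙ K`, and there on elementary tensors, where `S_t k`
converges in norm because `k` is compact. -/
theorem tendsto_opMultiplier {T : Type*} {l : Filter T} {S : T → HilbertSeq →L[ℂ] HilbertSeq}
    {S₀ : HilbertSeq →L[ℂ] HilbertSeq} {C : ℝ} (hC : ∀ t, ‖S t‖ ≤ C)
    (h : ∀ x, Tendsto (fun t => S t x) l (𝓝 (S₀ x))) (x : MaxTensor A Compacts) :
    Tendsto (fun t => (opMultiplier A (S t)).fst x) l (𝓝 ((opMultiplier A S₀).fst x)) := by
  have hC' : ∀ t, ‖opMultiplier A (S t)‖ ≤ C := fun t =>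
    (NonUnitalStarAlgHom.norm_apply_le (opMultiplier A) (S t)).trans (hC t)
  refine tendsto_apply_of_dense (C := C) (fun t x => (Multiplier.norm_fst_apply_le _ x).trans
    (mul_le_mul_of_nonneg_right (hC' t) (norm_nonneg x))) denseRange_ofAlg ?_ x
  rintro _ ⟨y, rfl⟩
  induction y using alg_induction with
  | h0 => simpa using tendsto_const_nhds
  | ha y z hy hz => simpa only [map_add] using hy.add hz
  | ht a k =>
    have h1 := Compacts.tendsto_leftMul hC h k
    have h2 : Tendsto (fun t => tmul a (Compacts.leftMul (S t) k)) l
        (𝓝 (tmul a (Compacts.leftMul S₀ k))) :=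
      ((continuous_tmul.comp (continuous_const.prodMk continuous_id)).tendsto _).comp h1
    rw [← opMultiplier_fst_tmul S₀ a k] at h2
    exact h2.congr fun t => (opMultiplier_fst_tmul (S t) a k).symm

end MaxTensor

/-! ### Slices of `A ⊗ K` -/

namespace Compacts

/-- The projection onto the span of the first `n` basis vectors. -/
def proj (n : ℕ) : HilbertSeq →L[ℂ] HilbertSeq := ∑ i : Fin n, rankOne ℂ (basis i) (basis i)

theorem proj_apply (n : ℕ) (x : HilbertSeq) :
    proj n x = ∑ i : Fin n, inner ℂ (basis i) x • basis i := by
  rw [proj, sum_apply]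
  rfl

theorem proj_basis (n k : ℕ) : proj n (basis k) = if k < n then basis k else 0 := by
  rw [proj_apply]
  split_ifs with h
  · rw [Finset.sum_eq_single_of_mem (⟨k, h⟩ : Fin n) (Finset.mem_univ _) fun i _ hi => ?_]
    · rw [inner_basis, if_pos rfl, one_smul]
    · rw [inner_basis, if_neg fun e => hi (Fin.ext e), zero_smul]
  · refine Finset.sum_eq_zero fun i _ => ?_
    rw [inner_basis, if_neg fun e => h (by rw [← e]; exact i.2), zero_smul]

theorem star_proj (n : ℕ) : star (proj n) = proj n := by
  rw [proj, star_sum]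
  exact Finset.sum_congr rfl fun i _ => InnerProductSpace.adjoint_rankOne _ _

theorem proj_mul_self (n : ℕ) : proj n * proj n = proj n := by
  refine op_ext fun k => ?_
  change proj n (proj n (basis k)) = proj n (basis k)
  rw [proj_basis]
  split_ifs with h
  · rw [proj_basis, if_pos h]
  · exact map_zero _

theorem norm_proj_le (n : ℕ) : ‖proj n‖ ≤ 1 := by
  have h := CStarRing.norm_star_mul_self (x := proj n)
  rw [star_proj, proj_mul_self] at h
  nlinarith [norm_nonneg (proj n)]

theorem tendsto_proj (x : HilbertSeq) : Tendsto (fun n => proj n x) atTop (𝓝 x) := by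
  refine tendsto_op_apply (S₀ := 1) norm_proj_le (fun k => ?_) x
  refine tendsto_const_nhds.congr' ?_
  filter_upwards [eventually_gt_atTop k] with n hn
  rw [proj_basis, if_pos hn]
  rfl

/-- The matrix coefficient `⟨e_i, k e_j⟩`. -/
def coeff (i j : ℕ) : Compacts →ₗ[ℂ] ℂ where
  toFun k := inner ℂ (basis i) (k.1 (basis j))
  map_add' _ _ := inner_add_right _ _ _
  map_smul' _ _ := inner_smul_right _ _ _

theorem coeff_apply (i j : ℕ) (k : Compacts) :
    coeff i j k = inner ℂ (basis i) (k.1 (basis j)) := rfl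

theorem proj_mul_proj (n : ℕ) (k : Compacts) :
    Multiplier.sandwich (multiplier (proj n)) (multiplier (proj n)) k =
      ∑ i : Fin n, ∑ j : Fin n, coeff i j k • rk (basis i) (basis j) := by
  refine ext_apply fun x => ?_
  rw [coe_sandwich_multiplier]
  have h : (((∑ i : Fin n, ∑ j : Fin n, coeff i j k • rk (basis i) (basis j) : Compacts)) :
      HilbertSeq →L[ℂ] HilbertSeq) =
      ∑ i : Fin n, ∑ j : Fin n, coeff i j k • (rk (basis i) (basis j)).1 := by
    rw [AddSubmonoidClass.coe_finsetSum]
    exact Finset.sum_congr rfl fun i _ => by rw [AddSubmonoidClass.coe_finsetSum]; rfl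
  refine Eq.trans ?_ (congrArg (fun T : HilbertSeq →L[ℂ] HilbertSeq => T x) h.symm)
  change proj n (k.1 (proj n x)) = _
  rw [proj_apply n x, map_sum, map_sum]
  simp only [sum_apply, smul_apply, coe_rk_apply, map_smul]
  rw [Finset.sum_comm]
  refine Finset.sum_congr rfl fun j _ => ?_
  rw [proj_apply, Finset.smul_sum]
  refine Finset.sum_congr rfl fun i _ => ?_
  rw [coeff_apply, smul_smul, smul_smul, mul_comm]

end Compacts

namespace MaxTensor

open Compacts

/-! ### Compressions to `M_n(A)` and the C*-seminorm they define -/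

section compression

variable {A : Type v} [NonUnitalCStarAlgebra A]

/-- The matrix of `a ⊗ T` with respect to the first `n` basis vectors. -/
def compression (n : ℕ) (a : A) (T : HilbertSeq →L[ℂ] HilbertSeq) :
    CStarMatrix (Fin n) (Fin n) A :=
  CStarMatrix.ofMatrix fun i j => inner ℂ (basis i) (T (basis j)) • a

theorem compression_apply (n : ℕ) (a : A) (T : HilbertSeq →L[ℂ] HilbertSeq) (i j : Fin n) :
    compression n a T i j = inner ℂ (basis i) (T (basis j)) • a := rfl

/-- Truncating the matrices inserts `proj n` between the factors. This is the only failure of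
multiplicativity. -/
theorem compression_mul (n : ℕ) (a b : A) (S T : HilbertSeq →L[ℂ] HilbertSeq) :
    compression n a S * compression n b T = compression n (a * b) (S * (proj n * T)) := by
  ext i j
  have h : ((S * (proj n * T) : HilbertSeq →L[ℂ] HilbertSeq)) (basis j) =
      ∑ l : Fin n, inner ℂ (basis l) (T (basis j)) • S (basis l) := by
    change S (proj n (T (basis j))) = _
    rw [proj_apply, map_sum]
    simp only [map_smul]
  rw [CStarMatrix.mul_apply, compression_apply, h, inner_sum, Finset.sum_smul]
  refine Finset.sum_congr rfl fun l _ => ?_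
  rw [compression_apply, compression_apply, smul_mul_smul_comm, inner_smul_right, mul_comm]

theorem star_compression (n : ℕ) (a : A) (T : HilbertSeq →L[ℂ] HilbertSeq) :
    star (compression n a T) = compression n (star a) (star T) := by
  ext i j
  rw [CStarMatrix.star_apply, compression_apply, compression_apply, star_smul,
    ContinuousLinearMap.star_eq_adjoint, ContinuousLinearMap.adjoint_inner_right]
  congr 1
  exact inner_conj_symm _ _

theorem compression_sub (n : ℕ) (a : A) (S T : HilbertSeq →L[ℂ] HilbertSeq) :
    compression n a (S - T) = compression n a S - compression n a T := by
  ext i j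
  rw [CStarMatrix.sub_apply, compression_apply, compression_apply, compression_apply,
    sub_apply, inner_sub_right, sub_smul]

section norm

variable [PartialOrder A] [StarOrderedRing A]

/-- A crude bound, entry by entry, with a constant depending on `n`. -/
theorem exists_norm_compression_le (n : ℕ) :
    ∃ K : ℝ, 0 ≤ K ∧ ∀ (a : A) (T : HilbertSeq →L[ℂ] HilbertSeq),
      ‖compression n a T‖ ≤ K * (‖a‖ * ‖T‖) := by
  have hf : ∀ i j : Fin n, ∃ f : A →L[ℂ] CStarMatrix (Fin n) (Fin n) A,
      ∀ a, f a = CStarMatrix.ofMatrix (Matrix.single i j a) := fun i j =>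
    ⟨⟨CStarMatrix.ofMatrixₗ.comp (Matrix.singleLinearMap ℂ i j),
      CStarMatrix.ofMatrixL.continuous.comp (by
        refine continuous_matrix fun k l => ?_
        change Continuous fun a : A => Matrix.single i j a k l
        simp only [Matrix.single_apply]
        split_ifs <;> fun_prop)⟩, fun _ => rfl⟩
  choose f hf using hf
  refine ⟨∑ i, ∑ j, ‖f i j‖, by positivity, fun a T => ?_⟩
  have h : compression n a T = ∑ i : Fin n, ∑ j : Fin n, (inner ℂ (basis i) (T (basis j)) : ℂ) • f i j a := by
    simp only [hf, CStarMatrix.smul_of, Matrix.smul_single]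
    refine (Matrix.matrix_eq_sum_single _).trans ?_
    rfl
  rw [h, Finset.sum_mul]
  refine (norm_sum_le _ _).trans (Finset.sum_le_sum fun i _ => ?_)
  rw [Finset.sum_mul]
  refine (norm_sum_le _ _).trans (Finset.sum_le_sum fun j _ => ?_)
  rw [norm_smul]
  have h1 : ‖(inner ℂ (basis i) (T (basis j)) : ℂ)‖ ≤ ‖T‖ := by
    refine (norm_inner_le_norm _ _).trans ?_
    rw [norm_basis, one_mul]
    refine (T.le_opNorm _).trans ?_
    rw [norm_basis, mul_one]
  calc _ ≤ ‖T‖ * (‖f i j‖ * ‖a‖) := by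
        gcongr
        exact (f i j).le_opNorm a
    _ = _ := by ring

/-- By the C*-identity `‖compression n a T‖²` is the norm of the compression of `a*a` and `T* P_n
T`, and `‖P_n‖ ≤ 1`. Iterating and taking roots removes the constant that depends on `n`. -/
theorem norm_compression_le (n : ℕ) (a : A) (T : HilbertSeq →L[ℂ] HilbertSeq) :
    ‖compression n a T‖ ≤ ‖a‖ * ‖T‖ := by
  obtain ⟨K, hK, h⟩ := exists_norm_compression_le (A := A) n
  refine le_of_pow_two_pow_le (K := K) (by positivity) fun k => ?_
  induction k generalizing a T with
  | zero => simpa using h a T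
  | succ k ih =>
    calc ‖compression n a T‖ ^ 2 ^ (k + 1)
        = ‖compression n (star a * a) (star T * (proj n * T))‖ ^ 2 ^ k := by
          rw [← compression_mul, ← star_compression, CStarRing.norm_star_mul_self, ← sq,
            ← pow_mul, pow_succ']
      _ ≤ K * (‖star a * a‖ * ‖star T * (proj n * T)‖) ^ 2 ^ k := ih _ _
      _ ≤ K * ((‖a‖ * ‖a‖) * (‖T‖ * ‖T‖)) ^ 2 ^ k := by
          have h1 : ‖star T * (proj n * T)‖ ≤ ‖T‖ * ‖T‖ := by
            refine (norm_mul_le _ _).trans ?_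
            rw [show ‖star T‖ = ‖T‖ from norm_star T]
            refine mul_le_mul_of_nonneg_left ((norm_mul_le _ _).trans ?_) (norm_nonneg _)
            exact mul_le_of_le_one_left (norm_nonneg _) (norm_proj_le n)
          rw [CStarRing.norm_star_mul_self]
          gcongr
      _ = K * (‖a‖ * ‖T‖) ^ 2 ^ (k + 1) := by
          rw [pow_succ' 2 k, pow_mul]
          congr 2
          ring

end norm

/-- The compression of an element of `A ⊙ K` to the first `n` basis vectors. -/
def compressAlg (n : ℕ) : AlgTensor A Compacts →ₗ[ℂ] CStarMatrix (Fin n) (Fin n) A :=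
  TensorProduct.lift (LinearMap.mk₂ ℂ (fun (a : A) (k : Compacts) => compression n a k.1)
    (fun a b k => by ext i j; exact smul_add _ a b)
    (fun c a k => by ext i j; exact smul_comm _ c a)
    (fun a k l => by
      ext i j
      refine (congrArg (· • a) (map_add (coeff i j) k l)).trans ?_
      exact add_smul _ _ a)
    (fun c a k => by
      ext i j
      refine (congrArg (· • a) (map_smul (coeff i j) c k)).trans ?_
      exact smul_assoc c _ a))

theorem compressAlg_tmul (n : ℕ) (a : A) (k : Compacts) :
    compressAlg n (algTmul a k) = compression n a k.1 := rfl

theorem star_compressAlg (n : ℕ) (x : AlgTensor A Compacts) :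
    compressAlg n (star x) = star (compressAlg n x) := by
  induction x using alg_induction with
  | h0 => simp
  | ha x y hx hy => simp only [star_add, map_add, hx, hy]
  | ht a k => rw [star_algTmul, compressAlg_tmul, compressAlg_tmul, star_compression]; rfl

variable [PartialOrder A] [StarOrderedRing A]

/-- On elementary tensors the defect is the compression of `ab` and `k(l - P_n l)`, which vanishes
in the limit because `P_n l → l` in norm for compact `l`. -/
theorem tendsto_compressAlg_mul (x y : AlgTensor A Compacts) :
    Tendsto (fun n => ‖compressAlg n (x * y) - compressAlg n x * compressAlg n y‖) atTop
      (𝓝 0) := by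
  induction x using alg_induction with
  | h0 => simp
  | ha x x' hx hx' =>
    refine squeeze_zero (fun _ => norm_nonneg _) (fun n => ?_) (by simpa using hx.add hx')
    rw [add_mul, map_add, map_add, add_mul, add_sub_add_comm]
    exact norm_add_le _ _
  | ht a k =>
    induction y using alg_induction with
    | h0 => simp
    | ha x x' hx hx' =>
      refine squeeze_zero (fun _ => norm_nonneg _) (fun n => ?_) (by simpa using hx.add hx')
      rw [mul_add, map_add, map_add, mul_add, add_sub_add_comm]
      exact norm_add_le _ _
    | ht b l =>
      have h1 := Compacts.tendsto_leftMul (S₀ := 1) norm_proj_le tendsto_proj l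
      have h2 : Tendsto (fun n => ‖a * b‖ * (‖k.1‖ * ‖leftMul 1 l - leftMul (proj n) l‖)) atTop
          (𝓝 0) := by
        have := ((tendsto_const_nhds (x := leftMul 1 l)).sub h1).norm
        simpa using (this.const_mul ‖k.1‖).const_mul ‖a * b‖
      refine squeeze_zero (fun _ => norm_nonneg _) (fun n => ?_) h2
      rw [algTmul_mul, compressAlg_tmul, compressAlg_tmul, compressAlg_tmul, compression_mul,
        ← compression_sub]
      refine (norm_compression_le _ _ _).trans ?_
      refine mul_le_mul_of_nonneg_left ?_ (norm_nonneg _)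
      have h3 : (k * l : Compacts).1 - k.1 * (proj n * l.1) =
          k.1 * (leftMul 1 l - leftMul (proj n) l).1 := by
        change k.1 * l.1 - k.1 * (proj n * l.1) = k.1 * (1 * l.1 - proj n * l.1)
        rw [one_mul, mul_sub]
      rw [h3]
      exact norm_mul_le _ _

theorem exists_norm_compressAlg_le (x : AlgTensor A Compacts) :
    ∃ C, ∀ n, ‖compressAlg n x‖ ≤ C := by
  induction x using alg_induction with
  | h0 => exact ⟨0, by simp⟩
  | ha x y hx hy =>
    obtain ⟨C, hC⟩ := hx
    obtain ⟨D, hD⟩ := hy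
    exact ⟨C + D, fun n => by
      rw [map_add]; exact (norm_add_le _ _).trans (add_le_add (hC n) (hD n))⟩
  | ht a k => exact ⟨_, fun n => norm_compression_le n a k.1⟩

theorem exists_tendsto_compressAlg (x : AlgTensor A Compacts) :
    ∃ r, Tendsto (fun n => ‖compressAlg n x‖) (hyperfilter ℕ : Filter ℕ) (𝓝 r) := by
  obtain ⟨C, hC⟩ := exists_norm_compressAlg_le x
  -- The norms are bounded, so an ultrafilter limit exists without any proof that the sequence
  -- converges.
  obtain ⟨r, -, hr⟩ := (isCompact_Icc (a := (0 : ℝ)) (b := C)).ultrafilter_le_nhds'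
    ((hyperfilter ℕ).map fun n => ‖compressAlg n x‖)
    (by
      rw [Ultrafilter.mem_map]
      exact Filter.mem_of_superset univ_mem fun n _ => ⟨norm_nonneg _, hC n⟩)
  exact ⟨r, hr⟩

/-- The limit of the norms of the compressions along an ultrafilter. -/
def compressNorm (x : AlgTensor A Compacts) : ℝ := (exists_tendsto_compressAlg x).choose

theorem tendsto_compressNorm (x : AlgTensor A Compacts) :
    Tendsto (fun n => ‖compressAlg n x‖) (hyperfilter ℕ : Filter ℕ) (𝓝 (compressNorm x)) :=
  (exists_tendsto_compressAlg x).choose_spec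

theorem tendsto_compressNorm_mul (x y : AlgTensor A Compacts) :
    Tendsto (fun n => ‖compressAlg n x * compressAlg n y‖) (hyperfilter ℕ : Filter ℕ)
      (𝓝 (compressNorm (x * y))) := by
  have h1 := (tendsto_compressAlg_mul x y).mono_left
    ((hyperfilter_le_cofinite (α := ℕ)).trans Nat.cofinite_eq_atTop.le)
  have h2 := tendsto_compressNorm (x * y)
  refine tendsto_of_tendsto_of_dist h2 (squeeze_zero (fun _ => dist_nonneg) (fun n => ?_) h1)
  rw [Real.dist_eq]
  exact abs_norm_sub_norm_le _ _

theorem compressNorm_add_le (x y : AlgTensor A Compacts) :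
    compressNorm (x + y) ≤ compressNorm x + compressNorm y :=
  le_of_tendsto_of_tendsto' (tendsto_compressNorm (x + y))
    ((tendsto_compressNorm x).add (tendsto_compressNorm y)) fun n => by
      rw [map_add]; exact norm_add_le _ _

theorem compressNorm_smul (c : ℂ) (x : AlgTensor A Compacts) :
    compressNorm (c • x) = ‖c‖ * compressNorm x :=
  tendsto_nhds_unique (tendsto_compressNorm (c • x)) (by
    simpa only [map_smul, norm_smul] using (tendsto_compressNorm x).const_mul ‖c‖)

theorem compressNorm_star_mul_self (x : AlgTensor A Compacts) :
    compressNorm (star x * x) = compressNorm x * compressNorm x :=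
  tendsto_nhds_unique (tendsto_compressNorm_mul (star x) x) (by
    refine ((tendsto_compressNorm x).mul (tendsto_compressNorm x)).congr fun n => ?_
    rw [star_compressAlg, CStarRing.norm_star_mul_self])

variable (A) in
/-- The C*-seminorm on `A ⊙ K` given by the compressions. -/
def compressSeminorm : TensorCStarSeminorm A Compacts where
  __ := Seminorm.of (compressNorm (A := A)) compressNorm_add_le compressNorm_smul
  mul_le' x y := le_of_tendsto_of_tendsto' (tendsto_compressNorm_mul x y)
    ((tendsto_compressNorm x).mul (tendsto_compressNorm y)) fun _ => norm_mul_le _ _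
  star_mul_self' := compressNorm_star_mul_self
  tmul_le' a k := le_of_tendsto' (tendsto_compressNorm (algTmul a k))
    fun n => norm_compression_le n a k.1

theorem compressNorm_le (x : AlgTensor A Compacts) : compressNorm x ≤ ‖x‖ :=
  TensorCStarSeminorm.le_iSup (compressSeminorm A) x

end compression

/-! ### Slice maps and their separation property -/

variable {A : Type v} [NonUnitalCStarAlgebra A]

/-- The map `a ⊗ k ↦ ⟨e_i, k e_j⟩ a` on `A ⊙ K`. -/
def sliceAlg (i j : ℕ) : AlgTensor A Compacts →ₗ[ℂ] A :=
  TensorProduct.lift ((LinearMap.lsmul ℂ A).flip.compl₂ (coeff i j))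

/-- For `n > max i j` the slice is an entry of the compressed matrix, so its norm is at most the
limiting norm of the compressions. That limit is a C*-seminorm, hence dominated by the maximal one.
-/
theorem norm_sliceAlg_le (i j : ℕ) (x : AlgTensor A Compacts) : ‖sliceAlg i j x‖ ≤ 1 * ‖x‖ := by
  -- The order serves only to give the matrix algebras over `A` their C*-norm.
  let _ : PartialOrder A := CStarAlgebra.spectralOrder A
  have _ : StarOrderedRing A := CStarAlgebra.spectralOrderedRing A
  rw [one_mul]
  refine le_trans ?_ (compressNorm_le x)
  refine ge_of_tendsto (tendsto_compressNorm x) ?_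
  have h : ∀ᶠ n in (hyperfilter ℕ : Filter ℕ), max i j < n :=
    ((hyperfilter_le_cofinite (α := ℕ)).trans Nat.cofinite_eq_atTop.le)
      (eventually_gt_atTop (max i j))
  filter_upwards [h] with n hn
  rw [max_lt_iff] at hn
  have h1 : sliceAlg i j x = compressAlg n x ⟨i, hn.1⟩ ⟨j, hn.2⟩ := by
    induction x using alg_induction with
    | h0 => simp
    | ha x y hx hy => rw [map_add, map_add, hx, hy]; rfl
    | ht a k => rfl
  rw [h1]
  exact CStarMatrix.norm_entry_le_norm

/-- The slice map `a ⊗ k ↦ ⟨e_i, k e_j⟩ a` on `A ⊗ K`. -/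
def slice (i j : ℕ) : MaxTensor A Compacts →L[ℂ] A :=
  extendCLM (sliceAlg i j) 1 (norm_sliceAlg_le i j)

theorem slice_tmul (i j : ℕ) (a : A) (k : Compacts) : slice i j (tmul a k) = coeff i j k • a :=
  extendCLM_tmul _ _ _ a k

theorem sandwich_proj (n : ℕ) (x : MaxTensor A Compacts) :
    Multiplier.sandwich (opMultiplier A (proj n)) (opMultiplier A (proj n)) x =
      ∑ i : Fin n, ∑ j : Fin n, tmul (slice i j x) (rk (basis i) (basis j)) := by
  have h : Multiplier.sandwich (opMultiplier A (proj n)) (opMultiplier A (proj n)) =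
      ∑ i : Fin n, ∑ j : Fin n, (((tmulBilin A Compacts).flip (rk (basis i) (basis j))).mkContinuous
        ‖rk (basis i) (basis j)‖ fun a => (norm_tmul_le _ _).trans (mul_comm _ _).le).comp
          (slice i j) := by
    refine clm_ext fun a k => ?_
    rw [sandwich_opMultiplier_tmul, proj_mul_proj]
    simp only [sum_apply]
    refine (map_sum (tmulBilin A Compacts a) _ _).trans (Finset.sum_congr rfl fun i _ => ?_)
    refine (map_sum (tmulBilin A Compacts a) _ _).trans (Finset.sum_congr rfl fun j _ => ?_)
    change tmul a (coeff i j k • rk (basis i) (basis j)) =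
      tmul (slice i j (tmul a k)) (rk (basis i) (basis j))
    rw [slice_tmul, tmul_smul, smul_tmul]
  rw [h]
  simp only [sum_apply]
  rfl

/-- `P_n → 1` strongly and boundedly, so `1 ⊗ P_n → 1` strictly and the conjugates of `x` converge
to `x`. -/
theorem tendsto_sandwich_proj (x : MaxTensor A Compacts) :
    Tendsto (fun n => ∑ i : Fin n, ∑ j : Fin n, tmul (slice i j x) (rk (basis i) (basis j))) atTop
      (𝓝 x) := by
  simp only [← sandwich_proj]
  have h := Multiplier.tendsto_sandwich (m := fun n => opMultiplier A (proj n)) (m₀ := 1) (C := 1)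
    (l := atTop) (fun n => (NonUnitalStarAlgHom.norm_apply_le (opMultiplier A) (proj n)).trans
      (norm_proj_le n)) (fun y => by
        have := tendsto_opMultiplier (A := A) (S₀ := 1) norm_proj_le tendsto_proj y
        rwa [map_one] at this) x
  simp only [← map_star, star_proj] at h
  rwa [star_one] at h

/-- `x` is a limit of finite sums assembled from its slices. -/
theorem eq_zero_of_slice {x : MaxTensor A Compacts} (h : ∀ i j, slice i j x = 0) : x = 0 := by
  refine tendsto_nhds_unique (tendsto_sandwich_proj x) (tendsto_const_nhds.congr fun n => ?_)
  refine (Finset.sum_eq_zero fun i _ => Finset.sum_eq_zero fun j _ => ?_).symm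
  rw [h]
  exact map_zero ((tmulBilin A Compacts).flip _)

end MaxTensor

/-! ### The isomorphism `S(B ⊗ K) ≅ SB ⊗ K` -/

/-- A bounded sequence of operators that converges pointwise to the identity converges uniformly
along paths. -/
theorem eventually_norm_apply_path_sub_lt {E : Type*} [NormedAddCommGroup E] [NormedSpace ℂ E]
    {T : ℕ → E →L[ℂ] E} (hT : ∀ n x, ‖T n x‖ ≤ ‖x‖) (h : ∀ x, Tendsto (fun n => T n x) atTop (𝓝 x))
    (F : C(I, E)) {ε : ℝ} (hε : 0 < ε) : ∀ᶠ n in atTop, ∀ s, dist (T n (F s)) (F s) < ε := by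
  have hc : IsCompact (Set.range F) := isCompact_range F.continuous
  obtain ⟨t, -, htf, htc⟩ := hc.finite_cover_balls (e := ε / 3) (by positivity)
  have h3 : ∀ᶠ n in atTop, ∀ b ∈ t, dist (T n b) b < ε / 3 := by
    rw [htf.eventually_all]
    exact fun b _ => Metric.tendsto_nhds.1 (h b) _ (by positivity)
  filter_upwards [h3] with n hn s
  obtain ⟨b, hb, hs⟩ := Set.mem_iUnion₂.1 (htc (Set.mem_range_self s))
  rw [Metric.mem_ball] at hs
  have h4 : dist (T n (F s)) (T n b) ≤ dist (F s) b := by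
    rw [dist_eq_norm, dist_eq_norm, ← map_sub]
    exact hT n _
  have h5 := dist_triangle4 (T n (F s)) (T n b) b (F s)
  have h6 := hn b hb
  rw [dist_comm b] at h5
  linarith

namespace MaxTensor

/-! ### The universal property of the maximal tensor product -/

section lift

variable {A : Type v} {B : Type w} [NonUnitalCStarAlgebra A] [NonUnitalCStarAlgebra B]
  {E : Type*} [NonUnitalCStarAlgebra E]

/-- A bilinear map, as a linear map on `A ⊙ B`. -/
def liftAlg (f : A →ₗ[ℂ] B →ₗ[ℂ] E) : AlgTensor A B →ₗ[ℂ] E := TensorProduct.lift f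

theorem liftAlg_tmul (f : A →ₗ[ℂ] B →ₗ[ℂ] E) (a : A) (b : B) :
    liftAlg f (algTmul a b) = f a b := rfl

theorem liftAlg_mul (f : A →ₗ[ℂ] B →ₗ[ℂ] E)
    (hmul : ∀ a a' b b', f (a * a') (b * b') = f a b * f a' b') (x y : AlgTensor A B) :
    liftAlg f (x * y) = liftAlg f x * liftAlg f y := by
  induction x using alg_induction with
  | h0 => simp
  | ha x x' hx hx' => simp only [add_mul, map_add, hx, hx']
  | ht a b =>
    induction y using alg_induction with
    | h0 => simp
    | ha y y' hy hy' => simp only [mul_add, map_add, hy, hy']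
    | ht c d => rw [algTmul_mul, liftAlg_tmul, liftAlg_tmul, liftAlg_tmul, hmul]

theorem liftAlg_star (f : A →ₗ[ℂ] B →ₗ[ℂ] E)
    (hstar : ∀ a b, f (star a) (star b) = star (f a b)) (x : AlgTensor A B) :
    liftAlg f (star x) = star (liftAlg f x) := by
  induction x using alg_induction with
  | h0 => simp
  | ha x x' hx hx' => simp only [star_add, map_add, hx, hx']
  | ht a b => rw [star_algTmul, liftAlg_tmul, liftAlg_tmul, hstar]

variable (f : A →ₗ[ℂ] B →ₗ[ℂ] E) (hmul : ∀ a a' b b', f (a * a') (b * b') = f a b * f a' b')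
  (hstar : ∀ a b, f (star a) (star b) = star (f a b)) (hnorm : ∀ a b, ‖f a b‖ ≤ ‖a‖ * ‖b‖)

/-- The C*-seminorm on `A ⊙ B` induced by a homomorphism. -/
def liftSeminorm : TensorCStarSeminorm A B where
  __ := (normSeminorm ℂ E).comp (TensorProduct.lift f)
  mul_le' x y := (congrArg norm (liftAlg_mul f hmul x y)).trans_le (norm_mul_le _ _)
  star_mul_self' x := by
    refine (congrArg norm ((liftAlg_mul f hmul (star x) x).trans
      (congrArg (· * liftAlg f x) (liftAlg_star f hstar x)))).trans ?_
    exact CStarRing.norm_star_mul_self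
  tmul_le' := hnorm

/-- The norm of `E` pulled back along the lift is one of the C*-seminorms in the supremum that
defines the maximal norm. -/
theorem norm_liftAlg_le (f : A →ₗ[ℂ] B →ₗ[ℂ] E)
    (hmul : ∀ a a' b b', f (a * a') (b * b') = f a b * f a' b')
    (hstar : ∀ a b, f (star a) (star b) = star (f a b)) (hnorm : ∀ a b, ‖f a b‖ ≤ ‖a‖ * ‖b‖)
    (x : AlgTensor A B) : ‖liftAlg f x‖ ≤ 1 * ‖x‖ :=
  (TensorCStarSeminorm.le_iSup (liftSeminorm f hmul hstar hnorm) x).trans_eq (one_mul _).symm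

/-- The homomorphism from the maximal tensor product given by a multiplicative, `*`-preserving and
contractive bilinear map. -/
def lift : MaxTensor A B →⋆ₙₐ[ℂ] E :=
  let T := extendCLM (liftAlg f) 1 (norm_liftAlg_le f hmul hstar hnorm)
  have hT : ∀ x, T (ofAlg x) = liftAlg f x := extendCLM_ofAlg _ _ _
  { toFun := T
    map_smul' := map_smul T
    map_zero' := map_zero T
    map_add' := map_add T
    map_mul' := fun x y => by
      refine induction_on x (isClosed_eq (by fun_prop) (by fun_prop)) fun x => ?_
      refine induction_on y (isClosed_eq (by fun_prop) (by fun_prop)) fun y => ?_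
      rw [← ofAlg_mul, hT, hT, hT, liftAlg_mul f hmul]
    map_star' := fun x => by
      refine induction_on x (isClosed_eq (by fun_prop) (by fun_prop)) fun x => ?_
      rw [← ofAlg_star, hT, hT, liftAlg_star f hstar] }

theorem lift_tmul (a : A) (b : B) : lift f hmul hstar hnorm (tmul a b) = f a b :=
  extendCLM_tmul (liftAlg f) 1 (norm_liftAlg_le f hmul hstar hnorm) a b

end lift

/-- A `*`-homomorphism of C*-algebras as a continuous linear map. -/
def _root_.NonUnitalStarAlgHom.toCLM {D E : Type*} [NonUnitalCStarAlgebra D]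
    [NonUnitalCStarAlgebra E] (φ : D →⋆ₙₐ[ℂ] E) : D →L[ℂ] E :=
  LinearMap.mkContinuous
    { toFun := φ
      map_add' := map_add φ
      map_smul' := map_smul φ } 1 fun x => by
    rw [one_mul]
    exact NonUnitalStarAlgHom.norm_apply_le φ x

/-! ### Loops in `B ⊗ K` as elements of `SB ⊗ K` -/

section susp

variable {B : Type w} [NonUnitalCStarAlgebra B]

/-- Evaluation of loops. -/
def evalSusp (s : I) : Susp B →L[ℂ] B :=
  (ContinuousMap.evalCLM ℂ s).comp (loopSubalgebra B).toSubmodule.subtypeL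

theorem norm_susp_apply_le (F : Susp B) (s : I) : ‖F.1 s‖ ≤ ‖F‖ := F.1.norm_coe_le_norm s

theorem norm_susp_le {F : Susp B} {C : ℝ} (hC : 0 ≤ C) (h : ∀ s, ‖F.1 s‖ ≤ C) : ‖F‖ ≤ C :=
  (ContinuousMap.norm_le F.1 hC).2 h

/-- Pointwise application of a continuous linear map to a loop. -/
def suspMap {E : Type*} [NonUnitalCStarAlgebra E] (T : B →L[ℂ] E) (F : Susp B) : Susp E :=
  ⟨⟨fun s => T (F.1 s), by fun_prop⟩, by
    change T (F.1 0) = 0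
    rw [F.2.1, map_zero], by
    change T (F.1 1) = 0
    rw [F.2.2, map_zero]⟩

theorem susp_ext {F G : Susp B} (h : ∀ s, F.1 s = G.1 s) : F = G :=
  Subtype.ext (ContinuousMap.ext h)

/-- The map `b ↦ b ⊗ k`. -/
def tmulRight {C : Type*} [NonUnitalCStarAlgebra C] (k : C) : B →L[ℂ] MaxTensor B C :=
  ((tmulBilin B C).flip k).mkContinuous ‖k‖ fun _ => (norm_tmul_le _ _).trans (mul_comm _ _).le

variable (B) in
/-- The bilinear map underlying `SB ⊗ C → S(B ⊗ C)`. -/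
def suspBilin (C : Type*) [NonUnitalCStarAlgebra C] :
    Susp B →ₗ[ℂ] C →ₗ[ℂ] Susp (MaxTensor B C) :=
  LinearMap.mk₂ ℂ (fun F k => suspMap (tmulRight k) F)
    (fun F G _ => susp_ext fun s => add_tmul (F.1 s) (G.1 s) _)
    (fun c F _ => susp_ext fun s => smul_tmul c (F.1 s) _)
    (fun F k l => susp_ext fun s => tmul_add (F.1 s) k l)
    (fun c F k => susp_ext fun s => tmul_smul c (F.1 s) k)

variable (B) in
/-- The homomorphism `SB ⊗ C → S(B ⊗ C)` with `F ⊗ k ↦ (s ↦ F(s) ⊗ k)`. -/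
def suspHom (C : Type*) [NonUnitalCStarAlgebra C] :
    MaxTensor (Susp B) C →⋆ₙₐ[ℂ] Susp (MaxTensor B C) :=
  lift (suspBilin B C)
    (fun F G k l => susp_ext fun s => (tmul_mul_tmul (F.1 s) (G.1 s) k l).symm)
    (fun F k => susp_ext fun s => (star_tmul (F.1 s) k).symm)
    (fun F k => norm_susp_le (by positivity) fun s => (norm_tmul_le (F.1 s) k).trans (by
      gcongr
      exact norm_susp_apply_le F s))

theorem suspHom_tmul {C : Type*} [NonUnitalCStarAlgebra C] (F : Susp B) (k : C) (s : I) :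
    (suspHom B C (tmul F k)).1 s = tmul (F.1 s) k :=
  congrArg (fun G : Susp (MaxTensor B C) => G.1 s) (lift_tmul _ _ _ _ F k)

/-- Continuous linear maps out of `SB ⊗ C` that factor through evaluations agree with those on
`S(B ⊗ C)` if they do so on elementary tensors. -/
theorem apply_suspHom_apply {C F : Type*} [NonUnitalCStarAlgebra C] [NormedAddCommGroup F]
    [NormedSpace ℂ F] {S : MaxTensor (Susp B) C →L[ℂ] F} {T : MaxTensor B C →L[ℂ] F} {s : I}
    (h : ∀ F k, S (tmul F k) = T (tmul (F.1 s) k)) (x : MaxTensor (Susp B) C) :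
    S x = T ((suspHom B C x).1 s) := by
  have h1 : S = (T.comp (evalSusp s)).comp (suspHom B C).toCLM := clm_ext fun F k => by
    rw [h]
    exact congrArg T (suspHom_tmul F k s).symm
  rw [h1]
  rfl

theorem slice_suspHom (i j : ℕ) (x : MaxTensor (Susp B) Compacts) (s : I) :
    slice i j ((suspHom B Compacts x).1 s) = (slice i j x).1 s := by
  symm
  refine apply_suspHom_apply (S := (evalSusp s).comp (slice i j)) (fun F k => ?_) x
  rw [ContinuousLinearMap.comp_apply, slice_tmul, slice_tmul]
  rfl

/-- Slices commute with evaluation of loops, so if the image of `x` is zero then all slices of `x`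
vanish, and slices separate points of `SB ⊗ K`. -/
theorem suspHom_injective : Function.Injective (suspHom B Compacts) := by
  rw [injective_iff_map_eq_zero]
  intro x hx
  refine eq_zero_of_slice fun i j => susp_ext fun s => ?_
  rw [← slice_suspHom, hx]
  exact map_zero (slice i j)

theorem suspHom_isometry : Isometry (suspHom B Compacts) :=
  NonUnitalStarAlgHom.isometry _ suspHom_injective

theorem mem_closure_range_suspHom (G : Susp (MaxTensor B Compacts)) :
    G ∈ closure (Set.range (suspHom B Compacts)) := by
  rw [Metric.mem_closure_range_iff]
  intro ε hε
  have h1 : ∀ n (x : MaxTensor B Compacts), ‖Multiplier.sandwich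
      (opMultiplier B (Compacts.proj n)) (opMultiplier B (Compacts.proj n)) x‖ ≤ ‖x‖ := fun n x => by
    have h := (NonUnitalStarAlgHom.norm_apply_le (opMultiplier B) (Compacts.proj n)).trans
      (Compacts.norm_proj_le n)
    refine (Multiplier.norm_sandwich_le _ _ x).trans ?_
    refine (mul_le_of_le_one_left (by positivity) h).trans ?_
    exact mul_le_of_le_one_left (norm_nonneg _) h
  -- Compressing by `1 ⊗ P_n` is contractive and approximates `G(s)` uniformly in `s`. The
  -- compressed loop is a finite sum of loops `slice i j ∘ G` tensored with matrix units, so it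
  -- comes from `SB ⊗ K`.
  obtain ⟨n, hn⟩ := (eventually_norm_apply_path_sub_lt h1 (fun x => by
    simpa only [sandwich_proj] using tendsto_sandwich_proj x) G.1 (half_pos hε)).exists
  refine ⟨∑ i : Fin n, ∑ j : Fin n,
    tmul (suspMap (slice i j) G) (Compacts.rk (Compacts.basis i) (Compacts.basis j)), ?_⟩
  rw [dist_comm]
  refine lt_of_le_of_lt ?_ (half_lt_self hε)
  rw [dist_eq_norm]
  refine norm_susp_le (half_pos hε).le fun s => ?_
  refine le_trans (le_of_eq ?_) (hn s).le
  rw [dist_eq_norm, sandwich_proj]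
  congr 1
  change evalSusp s (suspHom B Compacts _ - G) = _
  rw [map_sub, map_sum, map_sum]
  simp only [map_sum]
  congr 1
  exact Finset.sum_congr rfl fun i _ => Finset.sum_congr rfl fun j _ => suspHom_tmul _ _ s

/-- An injective `*`-homomorphism is isometric, so its range is closed; being dense, it is
everything. -/
theorem suspHom_bijective : Function.Bijective (suspHom B Compacts) := by
  refine ⟨suspHom_injective, fun G => ?_⟩
  have h := mem_closure_range_suspHom G
  rwa [suspHom_isometry.isClosedEmbedding.isClosed_range.closure_eq] at h

variable (B) in
/-- The isomorphism `SB ⊗ K ≅ S(B ⊗ K)`. -/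
def suspEquiv : MaxTensor (Susp B) Compacts ≃⋆ₐ[ℂ] Susp (MaxTensor B Compacts) :=
  StarAlgEquiv.ofBijective (suspHom B Compacts) suspHom_bijective

theorem suspEquiv_act {X : Type u} [TopologicalSpace X] [C0Algebra X B] (f : C₀(X, ℂ))
    (x : MaxTensor (Susp B) Compacts) : suspEquiv B (act f x) = act f (suspEquiv B x) := by
  refine susp_ext fun s => ?_
  have h1 := apply_suspHom_apply (B := B) (s := s) (S := ((evalSusp s).comp
    (suspHom B Compacts).toCLM).comp (act (A := MaxTensor (Susp B) Compacts) f)) (T := act f)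
    (fun F k => ?_) x
  · exact h1
  · refine Eq.trans ?_ (actCLM_tmul f (F.1 s) k).symm
    refine (congrArg (fun y => (suspHom B Compacts y).1 s) (actCLM_tmul f F k)).trans ?_
    exact suspHom_tmul (act f F) k s

/-- Under the isomorphism, multiplication by operators on the `K`-factor acts pointwise on loops,
and will therefore commute with reparametrization. -/
theorem suspEquiv_sandwich (S T : HilbertSeq →L[ℂ] HilbertSeq)
    (x : MaxTensor (Susp B) Compacts) (s : I) :
    (suspEquiv B (Multiplier.sandwich (opMultiplier _ S) (opMultiplier _ T) x)).1 s =
      Multiplier.sandwich (opMultiplier B S) (opMultiplier B T) ((suspEquiv B x).1 s) := by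
  refine apply_suspHom_apply (B := B) (s := s) (S := ((evalSusp s).comp
    (suspHom B Compacts).toCLM).comp (Multiplier.sandwich (opMultiplier _ S) (opMultiplier _ T)))
    (fun F k => ?_) x
  rw [sandwich_opMultiplier_tmul, ContinuousLinearMap.comp_apply, sandwich_opMultiplier_tmul]
  exact suspHom_tmul F _ s

end susp

end MaxTensor

/-! ### Direct sums -/

namespace Multiplier

/-! ### Stabilizations as homomorphisms from `B(ℓ²(ℕ))` to `M(D)` -/

section transport

variable {D E : Type*} [NonUnitalCStarAlgebra D] [NonUnitalCStarAlgebra E]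

/-- A `*`-isomorphism as a continuous linear map. -/
def equivCLM (e : D ≃⋆ₐ[ℂ] E) : D →L[ℂ] E :=
  LinearMap.mkContinuous
    { toFun := e
      map_add' := map_add e
      map_smul' := map_smul e } 1 fun x => by
    rw [one_mul]
    exact NonUnitalStarAlgHom.norm_apply_le e x

/-- The homomorphism of multiplier algebras induced by an isomorphism. -/
def transport (e : D ≃⋆ₐ[ℂ] E) : 𝓜(ℂ, E) →⋆ₐ[ℂ] 𝓜(ℂ, D) where
  toFun m := ⟨((equivCLM e.symm).comp (m.fst.comp (equivCLM e)),
      (equivCLM e.symm).comp (m.snd.comp (equivCLM e))), fun x y => by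
    change e.symm (m.snd (e x)) * y = x * e.symm (m.fst (e y))
    refine EquivLike.injective e ?_
    rw [map_mul, map_mul, e.apply_symm_apply, e.apply_symm_apply, m.central]⟩
  map_one' := by
    apply DoubleCentralizer.ext
    refine Prod.ext ?_ ?_ <;> exact ContinuousLinearMap.ext fun x => e.symm_apply_apply x
  map_mul' m n := by
    apply DoubleCentralizer.ext
    refine Prod.ext ?_ ?_ <;> refine ContinuousLinearMap.ext fun x => ?_
    · change e.symm (m.fst (n.fst (e x))) = e.symm (m.fst (e (e.symm (n.fst (e x)))))
      rw [e.apply_symm_apply]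
    · change e.symm (n.snd (m.snd (e x))) = e.symm (n.snd (e (e.symm (m.snd (e x)))))
      rw [e.apply_symm_apply]
  map_zero' := by
    apply DoubleCentralizer.ext
    refine Prod.ext ?_ ?_ <;> exact ContinuousLinearMap.ext fun x => map_zero e.symm
  map_add' m n := by
    apply DoubleCentralizer.ext
    refine Prod.ext ?_ ?_ <;> exact ContinuousLinearMap.ext fun x => map_add e.symm _ _
  commutes' c := by
    rw [Algebra.algebraMap_eq_smul_one, Algebra.algebraMap_eq_smul_one]
    apply DoubleCentralizer.ext
    refine Prod.ext ?_ ?_ <;> refine ContinuousLinearMap.ext fun x => ?_ <;>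
    · change e.symm (c • e x) = c • x
      rw [map_smul, e.symm_apply_apply]
  map_star' m := by
    apply DoubleCentralizer.ext
    refine Prod.ext ?_ ?_ <;> refine ContinuousLinearMap.ext fun x => ?_
    · change e.symm ((star m).fst (e x)) = star (e.symm (m.snd (e (star x))))
      rw [DoubleCentralizer.star_fst, map_star e, ← map_star e.symm]
    · change e.symm ((star m).snd (e x)) = star (e.symm (m.fst (e (star x))))
      rw [DoubleCentralizer.star_snd, map_star e, ← map_star e.symm]

theorem sandwich_transport (e : D ≃⋆ₐ[ℂ] E) (m n : 𝓜(ℂ, E)) (x : D) :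
    sandwich (transport e m) (transport e n) x = e.symm (sandwich m n (e x)) :=
  congrArg (fun y => e.symm (m.fst y)) (e.apply_symm_apply _)

end transport

/-- The homomorphism `B(ℓ²(ℕ)) → M(D)` induced by an isomorphism `D ≅ C ⊗ K`. -/
def ofStabilization {C D : Type*} [NonUnitalCStarAlgebra C] [NonUnitalCStarAlgebra D]
    (ρ : D ≃⋆ₐ[ℂ] MaxTensor C Compacts) : (HilbertSeq →L[ℂ] HilbertSeq) →⋆ₐ[ℂ] 𝓜(ℂ, D) :=
  (transport ρ).comp (MaxTensor.opMultiplier C)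

theorem sandwich_ofStabilization {C D : Type*} [NonUnitalCStarAlgebra C] [NonUnitalCStarAlgebra D]
    (ρ : D ≃⋆ₐ[ℂ] MaxTensor C Compacts) (S T : HilbertSeq →L[ℂ] HilbertSeq) (x : D) :
    sandwich (ofStabilization ρ S) (ofStabilization ρ T) x =
      ρ.symm (sandwich (MaxTensor.opMultiplier C S) (MaxTensor.opMultiplier C T) (ρ x)) :=
  sandwich_transport ρ _ _ x

variable {X : Type u} [TopologicalSpace X]

/-- On a stable algebra conjugation by isometries is trivial up to homotopy. -/
theorem conj_actsTrivially_of_stable {C D : Type*} [NonUnitalCStarAlgebra C]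
    [NonUnitalCStarAlgebra D] [C0Algebra X D] (ρ : D ≃⋆ₐ[ℂ] MaxTensor C Compacts) (A : Type v)
    [NonUnitalCStarAlgebra A] [C0Algebra X A] (m : 𝓜(ℂ, D)) (hm : star m * m = 1) :
    (conj (X := X) m hm).ActsTrivially A := by
  -- The path `shift` is carried to `M(D)` by `T ↦ 1 ⊗ T`; strong continuity becomes strict
  -- continuity, and its end `shift 1` is the first isometry of `pair` by definition.
  refine (Compacts.pair.map (ofStabilization ρ)).conj_actsTrivially
    (fun s => ofStabilization ρ (Compacts.shift s)) (fun s => ?_) (fun x => ?_) ?_ rfl m hm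
  · rw [← map_star, ← map_mul, Compacts.star_shift_mul_shift, map_one]
  · refine (equivCLM ρ.symm).continuous.comp (continuous_iff_continuousAt.2 fun s => ?_)
    exact MaxTensor.tendsto_opMultiplier
      (fun t => Compacts.norm_isometryOf_le (Compacts.shiftSeq_orthonormal t))
      (fun y => (Compacts.continuous_shift_apply y).tendsto s) (ρ x)
  · rw [Compacts.shift_zero, map_one]

/-- The same pair of isometries of `ℓ²(ℕ)` defines both `κ` on `K` and, acting as `1 ⊗ v_i`, the
isomorphism on `D ≅ C ⊗ K`. Central multipliers commute with the conjugations, hence the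
`C₀(X)`-linearity. -/
theorem isStabilizationIso_matrixEquiv {C D : Type w} [NonUnitalCStarAlgebra C]
    [NonUnitalCStarAlgebra D] [C0Algebra X C] [C0Algebra X D]
    (ρ : D ≃⋆ₐ[ℂ] MaxTensor C Compacts) (hρ : ∀ (f : C₀(X, ℂ)) d, ρ (act f d) = act f (ρ d)) :
    IsStabilizationIso X (Compacts.pair.map (ofStabilization ρ)).matrixEquiv := by
  refine ⟨fun f M => ?_, C, inferInstance, inferInstance, ρ,
    (Compacts.pair.map Compacts.multiplier).matrixEquiv, hρ, fun i j c k => ?_⟩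
  · simp only [IsometryPair.matrixEquiv_apply, map_sum]
    exact Finset.sum_congr rfl fun i _ => Finset.sum_congr rfl fun j _ => sandwich_act _ _ _ _
  · rw [IsometryPair.matrixEquiv_single, IsometryPair.matrixEquiv_single]
    change ρ (sandwich (ofStabilization ρ _) (star (ofStabilization ρ _)) _) = _
    rw [← map_star, sandwich_ofStabilization, ρ.apply_symm_apply, ρ.apply_symm_apply,
      MaxTensor.sandwich_opMultiplier_tmul, map_star]
    rfl

/-- Direct sums see only the diagonal corners of `θ`. There `κ` is conjugation by isometries of
`ℓ²(ℕ)`, so `θ` is conjugation by their images in `M(D)`. -/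
theorem exists_isometryPair_of_isStabilizationIso {D : Type w} [NonUnitalCStarAlgebra D]
    [C0Algebra X D] {θ : CStarMatrix (Fin 2) (Fin 2) D ≃⋆ₐ[ℂ] D} (hθ : IsStabilizationIso X θ) :
    ∃ P : IsometryPair 𝓜(ℂ, D),
      ∀ a b, θ (matrixDiag a b) = P.hom (X := X) 0 a + P.hom (X := X) 1 b := by
  obtain ⟨-, C, _, _, ρ, κ, -, hκ⟩ := hθ
  obtain ⟨P, hP⟩ := Compacts.exists_isometryPair κ
  refine ⟨P.map (ofStabilization ρ), fun a b => ?_⟩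
  have key : ∀ i d, θ (matrixSingle i i d) = (P.map (ofStabilization ρ)).hom (X := X) i d := by
    intro i d
    -- As a `*`-homomorphism the corner of `θ` is automatically continuous, so comparison on
    -- elementary tensors is enough.
    let φ : D →⋆ₙₐ[ℂ] D :=
      { toFun := fun d => θ (matrixSingle i i d)
        map_smul' := fun c a => by rw [Compacts.matrixSingle_smul]; exact map_smul θ _ _
        map_zero' := by rw [Compacts.matrixSingle_zero, map_zero]
        map_add' := fun a b => by rw [Compacts.matrixSingle_add, map_add]
        map_mul' := fun a b => by rw [← map_mul, Compacts.matrixSingle_mul, if_pos rfl]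
        map_star' := fun a => by rw [← map_star, Compacts.star_matrixSingle] }
    have h : ((equivCLM ρ).comp φ.toCLM).comp (equivCLM ρ.symm) =
        sandwich (MaxTensor.opMultiplier C (P.v i)) (MaxTensor.opMultiplier C (star (P.v i))) := by
      refine MaxTensor.clm_ext fun c k => (hκ i i c k).trans ?_
      rw [MaxTensor.sandwich_opMultiplier_tmul]
      congr 1
      refine Subtype.ext ((hP i k).trans ?_)
      rw [Compacts.coe_sandwich_multiplier, mul_assoc]
    have h1 := congrArg (fun T : MaxTensor C Compacts →L[ℂ] MaxTensor C Compacts => T (ρ d)) h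
    change ρ (θ (matrixSingle i i (ρ.symm (ρ d)))) = _ at h1
    rw [ρ.symm_apply_apply] at h1
    refine EquivLike.injective ρ ?_
    rw [h1]
    change _ = ρ (sandwich (ofStabilization ρ (P.v i)) (star (ofStabilization ρ (P.v i))) d)
    rw [← map_star, sandwich_ofStabilization, ρ.apply_symm_apply]
  rw [Compacts.matrixDiag_eq, map_add, key, key]

end Multiplier

/-! ### Addition defined by a pair of isometries -/

namespace HomotopyClasses

open Multiplier

variable {X : Type u} [TopologicalSpace X] {A : Type v} [NonUnitalCStarAlgebra A] [C0Algebra X A]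
  {D : Type*} [NonUnitalCStarAlgebra D] [C0Algebra X D]

/-- The addition of homotopy classes defined by a pair of isometries. -/
def pairOp (P : IsometryPair 𝓜(ℂ, D)) :
    HomotopyClasses X A D → HomotopyClasses X A D → HomotopyClasses X A D :=
  op (P.hom 0) (P.hom 1) (P.hom_orthogonal X)

variable (h : ∀ (m : 𝓜(ℂ, D)) (hm : star m * m = 1), (conj (X := X) m hm).ActsTrivially A)

/-- The pairs differ by `u = ∑ w_i v_i*`, and conjugation by `u` is trivial up to homotopy. -/
theorem pairOp_eq_pairOp
    (h : ∀ (m : 𝓜(ℂ, D)) (hm : star m * m = 1), (conj (X := X) m hm).ActsTrivially A)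
    (P Q : IsometryPair 𝓜(ℂ, D)) (x y : HomotopyClasses X A D) : pairOp P x y = pairOp Q x y :=
  op_eq_op _ (h _ (P.transition_isometry Q)) _ (P.conj_transition Q 0) (P.conj_transition Q 1) x y

/-- The abelian monoid structure on `⟦A, D⟧_X` defined by a pair of isometries. -/
@[reducible]
def pairMonoid (P : IsometryPair 𝓜(ℂ, D)) : AddCommMonoid (HomotopyClasses X A D) where
  add := pairOp P
  zero := mk 0
  zero_add := op_zero_left _ (h _ _)
  add_zero := op_zero_right _ (h _ _)
  add_assoc := op_assoc _ (h _ P.associator_isometry)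
    (fun d => by
      simp only [conj_apply, IsometryPair.hom_apply, sandwich_sandwich, ← star_mul,
        P.associator_mul₁])
    (fun d => by
      simp only [conj_apply, IsometryPair.hom_apply, sandwich_sandwich, ← star_mul,
        P.associator_mul₂])
    (fun d => by
      simp only [conj_apply, IsometryPair.hom_apply, sandwich_sandwich, ← star_mul,
        P.associator_mul₃])
  add_comm := op_comm _ (h _ (P.transition_isometry P.flip)) (P.conj_transition P.flip 0)
    (P.conj_transition P.flip 1)
  nsmul := @nsmulRec _ ⟨mk 0⟩ ⟨pairOp P⟩
  nsmul_zero _ := rfl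
  nsmul_succ _ _ := rfl

end HomotopyClasses

/-! ### Loop composition and direct sum on `S(B ⊗ K)` -/

namespace Multiplier

variable {X : Type u} [TopologicalSpace X] {A : Type v} [NonUnitalCStarAlgebra A] [C0Algebra X A]
  {B : Type w} [NonUnitalCStarAlgebra B] [C0Algebra X B]

/-- The pair of isometries of `S(B ⊗ K)` given by `B ⊗ K`. -/
def suspPair (B : Type w) [NonUnitalCStarAlgebra B] :
    IsometryPair 𝓜(ℂ, Susp (MaxTensor B Compacts)) :=
  Compacts.pair.map (ofStabilization (MaxTensor.suspEquiv B).symm)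

theorem suspPair_hom_apply (i : Fin 2) (F : Susp (MaxTensor B Compacts)) (s : I) :
    ((suspPair B).hom (X := X) i F).1 s =
      sandwich (MaxTensor.opMultiplier B (Compacts.pair.v i))
        (MaxTensor.opMultiplier B (star (Compacts.pair.v i))) (F.1 s) := by
  have h := MaxTensor.suspEquiv_sandwich (Compacts.pair.v i) (star (Compacts.pair.v i))
    ((MaxTensor.suspEquiv B).symm F) s
  rw [StarAlgEquiv.apply_symm_apply] at h
  rw [← h]
  change (sandwich (ofStabilization _ _) (star (ofStabilization _ _)) F).1 s = _
  rw [← map_star, sandwich_ofStabilization]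
  rfl

/-- Substitution changes the parameter of a loop and conjugation changes its values, so they
commute. The interchange law rests on this. -/
theorem suspPair_hom_subst (i : Fin 2) (g : C(I, I)) (h0 : g 0 = 0 ∨ g 0 = 1)
    (h1 : g 1 = 0 ∨ g 1 = 1) (F : Susp (MaxTensor B Compacts)) :
    subst (X := X) g h0 h1 ((suspPair B).hom (X := X) i F) =
      (suspPair B).hom (X := X) i (subst (X := X) g h0 h1 F) :=
  MaxTensor.susp_ext fun s => by
    rw [subst_apply, suspPair_hom_apply, suspPair_hom_apply, subst_apply]

theorem suspPair_actsTrivially (m : 𝓜(ℂ, Susp (MaxTensor B Compacts))) (hm : star m * m = 1) :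
    (conj (X := X) m hm).ActsTrivially A :=
  conj_actsTrivially_of_stable (MaxTensor.suspEquiv B).symm A m hm

open HomotopyClasses in
/-- On `⟦A, S(B ⊗ K)⟧_X` loop composition agrees with the direct sum. -/
theorem loop_eq_pairOp :
    op (X := X) (A := A) firstHalf secondHalf (halves_orthogonal X (MaxTensor B Compacts)) =
      pairOp (suspPair B) := by
  refine EckmannHilton.mul (e₁ := mk 0) (e₂ := mk 0)
    { left_id := op_zero_left _ (secondHalf_actsTrivially A)
      right_id := op_zero_right _ (firstHalf_actsTrivially A) }
    { left_id := op_zero_left _ (suspPair_actsTrivially _ _)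
      right_id := op_zero_right _ (suspPair_actsTrivially _ _) } ?_
  exact op_interchange _ _ (suspPair_hom_subst 0 _ _ _) (suspPair_hom_subst 1 _ _ _)
      (suspPair_hom_subst 0 _ _ _) (suspPair_hom_subst 1 _ _ _)

variable (X A B) in
/-- The abelian group structure on `⟦A, S(B ⊗ K)⟧_X`. -/
@[reducible]
def suspGroup : AddCommGroup (HomotopyClasses X A (Susp (MaxTensor B Compacts))) :=
  { (@Additive.addGroup _ (HomotopyClasses.loopGroup X A (MaxTensor B Compacts)) :
      AddGroup (HomotopyClasses X A (Susp (MaxTensor B Compacts)))) with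
    -- The group structure, with its inverses, is that of loop composition; commutativity is
    -- inherited from the direct sum.
    add_comm := fun x y => by
      change HomotopyClasses.op _ _ (halves_orthogonal X (MaxTensor B Compacts)) x y =
        HomotopyClasses.op _ _ (halves_orthogonal X (MaxTensor B Compacts)) y x
      rw [loop_eq_pairOp]
      exact (HomotopyClasses.pairMonoid suspPair_actsTrivially (suspPair B)).add_comm x y }

end Multiplier

/-! ### The theorem -/

open Multiplier HomotopyClasses in
theorem theorem3p15 {X : Type*} [TopologicalSpace X] [LocallyCompactSpace X] [T2Space X]
    {A B : Type*} [NonUnitalCStarAlgebra A] [NonUnitalCStarAlgebra B]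
    [C0Algebra X A] [C0Algebra X B] :
    -- direct sum
    (IsC0Stable X B →
      (∃ θ : CStarMatrix (Fin 2) (Fin 2) B ≃⋆ₐ[ℂ] B, IsStabilizationIso X θ) ∧
      ∀ θ : CStarMatrix (Fin 2) (Fin 2) B ≃⋆ₐ[ℂ] B, IsStabilizationIso X θ →
        ∃ _ : AddCommMonoid (HomotopyClasses X A B),
          (0 : HomotopyClasses X A B) = HomotopyClasses.mk 0 ∧
          ∀ ψ φ : AsymptoticMorphism X A B, ∃ χ : AsymptoticMorphism X A B,
            AsymptoticMorphism.IsDirectSum θ ψ φ χ ∧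
            HomotopyClasses.mk ψ + HomotopyClasses.mk φ = HomotopyClasses.mk χ) ∧
    -- loop composition
    (∃ _ : Group (HomotopyClasses X A (Susp B)),
      ∀ ψ φ : AsymptoticMorphism X A (Susp B), ∃ χ : AsymptoticMorphism X A (Susp B),
        AsymptoticMorphism.IsLoopComposition ψ φ χ ∧
        HomotopyClasses.mk ψ * HomotopyClasses.mk φ = HomotopyClasses.mk χ) ∧
    -- the two operations agree
    ((∃ θ : CStarMatrix (Fin 2) (Fin 2) (Susp (MaxTensor B Compacts)) ≃⋆ₐ[ℂ]
        Susp (MaxTensor B Compacts), IsStabilizationIso X θ) ∧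
      ∃ _ : AddCommGroup (HomotopyClasses X A (Susp (MaxTensor B Compacts))),
        (0 : HomotopyClasses X A (Susp (MaxTensor B Compacts))) = HomotopyClasses.mk 0 ∧
        ∀ ψ φ : AsymptoticMorphism X A (Susp (MaxTensor B Compacts)),
          (∃ χ : AsymptoticMorphism X A (Susp (MaxTensor B Compacts)),
            AsymptoticMorphism.IsLoopComposition ψ φ χ ∧
            HomotopyClasses.mk ψ + HomotopyClasses.mk φ = HomotopyClasses.mk χ) ∧
          ∀ θ : CStarMatrix (Fin 2) (Fin 2) (Susp (MaxTensor B Compacts)) ≃⋆ₐ[ℂ]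
            Susp (MaxTensor B Compacts), IsStabilizationIso X θ →
            ∃ χ : AsymptoticMorphism X A (Susp (MaxTensor B Compacts)),
              AsymptoticMorphism.IsDirectSum θ ψ φ χ ∧
              HomotopyClasses.mk ψ + HomotopyClasses.mk φ = HomotopyClasses.mk χ) := by
  -- The algebra `C` of the stabilization is `B` itself for a stable `B`, and `SB` for `S(B ⊗ K)`.
  refine ⟨fun ⟨ρ, hρ⟩ => ⟨⟨_, isStabilizationIso_matrixEquiv ρ hρ⟩, fun θ hθ => ?_⟩,
    ⟨loopGroup X A B, fun ψ φ => ⟨_, isLoopComposition_orthSum ψ φ, rfl⟩⟩,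
    ⟨_, isStabilizationIso_matrixEquiv (MaxTensor.suspEquiv B).symm fun f F => ?_⟩,
    suspGroup X A B, rfl, fun ψ φ => ⟨⟨_, isLoopComposition_orthSum ψ φ, rfl⟩, fun θ hθ => ?_⟩⟩
  · obtain ⟨P, hP⟩ := exists_isometryPair_of_isStabilizationIso hθ
    exact ⟨pairMonoid (conj_actsTrivially_of_stable ρ A) P, rfl, fun ψ φ =>
      ⟨orthSum (P.hom 0) (P.hom 1) (P.hom_orthogonal X) ψ φ, fun t a => (hP _ _).symm, rfl⟩⟩
  · refine EquivLike.injective (MaxTensor.suspEquiv B) ?_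
    rw [MaxTensor.suspEquiv_act, StarAlgEquiv.apply_symm_apply, StarAlgEquiv.apply_symm_apply]
  · obtain ⟨P, hP⟩ := exists_isometryPair_of_isStabilizationIso hθ
    refine ⟨orthSum (P.hom 0) (P.hom 1) (P.hom_orthogonal X) ψ φ, fun t a => (hP _ _).symm, ?_⟩
    -- The sum formed with `θ` equals the one formed with the standard pair, which is loop
    -- composition.
    refine Eq.trans ?_ (pairOp_eq_pairOp suspPair_actsTrivially (suspPair B) P (mk ψ) (mk φ))
    rw [← loop_eq_pairOp]
    rfl
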